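/- **Conventions.** A *triangulation* is a finite collection of tetrahedra $i(0123)$, some or all of whose triangular faces are glued together in pairs by affine maps, such that no edge becomes identified with itself in reverse. A gluing is written $i(abc)\mapsto j(def)$, meaning $a\mapsto d$, $b\mapsto e$, $c\mapsto f$. Faces that are not glued are *boundary faces*; the triangulation is *bounded* if there is at least one. It *represents a 3-manifold* if every vertex link is a sphere or a disc (i.e. is without boundary and has Euler characteristic $2$, or has non-empty boundary and Euler characteristic $1$). Each tetrahedron has four types of normal triangles (one around each vertex) and three types of normal quadrilaterals (one for each way of separating the vertices into two pairs); each face has three types of normal arcs, one around each of its vertices. For a triangulation with $n$ tetrahedra, let $C\subseteq\mathbb{R}_{\ge 0}^{7n}$ be the cone of non-negative vectors (one coordinate for each triangle or quadrilateral type of each tetrahedron) that satisfy the matching equations: for each pair of glued faces and each arc type, the numbers of arcs of that type coming from the two sides agree. A *vertex normal surface* is (given by) a non-zero integer vector that lies on an extremal ray of $C$, is the smallest non-zero integer point on that ray, and has at most one non-zero quadrilateral coordinate in each tetrahedron. Let $\sigma(\mathcal{T})$ denote the number of vertex normal surfaces of $\mathcal{T}$. **Statement.** Let $\mathcal{G}$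 be given by the tetrahedra $0,\dots,10$ and the following gluings (all other faces are boundary faces): - $0(013)\mapsto 1(012)$, $0(023)\mapsto 2(021)$; - $1(013)\mapsto 3(012)$, $1(023)\mapsto 4(021)$; - $2(013)\mapsto 5(012)$, $2(023)\mapsto 6(021)$; - $i(013)\mapsto (i+4)(231)$, $i(023)\mapsto (i+4)(023)$ for $i=3,4,5,6$. Then $\mathcal{G}$ is a bounded triangulation with $11$ tetrahedra that represents a 3-manifold. The face $f_0=0(012)$ is a boundary face whose three vertices are not all identified in $\mathcal{G}$, and exactly $\alpha_0=31\,643$ vertex normal surfaces of $\mathcal{G}$ meet $f_0$ in at least one normal arc around vertex $0$ and in no other type of normal arc. Moreover, there are triangulations $\mathcal{G}_k$ with boundary faces $f_k$, $k\ge 0$, where $(\mathcal{G}_0,f_0)$ is as above and, for every $k \geq 0$, $\mathcal{G}_{k+1}$ is obtained from two copies of $\mathcal{G}_k$ and one new tetrahedron by gluing the face $f_k$ of each copy to a face of the new tetrahedron (two different faces for the two copies), $f_{k+1}$ being one of the two free faces of the new tetrahedron, such that every $\mathcal{G}_k$ is bounded, represents a 3-manifold, has $$n_k=12\cdot 2^k-1$$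 tetrahedra, and satisfies $$\sigma(\mathcal{G}_k)\ \ge\ 2.3715^{\,n_k}.$$ -/

import Mathlib

/-- Face gluings of a collection of tetrahedra indexed by `ι`, each with vertices `0, 1, 2, 3`.
Face `f` of a tetrahedron is the triangle opposite vertex `f`. The value `none` means a boundary
face. The value `some (j, p)` means that face `f` of tetrahedron `i` is glued to face `p f` of
tetrahedron `j`, each vertex `v ≠ f` of the face going to vertex `p v`. (An affine identification
of two triangles is a bijection of their vertices, and such a bijection extends uniquely to a
permutation of `{0, 1, 2, 3}` that sends opposite vertex to opposite vertex.) -/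
abbrev Gluing (ι : Type) : Type := ι → Fin 4 → Option (ι × Equiv.Perm (Fin 4))

/-- One gluing identifies the corner `(i, a)` (vertex `a` of tetrahedron `i`) with `(j, p a)`. -/
inductive VertexStep {ι : Type} (g : Gluing ι) : ι × Fin 4 → ι × Fin 4 → Prop
  | mk (i j : ι) (f a : Fin 4) (p : Equiv.Perm (Fin 4)) :
      g i f = some (j, p) → a ≠ f → VertexStep g (i, a) (j, p a)

/-- One gluing identifies the directed edge `(i, a, b)` (from vertex `a` to vertex `b` of
tetrahedron `i`) with the directed edge `(j, p a, p b)`. -/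
inductive EdgeStep {ι : Type} (g : Gluing ι) : ι × Fin 4 × Fin 4 → ι × Fin 4 × Fin 4 → Prop
  | mk (i j : ι) (f a b : Fin 4) (p : Equiv.Perm (Fin 4)) :
      g i f = some (j, p) → a ≠ f → b ≠ f → EdgeStep g (i, a, b) (j, p a, p b)

/-- One gluing identifies the normal arc type `(i, a, f)` (the arc around vertex `a` in face `f`
of tetrahedron `i`) with the arc type `(j, p a, p f)`. -/
inductive ArcStep {ι : Type} (g : Gluing ι) : ι × Fin 4 × Fin 4 → ι × Fin 4 × Fin 4 → Prop
  | mk (i j : ι) (f a : Fin 4) (p : Equiv.Perm (Fin 4)) :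
      g i f = some (j, p) → a ≠ f → ArcStep g (i, a, f) (j, p a, p f)

/-- A (generalised) triangulation: finitely many tetrahedra, some or all of whose faces are glued
together in pairs, such that no edge is identified with itself in reverse. -/
structure Triangulation where
  Tet : Type
  finite : Finite Tet
  glue : Gluing Tet
  glue_symm : ∀ i f j p, glue i f = some (j, p) → glue j (p f) = some (i, p⁻¹)
  glue_ne_self : ∀ i f j p, glue i f = some (j, p) → (j, p f) ≠ (i, f)
  edge_not_reversed : ∀ i a b, a ≠ b → ¬ Relation.EqvGen (EdgeStep glue) (i, a, b) (i, b, a)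

namespace Triangulation

variable (T : Triangulation)

/-- The number of tetrahedra. -/
noncomputable def numTet : ℕ := Nat.card T.Tet

/-- A face of a tetrahedron: `(i, f)` is the face opposite vertex `f` of tetrahedron `i`. -/
abbrev Face : Type := T.Tet × Fin 4

def IsBoundaryFace (F : T.Face) : Prop := T.glue F.1 F.2 = none

/-- A bounded triangulation: the set of boundary faces is non-empty. -/
def IsBounded : Prop := ∃ F : T.Face, T.IsBoundaryFace F

/-- Two corners of tetrahedra are the same vertex of the triangulation. -/
def SameVertex : T.Tet × Fin 4 → T.Tet × Fin 4 → Prop := Relation.EqvGen (VertexStep T.glue)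

/-! ### Vertex links and the manifold condition

The link of the vertex represented by the corner `v` is made of one normal triangle for each
corner identified with `v`. The triangle at the corner `(i, a)` has the three sides `(i, a, f)`,
`f ≠ a` (the arc around `a` in face `f`), and the three vertices `(i, a, b)`, `b ≠ a` (the point of
the edge from `a` to `b` close to `a`). The sides and vertices are identified as the gluings
prescribe. The result is always a connected compact surface. -/

def edgeSetoid : Setoid (T.Tet × Fin 4 × Fin 4) := Relation.EqvGen.setoid (EdgeStep T.glue)

def arcSetoid : Setoid (T.Tet × Fin 4 × Fin 4) := Relation.EqvGen.setoid (ArcStep T.glue)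

def linkTriangles (v : T.Tet × Fin 4) : Set (T.Tet × Fin 4) := {c | T.SameVertex v c}

/-- The triples `(i, a, b)` with `(i, a)` in the link and `b ≠ a`. They index the vertices of the
triangles of the link as well as their sides, before identification. -/
def linkFlags (v : T.Tet × Fin 4) : Set (T.Tet × Fin 4 × Fin 4) :=
  {s | (s.1, s.2.1) ∈ T.linkTriangles v ∧ s.2.2 ≠ s.2.1}

def linkVertices (v : T.Tet × Fin 4) : Set (Quotient T.edgeSetoid) :=
  Quotient.mk T.edgeSetoid '' T.linkFlags v

def linkEdges (v : T.Tet × Fin 4) : Set (Quotient T.arcSetoid) :=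
  Quotient.mk T.arcSetoid '' T.linkFlags v

noncomputable def linkEulerChar (v : T.Tet × Fin 4) : ℤ :=
  (T.linkVertices v).ncard - (T.linkEdges v).ncard + (T.linkTriangles v).ncard

/-- The link has a boundary edge, i.e. one of its sides lies in a boundary face. -/
def LinkHasBoundary (v : T.Tet × Fin 4) : Prop :=
  ∃ s ∈ T.linkFlags v, T.IsBoundaryFace (s.1, s.2.2)

/-- A connected compact surface is a sphere iff it has no boundary and Euler characteristic `2`. -/
def LinkIsSphere (v : T.Tet × Fin 4) : Prop := ¬ T.LinkHasBoundary v ∧ T.linkEulerChar v = 2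

/-- A connected compact surface is a disc iff it has a boundary and Euler characteristic `1`. -/
def LinkIsDisc (v : T.Tet × Fin 4) : Prop := T.LinkHasBoundary v ∧ T.linkEulerChar v = 1

/-- The triangulation represents a 3-manifold, possibly with boundary: every vertex link is a
sphere or a disc (and no edge is identified with itself in reverse). -/
def IsManifold : Prop := ∀ v : T.Tet × Fin 4, T.LinkIsSphere v ∨ T.LinkIsDisc v

/-! ### Normal surfaces -/

/-- The quadrilateral type `q` separates the vertices `0` and `q + 1` of the tetrahedron from the
other two. -/
def SameSide (q : Fin 3) (a b : Fin 4) : Prop := (a = 0 ∨ a = q.succ) ↔ (b = 0 ∨ b = q.succ)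

instance (q : Fin 3) (a b : Fin 4) : Decidable (SameSide q a b) := by
  unfold SameSide; infer_instance

/-- Indices of normal coordinates: `(i, Sum.inl a)` stands for the triangles around vertex `a` in
tetrahedron `i`, and `(i, Sum.inr q)` for the quadrilaterals of type `q` in tetrahedron `i`. -/
abbrev Piece : Type := T.Tet × (Fin 4 ⊕ Fin 3)

variable {T}

/-- The number of normal arcs around vertex `a` in the face opposite vertex `f` (`a ≠ f`) of
tetrahedron `i`. The triangles around `a` contribute, and so do the quadrilaterals that
separate `a` and `f` from the other two vertices. -/
def arcs {R : Type} [AddCommMonoid R] (x : T.Piece → R) (i : T.Tet) (f a : Fin 4) : R :=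
  x (i, Sum.inl a) + ∑ q : Fin 3, if SameSide q a f then x (i, Sum.inr q) else 0

/-- The matching equations: one for each arc type of each internal face. -/
def Matching {R : Type} [AddCommMonoid R] (x : T.Piece → R) : Prop :=
  ∀ i f j p, T.glue i f = some (j, p) → ∀ a, a ≠ f → arcs x i f a = arcs x j (p f) (p a)

/-- The quadrilateral constraints: at most one quadrilateral type occurs in each tetrahedron. -/
def QuadConstraints (x : T.Piece → ℕ) : Prop :=
  ∀ i q q', x (i, Sum.inr q) ≠ 0 → x (i, Sum.inr q') ≠ 0 → q = q'

/-- The polyhedral cone of non-negative real solutions of the matching equations. -/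
def InCone (x : T.Piece → ℝ) : Prop := (∀ c, 0 ≤ x c) ∧ Matching x

/-- `x` spans an extremal ray of the cone. -/
def OnExtremalRay (x : T.Piece → ℝ) : Prop :=
  InCone x ∧ x ≠ 0 ∧ ∀ y z, InCone y → InCone z → y + z = x → ∃ t : ℝ, y = t • x

/-- `x` is the vector of normal coordinates of a vertex normal surface: it is admissible, it lies
on an extremal ray, and it is minimal among the non-zero integer points of this ray. -/
def IsVertexNormal (x : T.Piece → ℕ) : Prop :=
  QuadConstraints x ∧ OnExtremalRay (fun c => (x c : ℝ)) ∧
    ∀ y : T.Piece → ℕ, y ≠ 0 → (∃ t : ℝ, (fun c => (y c : ℝ)) = t • fun c => (x c : ℝ)) → x ≤ y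

variable (T)

/-- The number of vertex normal surfaces. -/
noncomputable def sigma : ℕ := {x : T.Piece → ℕ | IsVertexNormal x}.ncard

/-- The number of vertex normal surfaces that meet the face `F` in at least one arc around its
vertex `a`, but in no other normal arc types. -/
noncomputable def alpha (F : T.Face) (a : Fin 4) : ℕ :=
  {x : T.Piece → ℕ | IsVertexNormal x ∧ 0 < arcs x F.1 F.2 a ∧
    ∀ b, b ≠ F.2 → b ≠ a → arcs x F.1 F.2 b = 0}.ncard

end Triangulation

/-- A triangulation with a chosen face. -/
abbrev MarkedTriangulation : Type 1 := (T : Triangulation) × T.Face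

/-- `N` arises from `M` by taking two copies of the triangulation of `M` (indexed by `Bool`) and
one new tetrahedron (indexed by `none`), and gluing the marked boundary face of each copy to a face
of the new tetrahedron; the marked face of `N` is one of the two free faces of the new tetrahedron. -/
def IsDoubling (M N : MarkedTriangulation) : Prop :=
  M.1.IsBoundaryFace M.2 ∧
  ∃ (e : Option (Bool × M.1.Tet) ≃ N.1.Tet) (p : Bool → Equiv.Perm (Fin 4)),
    p true M.2.2 ≠ p false M.2.2 ∧
    (∀ b i f, (i, f) ≠ M.2 → N.1.glue (e (some (b, i))) f =
      (M.1.glue i f).map fun jq => (e (some (b, jq.1)), jq.2)) ∧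
    (∀ b, N.1.glue (e (some (b, M.2.1))) M.2.2 = some (e none, p b)) ∧
    (∀ f, (∀ b, f ≠ p b M.2.2) → N.1.glue (e none) f = none) ∧
    N.2.1 = e none ∧ ∀ b, N.2.2 ≠ p b M.2.2

namespace TriG

open Equiv in
/-- The gluings of an explicit triangulation with tetrahedra `0, …, 10`. The four entries of a row
belong to the faces opposite the vertices `0, 1, 2, 3`, i.e. to the triangles
`(123), (023), (013), (012)` in this order. For example `0(013)` is glued to `1(012)`, `0(023)` to
`2(021)`, `3(023)` to `7(023)`, and `3(013)` to `7(231)`. -/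
def glue : Gluing (Fin 11) := ![
  ![none, some (2, swap 1 3), some (1, swap 2 3), none],
  ![none, some (4, swap 1 3), some (3, swap 2 3), some (0, swap 2 3)],
  ![none, some (6, swap 1 3), some (5, swap 2 3), some (0, swap 1 3)],
  ![none, some (7, 1), some (7, swap 0 2 * swap 1 3), some (1, swap 2 3)],
  ![none, some (8, 1), some (8, swap 0 2 * swap 1 3), some (1, swap 1 3)],
  ![none, some (9, 1), some (9, swap 0 2 * swap 1 3), some (2, swap 2 3)],
  ![none, some (10, 1), some (10, swap 0 2 * swap 1 3), some (2, swap 1 3)],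
  ![some (3, swap 0 2 * swap 1 3), some (3, 1), none, none],
  ![some (4, swap 0 2 * swap 1 3), some (4, 1), none, none],
  ![some (5, swap 0 2 * swap 1 3), some (5, 1), none, none],
  ![some (6, swap 0 2 * swap 1 3), some (6, 1), none, none]]

/-- A linear order on the vertices of each tetrahedron which all gluings respect; it shows that no
edge is identified with itself in reverse. -/
def rank (i : Fin 11) : Fin 4 → Fin 4 := if i < 7 then ![0, 3, 1, 2] else ![0, 2, 1, 3]

theorem rank_step : ∀ (i : Fin 11) (f : Fin 4), ∀ jp ∈ glue i f, ∀ a b, a ≠ f → b ≠ f →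
    (rank i a < rank i b ↔ rank jp.1 (jp.2 a) < rank jp.1 (jp.2 b)) := by
  decide +kernel

theorem rank_eqvGen {s t : Fin 11 × Fin 4 × Fin 4} (h : Relation.EqvGen (EdgeStep glue) s t) :
    (rank s.1 s.2.1 < rank s.1 s.2.2 ↔ rank t.1 t.2.1 < rank t.1 t.2.2) := by
  induction h with
  | rel _ _ h =>
    obtain ⟨i, j, f, a, b, p, hg, ha, hb⟩ := h
    exact rank_step i f (j, p) hg a b ha hb
  | refl => rfl
  | symm _ _ _ ih => exact ih.symm
  | trans _ _ _ _ _ ih₁ ih₂ => exact ih₁.trans ih₂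

theorem rank_total : ∀ (i : Fin 11) (a b : Fin 4), a ≠ b →
    ¬ (rank i a < rank i b ↔ rank i b < rank i a) := by
  decide +kernel

theorem glue_symm : ∀ (i : Fin 11) (f : Fin 4), ∀ jp ∈ glue i f,
    glue jp.1 (jp.2 f) = some (i, jp.2⁻¹) := by
  decide +kernel

theorem glue_ne_self : ∀ (i : Fin 11) (f : Fin 4), ∀ jp ∈ glue i f, (jp.1, jp.2 f) ≠ (i, f) := by
  decide +kernel

end TriG

/-- The explicit triangulation with 11 tetrahedra. -/
def triG : Triangulation where
  Tet := Fin 11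
  finite := inferInstance
  glue := TriG.glue
  glue_symm i f j p h := TriG.glue_symm i f (j, p) h
  glue_ne_self i f j p h := TriG.glue_ne_self i f (j, p) h
  edge_not_reversed i a b hab h := TriG.rank_total i a b hab (TriG.rank_eqvGen h)

/-- The face `(012)` of tetrahedron `0`. -/
def triGFace : triG.Face := ((0 : Fin 11), 3)

/-! ### Polyhedral cones and their extremal rays -/

namespace PolyCone

variable {ι : Type}

/-! Growth. The surfaces to follow are those that meet the marked face in arcs around vertex 0 only,
since doubling at least squares their number. For such a surface in a double, two triangle types and
two quadrilateral types of the new tetrahedron do not occur, and the three remaining coordinates are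
the numbers of arcs of the restriction to one copy on its marked face. So these surfaces correspond
to pairs (x, y) of vectors in the matching cone of one copy whose boundary values in ℝ³ agree once
the last two are exchanged. Vectors without other arcs form a face of the cone, so extremal rays
correspond to extremal rays of this fibre product (`IsStdDoubling.isRay_extend_iff`,
`IsStdDoubling.alpha_eq`). Two extremal rays with boundary values (a,0,0) and (b,0,0) can be
rescaled to fit, and they then form an extremal pair; hence α(double) ≥ α²
(`IsStdDoubling.sq_alpha_le`). Starting from 31643 this gives σ ≥ 31643^(2^k), and n_k + 1 = 12·2^k
with 2.3715^12 ≤ 31643 gives the bound.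

The value 31643. The explicit triangulation is itself the double of a triangulation `triH` with five
tetrahedra, so extremal pairs over the cone of `triH` have to be counted. If x is extremal with
non-zero boundary, then the pair is extremal exactly if y is extremal in the slice of the cone whose
boundary values have the direction prescribed by x (`isPairRay_iff_of_isRay`); symmetrically for y.
If neither is extremal, a dimension count (`IsPairRay.eq_or_eq`) shows that each lies inside a
two-dimensional face, and the images of the two faces in the projective plane are segments that
cross in one interior point; this is a sign condition on 3×3 determinants (`crosses_iff`). Inclusion
and exclusion (`ncard_pairMasks`) gives 13471 + 13471 − 7135 + 11836.

The lists of rays come from the double description method, restricted to supports that satisfy the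
quadrilateral constraints and verified in `Enumerates.step`; the kernel runs it.

Manifold condition. Vertices 0 and 2 of the marked face are identified and vertex 1 is different
from them, and doubling preserves this (`isRooted_double`). The links that meet the face have Euler
characteristics 2·1 + 1 − 2 = 1 and 1 in the double, so discs remain discs; all other links are
copied (`IsGood.isManifold_double`). Vertex orders that are respected by the gluings exclude
reversed edges. -/

theorem support_smul {t : ℝ} (ht : t ≠ 0) (x : ι → ℝ) :
    Function.support (t • x) = Function.support x := by
  ext c; simp [ht]

theorem support_add_of_nonneg {x y : ι → ℝ} (hx : ∀ c, 0 ≤ x c) (hy : ∀ c, 0 ≤ y c) :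
    Function.support (x + y) = Function.support x ∪ Function.support y := by
  ext c
  have h1 := hx c
  have h2 := hy c
  simp only [Function.mem_support, Pi.add_apply, Set.mem_union]
  constructor
  · intro h
    by_contra! h'
    exact h (by rw [h'.1, h'.2, add_zero])
  · rintro (h | h) h'
    · exact h (by linarith)
    · exact h (by linarith)
variable [Fintype ι]

/-- The value of the linear form with integer coefficients `φ` at `x`. -/
def form (φ : ι → ℤ) (x : ι → ℝ) : ℝ := ∑ c, (φ c : ℝ) * x c

theorem form_add (φ : ι → ℤ) (x y : ι → ℝ) : form φ (x + y) = form φ x + form φ y := by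
  simp [form, mul_add, Finset.sum_add_distrib]

theorem form_smul (φ : ι → ℤ) (t : ℝ) (x : ι → ℝ) : form φ (t • x) = t * form φ x := by
  simp only [form, Pi.smul_apply, smul_eq_mul, Finset.mul_sum]
  exact Finset.sum_congr rfl fun c _ => by ring

theorem form_zero (φ : ι → ℤ) : form φ 0 = 0 := by simp [form]

theorem form_neg (φ : ι → ℤ) (x : ι → ℝ) : form φ (-x) = -form φ x := by simp [form]

theorem form_sub (φ : ι → ℤ) (x y : ι → ℝ) : form φ (x - y) = form φ x - form φ y := by
  rw [sub_eq_add_neg, form_add, form_neg, sub_eq_add_neg]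

/-- The cone of non-negative vectors at which all linear forms in `E` vanish. -/
def cone (E : Set (ι → ℤ)) : Set (ι → ℝ) := {x | (∀ c, 0 ≤ x c) ∧ ∀ φ ∈ E, form φ x = 0}

/-- A non-zero vector that spans an extremal ray, in terms of supports. -/
def IsRay (K : Set (ι → ℝ)) (x : ι → ℝ) : Prop :=
  x ∈ K ∧ x ≠ 0 ∧ ∀ y ∈ K, Function.support y ⊆ Function.support x → ∃ t : ℝ, y = t • x

variable {E : Set (ι → ℤ)} {x y v w z : ι → ℝ}

theorem add_mem_cone (hx : x ∈ cone E) (hy : y ∈ cone E) : x + y ∈ cone E :=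
  ⟨fun c => add_nonneg (hx.1 c) (hy.1 c), fun φ h => by
    rw [form_add, hx.2 φ h, hy.2 φ h, add_zero]⟩

theorem smul_mem_cone {t : ℝ} (ht : 0 ≤ t) (hx : x ∈ cone E) : t • x ∈ cone E :=
  ⟨fun c => mul_nonneg ht (hx.1 c), fun φ h => by rw [form_smul, hx.2 φ h, mul_zero]⟩

theorem exists_pos_coord (hx : x ∈ cone E) (h0 : x ≠ 0) : ∃ c, 0 < x c := by
  obtain ⟨c, hc⟩ := Function.ne_iff.1 h0
  exact ⟨c, lt_of_le_of_ne (hx.1 c) (Ne.symm hc)⟩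

/-- A vector of the cone whose support lies in that of `x` can be subtracted from `x` until the
support gets smaller. -/
theorem exists_sub_smul (hx : x ∈ cone E) (hy : y ∈ cone E) (hy0 : y ≠ 0)
    (hs : Function.support y ⊆ Function.support x) :
    ∃ t : ℝ, 0 < t ∧ x - t • y ∈ cone E ∧
      Function.support (x - t • y) ⊂ Function.support x := by
  classical
  obtain ⟨c₁, hc₁⟩ := exists_pos_coord hy hy0
  -- Ratio test: the smallest quotient `x c / y c` is the largest multiple of `y` that can be
  -- subtracted, and `c₀` leaves the support.
  obtain ⟨c₀, hc₀, hmin⟩ := Finset.exists_min_image (Finset.univ.filter fun c => 0 < y c)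
    (fun c => x c / y c) ⟨c₁, by simpa using hc₁⟩
  simp only [Finset.mem_filter, Finset.mem_univ, true_and] at hc₀ hmin
  have hx₀ : 0 < x c₀ := lt_of_le_of_ne (hx.1 c₀) (Ne.symm (hs (ne_of_gt hc₀)))
  refine ⟨x c₀ / y c₀, div_pos hx₀ hc₀, ⟨fun c => ?_, fun φ h => ?_⟩, ?_⟩
  · rcases (hy.1 c).eq_or_lt with h | h
    · simp [← h, hx.1 c]
    · have := hmin c h
      rw [le_div_iff₀ h] at this
      simpa using this
  · rw [form_sub, form_smul, hx.2 φ h, hy.2 φ h, mul_zero, sub_zero]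
  · refine ⟨fun c hc => ?_, fun h => ?_⟩
    · by_contra hxc
      have hyc : y c = 0 := by
        by_contra hne
        exact hxc (hs hne)
      have : x c = 0 := by simpa using hxc
      simp [this, hyc] at hc
    · have : c₀ ∈ Function.support (x - (x c₀ / y c₀) • y) := h (ne_of_gt hx₀)
      simp [div_mul_cancel₀ _ (ne_of_gt hc₀)] at this

/-- Descent on the size of the support: if `x` is not extremal, some vector below it is not a
multiple of it, and subtracting that vector shrinks the support without reaching zero. -/
theorem exists_ray_le (hx : x ∈ cone E) (h0 : x ≠ 0) :
    ∃ r, IsRay (cone E) r ∧ Function.support r ⊆ Function.support x := by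
  induction h : (Function.support x).ncard using Nat.strong_induction_on generalizing x with
  | _ n ih =>
    by_cases hr : IsRay (cone E) x
    · exact ⟨x, hr, subset_rfl⟩
    · have : ∃ y ∈ cone E, Function.support y ⊆ Function.support x ∧ ∀ t : ℝ, y ≠ t • x := by
        by_contra! hcon
        exact hr ⟨hx, h0, fun y hy hs => hcon y hy hs⟩
      obtain ⟨y, hy, hs, hne⟩ := this
      have hy0 : y ≠ 0 := fun h => hne 0 (by simp [h])
      obtain ⟨t, ht, hmem, hss⟩ := exists_sub_smul hx hy hy0 hs
      have hx' : x - t • y ≠ 0 := by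
        intro h
        apply hne t⁻¹
        rw [sub_eq_zero.1 h, smul_smul, inv_mul_cancel₀ ht.ne', one_smul]
      obtain ⟨r, hr, hrs⟩ := ih _ (h ▸ Set.ncard_lt_ncard hss (Set.toFinite _)) hmem hx' rfl
      exact ⟨r, hr, hrs.trans hss.subset⟩

theorem IsRay.smul {t : ℝ} (ht : 0 < t) (hx : IsRay (cone E) x) : IsRay (cone E) (t • x) := by
  refine ⟨smul_mem_cone ht.le hx.1, smul_ne_zero ht.ne' hx.2.1, fun y hy hs => ?_⟩
  rw [support_smul ht.ne'] at hs
  obtain ⟨s, rfl⟩ := hx.2.2 y hy hs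
  exact ⟨s / t, by rw [smul_smul, div_mul_cancel₀ _ ht.ne']⟩

/-- With `y` a second ray this shows that a ray is determined by its support, which is why rays can
be recorded as bit masks. -/
theorem IsRay.exists_eq_smul (hx : IsRay (cone E) x) (hy : y ∈ cone E) (hy0 : y ≠ 0)
    (hs : Function.support y ⊆ Function.support x) : ∃ t : ℝ, 0 < t ∧ y = t • x := by
  obtain ⟨t, rfl⟩ := hx.2.2 y hy hs
  refine ⟨t, ?_, rfl⟩
  obtain ⟨c, hc⟩ := exists_pos_coord hy hy0
  exact pos_of_mul_pos_left hc (hx.1.1 c)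

theorem IsRay.support_eq (hx : IsRay (cone E) x) (hy : y ∈ cone E) (hy0 : y ≠ 0)
    (hs : Function.support y ⊆ Function.support x) :
    Function.support y = Function.support x := by
  obtain ⟨t, ht, rfl⟩ := hx.exists_eq_smul hy hy0 hs
  exact support_smul ht.ne' x

/-- Every vector of the cone is a sum of extremal ones whose supports lie in its own. -/
theorem mem_closure_rays (hx : x ∈ cone E) :
    x ∈ AddSubmonoid.closure
      {r | IsRay (cone E) r ∧ Function.support r ⊆ Function.support x} := by
  induction h : (Function.support x).ncard using Nat.strong_induction_on generalizing x with
  | _ n ih =>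
    by_cases h0 : x = 0
    · rw [h0]; exact zero_mem _
    obtain ⟨r, hr, hrs⟩ := exists_ray_le hx h0
    obtain ⟨t, ht, hmem, hss⟩ := exists_sub_smul hx hr.1 hr.2.1 hrs
    have h1 := ih _ (h ▸ Set.ncard_lt_ncard hss (Set.toFinite _)) hmem rfl
    have h2 := AddSubmonoid.closure_mono (t := {r | IsRay (cone E) r ∧
      Function.support r ⊆ Function.support x}) (fun s hs => ⟨hs.1, hs.2.trans hss.subset⟩) h1
    have h3 : t • r ∈ AddSubmonoid.closure {r | IsRay (cone E) r ∧
        Function.support r ⊆ Function.support x} :=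
      AddSubmonoid.subset_closure ⟨hr.smul ht, by rwa [support_smul ht.ne']⟩
    simpa using add_mem h2 h3

/-- If all extremal rays below `x` are multiples of `v` or of `w`, then `x` is a combination
of `v` and `w`. -/
theorem exists_eq_add_of_rays (hx : x ∈ cone E)
    (h : ∀ z, IsRay (cone E) z → Function.support z ⊆ Function.support x →
      ∃ a b : ℝ, 0 ≤ a ∧ 0 ≤ b ∧ z = a • v + b • w) :
    ∃ a b : ℝ, 0 ≤ a ∧ 0 ≤ b ∧ x = a • v + b • w := by
  have hmem := mem_closure_rays hx
  clear hx
  revert hmem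
  -- The set of rays stays fixed during the induction, while the vector that is decomposed varies.
  generalize hS : {r | IsRay (cone E) r ∧ Function.support r ⊆ Function.support x} = S
  intro hmem
  replace h : ∀ z ∈ S, ∃ a b : ℝ, 0 ≤ a ∧ 0 ≤ b ∧ z = a • v + b • w := by
    rw [← hS]; exact fun z hz => h z hz.1 hz.2
  clear hS
  induction hmem using AddSubmonoid.closure_induction with
  | mem z hz => exact h z hz
  | zero => exact ⟨0, 0, le_rfl, le_rfl, by simp⟩
  | add y z _ _ hy hz =>
    obtain ⟨a, b, ha, hb, rfl⟩ := hy
    obtain ⟨a', b', ha', hb', rfl⟩ := hz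
    exact ⟨a + a', b + b', by positivity, by positivity, by module⟩

/-! ### Intersecting with a hyperplane -/

variable {φ : ι → ℤ}

theorem mem_cone_insert : x ∈ cone (insert φ E) ↔ x ∈ cone E ∧ form φ x = 0 := by
  simp only [cone, Set.mem_ofPred_eq, Set.forall_mem_insert]
  tauto

theorem IsRay.insert (hx : IsRay (cone E) x) (h : form φ x = 0) : IsRay (cone (insert φ E)) x :=
  ⟨mem_cone_insert.2 ⟨hx.1, h⟩, hx.2.1, fun y hy hs => hx.2.2 y (mem_cone_insert.1 hy).1 hs⟩

/-- The combination of `v` and `w` at which the form `φ` vanishes. -/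
noncomputable def mix (φ : ι → ℤ) (v w : ι → ℝ) : ι → ℝ := (-form φ w) • v + form φ v • w

theorem form_mix (v w : ι → ℝ) (φ : ι → ℤ) : form φ (mix φ v w) = 0 := by
  rw [mix, form_add, form_smul, form_smul]; ring

theorem support_mix (hv : v ∈ cone E) (hw : w ∈ cone E) (hpv : 0 < form φ v)
    (hpw : form φ w < 0) :
    Function.support (mix φ v w) = Function.support v ∪ Function.support w := by
  have h1 : 0 < -form φ w := by linarith
  rw [mix, support_add_of_nonneg (smul_mem_cone h1.le hv).1 (smul_mem_cone hpv.le hw).1,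
    support_smul h1.ne', support_smul hpv.ne']

theorem mix_mem_cone (hv : v ∈ cone E) (hw : w ∈ cone E) (hpv : 0 < form φ v)
    (hpw : form φ w < 0) : mix φ v w ∈ cone (insert φ E) :=
  mem_cone_insert.2 ⟨add_mem_cone (smul_mem_cone (by linarith) hv) (smul_mem_cone hpv.le hw),
    form_mix v w φ⟩

/-- By `hadj` the face of the cone below `v` and `w` is spanned by these two, so its vectors are `a
• v + b • w`; the equation for `φ` fixes the ratio of `a` and `b`. -/
theorem isRay_mix (hv : IsRay (cone E) v) (hw : IsRay (cone E) w) (hpv : 0 < form φ v)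
    (hpw : form φ w < 0)
    (hadj : ∀ z, IsRay (cone E) z →
      Function.support z ⊆ Function.support v ∪ Function.support w →
      Function.support z = Function.support v ∨ Function.support z = Function.support w) :
    IsRay (cone (insert φ E)) (mix φ v w) := by
  refine ⟨mix_mem_cone hv.1 hw.1 hpv hpw, ?_, fun y hy hs => ?_⟩
  · intro h
    have := support_mix hv.1 hw.1 hpv hpw
    rw [h, Function.support_zero] at this
    obtain ⟨c, hc⟩ := exists_pos_coord hv.1 hv.2.1
    have h2 : c ∈ Function.support v ∪ Function.support w := Or.inl hc.ne'
    rw [← this] at h2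
    exact h2
  · rw [support_mix hv.1 hw.1 hpv hpw] at hs
    obtain ⟨hyE, hy0⟩ := mem_cone_insert.1 hy
    obtain ⟨a, b, -, -, rfl⟩ := exists_eq_add_of_rays (v := v) (w := w) hyE (fun z hz hzs => by
      rcases hadj z hz (hzs.trans hs) with h | h
      · obtain ⟨t, ht, rfl⟩ := hv.exists_eq_smul hz.1 hz.2.1 h.le
        exact ⟨t, 0, ht.le, le_rfl, by simp⟩
      · obtain ⟨t, ht, rfl⟩ := hw.exists_eq_smul hz.1 hz.2.1 h.le
        exact ⟨0, t, le_rfl, ht.le, by simp⟩)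
    rw [form_add, form_smul, form_smul] at hy0
    have hb : b = a / (-form φ w) * form φ v := by
      have : -form φ w ≠ 0 := by linarith
      rw [div_mul_eq_mul_div, eq_div_iff this]
      linarith
    refine ⟨a / (-form φ w), ?_⟩
    have : a = a / (-form φ w) * (-form φ w) := by
      rw [div_mul_cancel₀]; linarith
    rw [mix, smul_add, smul_smul, smul_smul, ← this, ← hb]

/-- If `φ` vanishes at `x` but at no extremal ray below `x`, then it is positive at one of them. -/
theorem exists_ray_form_pos (hx : x ∈ cone E) (hx0 : x ≠ 0) (hφ : form φ x = 0)
    (key : ∀ z, IsRay (cone E) z → Function.support z ⊆ Function.support x → form φ z ≠ 0) :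
    ∃ v, IsRay (cone E) v ∧ Function.support v ⊆ Function.support x ∧ 0 < form φ v := by
  by_contra! hcon
  have : ∀ y ∈ AddSubmonoid.closure {r | IsRay (cone E) r ∧
      Function.support r ⊆ Function.support x}, y = 0 ∨ form φ y < 0 := by
    intro y hy
    induction hy using AddSubmonoid.closure_induction with
    | mem z hz => exact Or.inr (lt_of_le_of_ne (hcon z hz.1 hz.2) (key z hz.1 hz.2))
    | zero => exact Or.inl rfl
    | add y z _ _ hy hz =>
      rw [form_add]
      rcases hy with rfl | hy
      · simpa [form_zero] using hz
      · rcases hz with rfl | hz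
        · exact Or.inr (by simpa [form_zero] using hy)
        · exact Or.inr (add_neg hy hz)
  rcases this x (mem_closure_rays hx) with h | h
  · exact hx0 h
  · linarith

/-- Two extremal rays in the plane through `v` and on the same side of it coincide. -/
theorem IsRay.support_eq_of_add_eq (hw : IsRay (cone E) w) (hz : IsRay (cone E) z)
    (hv : v ∈ cone E) {a b a' b' : ℝ} (hb : 0 < b) (hb' : 0 < b')
    (h : a • v + b • w = a' • v + b' • z) : Function.support z = Function.support w := by
  wlog hle : a ≤ a' generalizing a b a' b' w z
  · exact (this hz hw hb' hb h.symm (le_of_not_ge hle)).symm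
  -- Now `b • w` is a sum of vectors of the cone of which one is a positive multiple of `z`, so `z`
  -- lies below the extremal `w`.
  have hw' : b • w = (a' - a) • v + b' • z := by
    rw [sub_smul, sub_add_eq_add_sub, ← h]; abel
  apply hw.support_eq hz.1 hz.2.1
  rw [← support_smul hb.ne' w, hw', support_add_of_nonneg
    (smul_mem_cone (sub_nonneg.2 hle) hv).1 (smul_mem_cone hb'.le hz.1).1, support_smul hb'.ne']
  exact Set.subset_union_right

/-- Converse of `isRay_mix`: every new ray of the section comes from an adjacent pair on opposite
sides of the hyperplane. An old ray below `x` on which `φ` vanished would be a ray of the section,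
hence proportional to `x`; so all old rays below `x` lie strictly on one side, and both sides occur.
Mixing any positive one with any negative one gives a multiple of `x`, which leaves room for only
one ray on each side. -/
theorem exists_rays_of_isRay_insert (hx : IsRay (cone (insert φ E)) x)
    (hn : ¬ IsRay (cone E) x) :
    ∃ v w, IsRay (cone E) v ∧ IsRay (cone E) w ∧ 0 < form φ v ∧ form φ w < 0 ∧
      Function.support v ∪ Function.support w = Function.support x ∧
      ∀ z, IsRay (cone E) z → Function.support z ⊆ Function.support x →
        Function.support z = Function.support v ∨ Function.support z = Function.support w := by
  obtain ⟨hxE, hx0⟩ := mem_cone_insert.1 hx.1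
  have key : ∀ z, IsRay (cone E) z → Function.support z ⊆ Function.support x →
      form φ z ≠ 0 := by
    intro z hz hzs h0
    obtain ⟨t, ht, rfl⟩ := hx.exists_eq_smul (hz.insert h0).1 hz.2.1 hzs
    apply hn
    have := hz.smul (inv_pos.2 ht)
    rwa [smul_smul, inv_mul_cancel₀ ht.ne', one_smul] at this
  have hpos := exists_ray_form_pos hxE hx.2.1 hx0 key
  have hneg : ∃ w, IsRay (cone E) w ∧ Function.support w ⊆ Function.support x ∧
      form φ w < 0 := by
    have hform : ∀ z : ι → ℝ, form (-φ) z = -form φ z := fun z => by simp [form]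
    obtain ⟨w, hw, hws, hpw⟩ := exists_ray_form_pos (φ := -φ) hxE hx.2.1 (by simp [hform, hx0])
      (fun z hz hzs => by simpa [hform] using key z hz hzs)
    exact ⟨w, hw, hws, by rw [hform] at hpw; linarith⟩
  obtain ⟨v, hv, hvs, hpv⟩ := hpos
  obtain ⟨w, hw, hws, hpw⟩ := hneg
  have hmix : ∀ v w, IsRay (cone E) v → IsRay (cone E) w →
      Function.support v ⊆ Function.support x → Function.support w ⊆ Function.support x →
      0 < form φ v → form φ w < 0 →
      Function.support v ∪ Function.support w = Function.support x ∧
        ∃ t : ℝ, 0 < t ∧ mix φ v w = t • x := by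
    intro v w hv hw hvs hws hpv hpw
    have hs := support_mix hv.1 hw.1 hpv hpw
    have hm := mix_mem_cone hv.1 hw.1 hpv hpw
    have h0 : mix φ v w ≠ 0 := by
      intro h
      obtain ⟨c, hc⟩ := exists_pos_coord hv.1 hv.2.1
      have h2 : c ∈ Function.support v ∪ Function.support w := Or.inl hc.ne'
      rw [← hs, h, Function.support_zero] at h2
      exact h2
    have hle : Function.support (mix φ v w) ⊆ Function.support x :=
      hs ▸ Set.union_subset hvs hws
    exact ⟨hs ▸ hx.support_eq hm h0 hle, hx.exists_eq_smul hm h0 hle⟩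
  obtain ⟨hun, t, ht, hmt⟩ := hmix v w hv hw hvs hws hpv hpw
  refine ⟨v, w, hv, hw, hpv, hpw, hun, fun z hz hzs => ?_⟩
  -- Any two such mixtures are positive multiples of `x`; equating them gives two expansions that
  -- share one ray, as `IsRay.support_eq_of_add_eq` requires.
  have hscale : ∀ v' w' : ι → ℝ, ∀ s : ℝ, mix φ v' w' = s • x →
      s • mix φ v w = t • mix φ v' w' := fun v' w' s hms => by
    rw [hmt, hms, smul_comm]
  rcases lt_or_gt_of_ne (key z hz hzs) with h | h
  · right
    obtain ⟨-, s, hs, hms⟩ := hmix v z hv hz hvs hzs hpv h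
    have e := hscale _ _ s hms
    simp only [mix, smul_add, smul_smul] at e
    exact hw.support_eq_of_add_eq hz hv.1 (mul_pos hs hpv) (mul_pos ht hpv) e
  · left
    obtain ⟨-, s, hs, hms⟩ := hmix z w hz hw hzs hws h hpw
    have e := hscale _ _ s hms
    simp only [mix, smul_add, smul_smul] at e
    rw [add_comm, add_comm ((t * _) • z)] at e
    exact hv.support_eq_of_add_eq hz hw.1 (mul_pos hs (neg_pos.2 hpw)) (mul_pos ht (neg_pos.2 hpw)) e

end PolyCone

/-! ### Enumeration of extremal rays by the double description method

An extremal ray is recorded as a pair `(m, l)`, where the binary digits of `m` give the support and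
`l` lists the values of some linear forms at a point of the ray. -/

namespace RayEnum

open PolyCone

abbrev Entry : Type := ℕ × List ℤ

/-! The functions `force…` return `f` applied to their first argument. When they are reduced by the
kernel, this argument is evaluated first. -/

noncomputable def forceNat {α : Type} (n : ℕ) (f : ℕ → α) : α :=
  Nat.rec (f 0) (fun k _ => f (Nat.succ k)) n

noncomputable def forceInt {α : Type} (z : ℤ) (f : ℤ → α) : α :=
  Int.rec (fun n => forceNat n fun k => f (Int.ofNat k))
    (fun n => forceNat n fun k => f (Int.negSucc k)) z

noncomputable def forceInts {α : Type} (l : List ℤ) : (List ℤ → α) → α :=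
  List.rec (fun f => f []) (fun z _ ih f => forceInt z fun z' => ih fun l' => f (z' :: l')) l

noncomputable def forceEntries {α : Type} (L : List Entry) : (List Entry → α) → α :=
  List.rec (fun f => f []) (fun e _ ih f => forceNat e.1 fun m => forceInts e.2 fun v =>
    ih fun l' => f ((m, v) :: l')) L

noncomputable def forceMasks {α : Type} (L : List Entry) : (List ℕ → α) → α :=
  List.rec (fun f => f []) (fun e _ ih f => forceNat e.1 fun m => ih fun l' => f (m :: l')) L

theorem forceNat_eq {α : Type} (n : ℕ) (f : ℕ → α) : forceNat n f = f n := by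
  cases n <;> rfl

theorem forceInt_eq {α : Type} (z : ℤ) (f : ℤ → α) : forceInt z f = f z := by
  cases z with
  | ofNat n => exact forceNat_eq n fun k => f (Int.ofNat k)
  | negSucc n => exact forceNat_eq n fun k => f (Int.negSucc k)

theorem forceInts_eq {α : Type} (l : List ℤ) (f : List ℤ → α) : forceInts l f = f l := by
  induction l generalizing f with
  | nil => rfl
  | cons z l ih =>
    change forceInt z (fun z' => forceInts l fun l' => f (z' :: l')) = _
    rw [forceInt_eq, ih]

theorem forceEntries_eq {α : Type} (L : List Entry) (f : List Entry → α) :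
    forceEntries L f = f L := by
  induction L generalizing f with
  | nil => rfl
  | cons e L ih =>
    change forceNat e.1 (fun m => forceInts e.2 fun v => forceEntries L fun l' =>
      f ((m, v) :: l')) = _
    rw [forceNat_eq, forceInts_eq, ih]

theorem forceMasks_eq {α : Type} (L : List Entry) (f : List ℕ → α) :
    forceMasks L f = f (L.map Prod.fst) := by
  induction L generalizing f with
  | nil => rfl
  | cons e L ih =>
    change forceNat e.1 (fun m => forceMasks L fun l' => f (m :: l')) = _
    rw [forceNat_eq, ih]; rfl

/-- Whether exactly `k` members of `l` are below `m` as sets of binary digits. -/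
noncomputable def countBelow (m : ℕ) (l : List ℕ) : ℕ → Bool :=
  List.rec (fun k => Nat.beq k 0) (fun a _ ih k =>
    Bool.rec (ih k) (Nat.rec false (fun k _ => ih k) k) (Nat.beq (Nat.lor a m) m)) l

theorem countBelow_iff (m : ℕ) (l : List ℕ) (k : ℕ) :
    countBelow m l k = true ↔ l.countP (fun a => Nat.beq (Nat.lor a m) m) = k := by
  induction l generalizing k with
  | nil =>
    change Nat.beq k 0 = true ↔ 0 = k
    rw [Nat.beq_eq]; exact eq_comm
  | cons a l ih =>
    change Bool.rec (countBelow m l k) (Nat.rec false (fun k _ => countBelow m l k) k)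
      (Nat.beq (Nat.lor a m) m) = true ↔ _
    rw [List.countP_cons]
    cases h : Nat.beq (Nat.lor a m) m with
    | false => simpa using ih k
    | true =>
      cases k with
      | zero => simp
      | succ k => simpa using ih k

noncomputable def gcdList (l : List ℤ) : ℕ := l.foldr (fun z g => Nat.gcd z.natAbs g) 0

/-- Division by the greatest common divisor. -/
noncomputable def primitive (l : List ℤ) : List ℤ :=
  forceNat (gcdList l) fun g => l.map fun z => z / (g : ℤ)

theorem gcdList_dvd {l : List ℤ} {z : ℤ} (h : z ∈ l) : (gcdList l : ℤ) ∣ z := by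
  induction l with
  | nil => simp at h
  | cons a l ih =>
    rw [← Int.dvd_natAbs, Int.natCast_dvd_natCast]
    rcases List.mem_cons.1 h with rfl | h
    · exact Nat.gcd_dvd_left _ _
    · exact (Nat.gcd_dvd_right _ _).trans
        (Int.natCast_dvd_natCast.1 (Int.dvd_natAbs.2 (ih h)))

/-- Only signs and ratios of the recorded values matter, so dividing by the gcd keeps the numbers
small. If the gcd is zero then all values are zero and division by zero leaves them so; the factor 1
serves. -/
theorem exists_eq_map_primitive (l : List ℤ) :
    ∃ g : ℕ, 0 < g ∧ l = (primitive l).map fun z => (g : ℤ) * z := by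
  by_cases h : gcdList l = 0
  · refine ⟨1, one_pos, ?_⟩
    have h0 : ∀ z ∈ l, z = 0 := fun z hz => by simpa [h] using gcdList_dvd hz
    rw [primitive, forceNat_eq, List.map_map]
    refine (List.map_id' l).symm.trans (List.map_congr_left fun z hz => ?_)
    simp [h0 z hz]
  · refine ⟨gcdList l, Nat.pos_of_ne_zero h, ?_⟩
    rw [primitive, forceNat_eq, List.map_map]
    refine (List.map_id' l).symm.trans (List.map_congr_left fun z hz => ?_)
    exact (Int.mul_ediv_cancel' (gcdList_dvd hz)).symm

/-- The entry of the combination of two rays at which the first form vanishes. -/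
noncomputable def combine (e e' : Entry) : Entry :=
  (Nat.lor e.1 e'.1, primitive (List.zipWith
    (fun a b => (-(e'.2.headD 0)) * a + e.2.headD 0 * b) e.2.tail e'.2.tail))

/-- The combinations of `e` with those members of `M` that are adjacent to it. -/
noncomputable def combinations (adm : ℕ → Bool) (masks : List ℕ) (e : Entry) (M : List Entry) :
    List Entry :=
  List.rec [] (fun e' _ ih => forceNat (Nat.lor e.1 e'.1) fun m =>
    Bool.rec ih (Bool.rec ih (combine e e' :: ih) (countBelow m masks 2)) (adm m)) M

theorem combinations_eq (adm : ℕ → Bool) (masks : List ℕ) (e : Entry) (M : List Entry) :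
    combinations adm masks e M = (M.filter fun e' =>
      adm (Nat.lor e.1 e'.1) && countBelow (Nat.lor e.1 e'.1) masks 2).map (combine e) := by
  induction M with
  | nil => rfl
  | cons e' M ih =>
    have : combinations adm masks e (e' :: M) = Bool.rec (combinations adm masks e M)
        (Bool.rec (combinations adm masks e M) (combine e e' :: combinations adm masks e M)
          (countBelow (Nat.lor e.1 e'.1) masks 2)) (adm (Nat.lor e.1 e'.1)) :=
      forceNat_eq (Nat.lor e.1 e'.1) fun m => Bool.rec (motive := fun _ => List Entry)
        (combinations adm masks e M) (Bool.rec (motive := fun _ => List Entry) (combinations adm masks e M) (combine e e' :: combinations adm masks e M)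
          (countBelow m masks 2)) (adm m)
    rw [this, ih, List.filter_cons]
    cases adm (Nat.lor e.1 e'.1) with
    | false => rfl
    | true =>
      cases h : countBelow (Nat.lor e.1 e'.1) masks 2 with
      | false => rfl
      | true => simp

/-- One step of the double description method: intersection with the hyperplane on which the first
form vanishes. -/
noncomputable def step (adm : ℕ → Bool) (L : List Entry) : List Entry :=
  forceMasks L fun masks =>
  forceEntries (L.filter fun e => decide (e.2.headD 0 < 0)) fun M =>
  (L.filter fun e => decide (e.2.headD 0 = 0)).map (fun e => (e.1, e.2.tail)) ++
    (L.filter fun e => decide (0 < e.2.headD 0)).flatMap fun e => combinations adm masks e M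

theorem step_eq (adm : ℕ → Bool) (L : List Entry) : step adm L =
    (L.filter fun e => decide (e.2.headD 0 = 0)).map (fun e => (e.1, e.2.tail)) ++
    (L.filter fun e => decide (0 < e.2.headD 0)).flatMap fun e =>
      ((L.filter fun e => decide (e.2.headD 0 < 0)).filter fun e' => adm (Nat.lor e.1 e'.1) &&
        countBelow (Nat.lor e.1 e'.1) (L.map Prod.fst) 2).map (combine e) := by
  rw [step, forceMasks_eq, forceEntries_eq]
  simp only [combinations_eq]

noncomputable def steps (adm : ℕ → Bool) (n : ℕ) : List Entry → List Entry :=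
  Nat.rec (fun L => L) (fun _ ih L => forceEntries (step adm L) ih) n

theorem steps_succ (adm : ℕ → Bool) (n : ℕ) (L : List Entry) :
    steps adm (n + 1) L = steps adm n (step adm L) := forceEntries_eq _ _

/-! ### Supports as binary numbers -/

variable {ι : Type} (bit : ι → ℕ)

/-- The binary digits of `m` are the positions given by the members of `S`. -/
def IsMask (m : ℕ) (S : Set ι) : Prop := ∀ k, m.testBit k = true ↔ ∃ c ∈ S, bit c = k

variable {bit} {m m' : ℕ} {S S' : Set ι}

theorem IsMask.unique (h : IsMask bit m S) (h' : IsMask bit m' S) : m = m' :=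
  Nat.eq_of_testBit_eq fun k => Bool.eq_iff_iff.2 ((h k).trans (h' k).symm)

theorem IsMask.mem (hb : Function.Injective bit) (h : IsMask bit m S) {c : ι} :
    m.testBit (bit c) = true ↔ c ∈ S := by
  rw [h]
  exact ⟨fun ⟨d, hd, e⟩ => hb e ▸ hd, fun hc => ⟨c, hc, rfl⟩⟩

theorem IsMask.set_unique (hb : Function.Injective bit) (h : IsMask bit m S)
    (h' : IsMask bit m S') : S = S' :=
  Set.ext fun _ => (h.mem hb).symm.trans (h'.mem hb)

theorem IsMask.union (h : IsMask bit m S) (h' : IsMask bit m' S') :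
    IsMask bit (Nat.lor m m') (S ∪ S') := fun k => by
  change (m ||| m').testBit k = true ↔ _
  rw [Nat.testBit_or, Bool.or_eq_true, h, h']
  simp only [Set.mem_union, or_and_right, exists_or]

theorem IsMask.below_iff (hb : Function.Injective bit) (h : IsMask bit m S)
    (h' : IsMask bit m' S') : Nat.beq (Nat.lor m m') m' = true ↔ S ⊆ S' := by
  rw [Nat.beq_eq]
  constructor
  · intro e
    have := (h.union h').set_unique hb (e ▸ h')
    rw [← this]; exact Set.subset_union_left
  · intro hs
    have := h.union h'
    rw [Set.union_eq_self_of_subset_left hs] at this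
    exact this.unique h'

theorem exists_isMask [Fintype ι] (bit : ι → ℕ) (S : Set ι) : ∃ m, IsMask bit m S := by
  classical
  have : ∀ F : Finset ι, ∃ m, IsMask bit m (F : Set ι) := by
    intro F
    induction F using Finset.induction_on with
    | empty => exact ⟨0, fun k => by simp⟩
    | insert c F _ ih =>
      obtain ⟨m, hm⟩ := ih
      refine ⟨Nat.lor (2 ^ bit c) m, ?_⟩
      have h1 : IsMask bit (2 ^ bit c) ({c} : Set ι) := fun k => by
        simp [Nat.testBit_two_pow, eq_comm]
      rw [Finset.coe_insert, Set.insert_eq]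
      exact h1.union hm
  obtain ⟨m, hm⟩ := this S.toFinset
  exact ⟨m, by simpa using hm⟩

/-! ### Correctness -/

variable [Fintype ι]

/-- The value of an integer linear form at an integer vector. -/
def intForm (φ : ι → ℤ) (v : ι → ℕ) : ℤ := ∑ c, φ c * (v c : ℤ)

/-- A vector of natural numbers as a real vector. -/
def toReal (v : ι → ℕ) : ι → ℝ := fun c => (v c : ℝ)

theorem form_toReal (φ : ι → ℤ) (v : ι → ℕ) : form φ (toReal v) = (intForm φ v : ℝ) := by
  simp [form, intForm, toReal]

theorem intForm_combination (φ : ι → ℤ) (a b : ℕ) (v w : ι → ℕ) :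
    intForm φ (a • v + b • w) = a * intForm φ v + b * intForm φ w := by
  simp only [intForm, Finset.mul_sum, ← Finset.sum_add_distrib]
  refine Finset.sum_congr rfl fun c _ => ?_
  simp only [Pi.add_apply, Pi.smul_apply, smul_eq_mul]
  push_cast
  ring

variable (bit)

/-- The list `L` enumerates the admissible extremal rays of the cone defined by `E`, with the values
of the linear forms in `Φ` up to a positive factor. -/
structure Enumerates (adm : ℕ → Bool) (E : Set (ι → ℤ)) (Φ : List (ι → ℤ)) (L : List Entry) :
    Prop where
  sound : ∀ e ∈ L, adm e.1 = true ∧ ∃ v : ι → ℕ, IsRay (cone E) (toReal v) ∧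
    IsMask bit e.1 (Function.support (toReal v)) ∧
    ∃ k : ℕ, 0 < k ∧ Φ.map (fun φ => intForm φ v) = e.2.map fun z => (k : ℤ) * z
  complete : ∀ x m, IsRay (cone E) x → IsMask bit m (Function.support x) → adm m = true →
    ∃ e ∈ L, e.1 = m
  nodup : (L.map Prod.fst).Nodup

variable {bit}

theorem countP_eq_two_iff {l : List ℕ} (hl : l.Nodup) {p : ℕ → Bool} {a b : ℕ} (hab : a ≠ b)
    (ha : a ∈ l) (hb : b ∈ l) (hpa : p a = true) (hpb : p b = true) :
    l.countP p = 2 ↔ ∀ c ∈ l, p c = true → c = a ∨ c = b := by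
  rw [List.countP_eq_length_filter, ← List.toFinset_card_of_nodup (hl.filter p)]
  have hsub : ({a, b} : Finset ℕ) ⊆ (l.filter p).toFinset := by
    intro c hc
    simp only [Finset.mem_insert, Finset.mem_singleton] at hc
    rcases hc with rfl | rfl <;> simp [*]
  have hc2 : ({a, b} : Finset ℕ).card = 2 := Finset.card_pair hab
  constructor
  · intro h c hc hpc
    have := Finset.eq_of_subset_of_card_le hsub (by rw [h, hc2])
    have hcm : c ∈ (l.filter p).toFinset := by simp [hc, hpc]
    simpa [← this] using hcm
  · intro h
    rw [← hc2]
    congr 1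
    refine (Finset.Subset.antisymm hsub fun c hc => ?_).symm
    simp only [List.mem_toFinset, List.mem_filter] at hc
    simpa using h c hc.1 hc.2

theorem Enumerates.mem_of_adm {adm : ℕ → Bool} {E : Set (ι → ℤ)} {Φ : List (ι → ℤ)}
    {L : List Entry} (h : Enumerates bit adm E Φ L) {e e' : Entry} (he : e ∈ L) (he' : e' ∈ L)
    (hm : e.1 = e'.1) : e = e' :=
  List.inj_on_of_nodup_map h.nodup he he' hm

theorem Enumerates.exists_head {adm : ℕ → Bool} {E : Set (ι → ℤ)} {φ : ι → ℤ}
    {Φ : List (ι → ℤ)} {L : List Entry} (h : Enumerates bit adm E (φ :: Φ) L) {e : Entry}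
    (he : e ∈ L) : adm e.1 = true ∧ ∃ v : ι → ℕ, IsRay (cone E) (toReal v) ∧
      IsMask bit e.1 (Function.support (toReal v)) ∧
      ∃ k : ℕ, 0 < k ∧ intForm φ v = k * e.2.headD 0 ∧
        Φ.map (fun φ => intForm φ v) = e.2.tail.map fun z => (k : ℤ) * z := by
  obtain ⟨ha, v, hv, hm, k, hk, hval⟩ := h.sound e he
  refine ⟨ha, v, hv, hm, k, hk, ?_⟩
  obtain ⟨m, l⟩ := e
  cases l with
  | nil => simp at hval
  | cons z l => simpa using hval

/-- Counting in the pruned list decides adjacency in the whole cone: admissibility passes to smaller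
supports, so if the union of the two supports is admissible then every ray below it is listed. -/
theorem adjacent_iff {adm : ℕ → Bool} {E : Set (ι → ℤ)} {Φ : List (ι → ℤ)} {L : List Entry}
    (hbit : Function.Injective bit)
    (hadm : ∀ m m', adm m' = true → Nat.beq (Nat.lor m m') m' = true → adm m = true)
    (h : Enumerates bit adm E Φ L) {e e' : Entry} (he : e ∈ L) (he' : e' ∈ L)
    (hne : e.1 ≠ e'.1) {v w : ι → ℝ}
    (hmv : IsMask bit e.1 (Function.support v)) (hmw : IsMask bit e'.1 (Function.support w))
    (ha : adm (Nat.lor e.1 e'.1) = true) :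
    countBelow (Nat.lor e.1 e'.1) (L.map Prod.fst) 2 = true ↔
      ∀ z, IsRay (cone E) z → Function.support z ⊆ Function.support v ∪ Function.support w →
        Function.support z = Function.support v ∨ Function.support z = Function.support w := by
  have hmu := hmv.union hmw
  rw [countBelow_iff, countP_eq_two_iff h.nodup hne (List.mem_map_of_mem he)
    (List.mem_map_of_mem he') ((hmv.below_iff hbit hmu).2 Set.subset_union_left)
    ((hmw.below_iff hbit hmu).2 Set.subset_union_right)]
  constructor
  · intro hall z hz hzs
    obtain ⟨m, hm⟩ := exists_isMask bit (Function.support z)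
    have hb := (hm.below_iff hbit hmu).2 hzs
    obtain ⟨e₁, he₁, rfl⟩ := h.complete z m hz hm (hadm _ _ ha hb)
    rcases hall e₁.1 (List.mem_map_of_mem he₁) hb with h1 | h1
    · exact Or.inl (hm.set_unique hbit (h1 ▸ hmv))
    · exact Or.inr (hm.set_unique hbit (h1 ▸ hmw))
  · intro hall c hc hb
    obtain ⟨e₁, he₁, rfl⟩ := List.mem_map.1 hc
    obtain ⟨-, z, hz, hmz, -⟩ := h.sound e₁ he₁
    rcases hall _ hz ((hmz.below_iff hbit hmu).1 hb) with h1 | h1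
    · exact Or.inl (hmz.unique (h1 ▸ hmv))
    · exact Or.inr (hmz.unique (h1 ▸ hmw))

/-- The two lists are known up to different factors `k` and `l`; weighting each vector with the
factor of the other makes `k * l` a common factor. -/
theorem zipWith_eq_map_mul (a b : ℤ) (k l : ℤ) : ∀ (Φ : List (ι → ℤ)) (v w : ι → ℕ)
    (s t : List ℤ), Φ.map (fun φ => intForm φ v) = s.map (fun z => k * z) →
    Φ.map (fun φ => intForm φ w) = t.map (fun z => l * z) →
    Φ.map (fun φ => l * a * intForm φ v + k * b * intForm φ w) =
      (List.zipWith (fun x y => a * x + b * y) s t).map fun z => k * l * z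
  | [], _, _, [], [], _, _ => rfl
  | φ :: Φ, v, w, x :: s, y :: t, h, h' => by
    simp only [List.map_cons, List.cons.injEq] at h h'
    simp only [List.map_cons, List.zipWith_cons_cons, List.cons.injEq]
    exact ⟨by rw [h.1, h'.1]; ring, zipWith_eq_map_mul a b k l Φ v w s t h.2 h'.2⟩
  | [], _, _, _ :: _, _, h, _ => by simp at h
  | [], _, _, [], _ :: _, _, h => by simp at h
  | _ :: _, _, _, [], _, h, _ => by simp at h
  | _ :: _, _, _, _ :: _, [], _, h => by simp at h

/-- Soundness is `isRay_mix`, completeness is `exists_rays_of_isRay_insert`. Discarding inadmissible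
rays loses nothing, since both parents of an admissible new ray have smaller supports and are
therefore admissible. -/
theorem Enumerates.step {adm : ℕ → Bool} {E : Set (ι → ℤ)} {φ : ι → ℤ}
    {Φ : List (ι → ℤ)} {L : List Entry} (hbit : Function.Injective bit)
    (hadm : ∀ m m', adm m' = true → Nat.beq (Nat.lor m m') m' = true → adm m = true)
    (h : Enumerates bit adm E (φ :: Φ) L) :
    Enumerates bit adm (insert φ E) Φ (RayEnum.step adm L) := by
  rw [step_eq]
  constructor
  · intro e hmem
    rcases List.mem_append.1 hmem with hmem | hmem
    · obtain ⟨e, he, rfl⟩ := List.mem_map.1 hmem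
      obtain ⟨he, h0⟩ := List.mem_filter.1 he
      obtain ⟨ha, v, hv, hm, k, hk, hh, ht⟩ := h.exists_head he
      refine ⟨ha, v, hv.insert ?_, hm, k, hk, ht⟩
      rw [form_toReal, hh, of_decide_eq_true h0]; simp
    · obtain ⟨e, he, he2⟩ := List.mem_flatMap.1 hmem
      obtain ⟨e', he', rfl⟩ := List.mem_map.1 he2
      obtain ⟨he', hcond⟩ := List.mem_filter.1 he'
      obtain ⟨he', hneg⟩ := List.mem_filter.1 he'
      obtain ⟨he, hpos⟩ := List.mem_filter.1 he
      replace hneg := of_decide_eq_true hneg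
      replace hpos := of_decide_eq_true hpos
      rw [Bool.and_eq_true] at hcond
      obtain ⟨-, v, hv, hmv, k, hk, hvh, hvt⟩ := h.exists_head he
      obtain ⟨-, w, hw, hmw, l, hl, hwh, hwt⟩ := h.exists_head he'
      have hne : e.1 ≠ e'.1 := fun hcon => by
        rw [h.mem_of_adm he he' hcon] at hpos
        exact absurd hpos hneg.not_gt
      have hadj := (adjacent_iff hbit hadm h he he' hne hmv hmw hcond.1).1 hcond.2
      have hk' : (0 : ℝ) < k := by exact_mod_cast hk
      have hl' : (0 : ℝ) < l := by exact_mod_cast hl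
      have hfv : form φ (toReal v) = k * (e.2.headD 0 : ℤ) := by
        rw [form_toReal, hvh]; push_cast; rfl
      have hfw : form φ (toReal w) = l * (e'.2.headD 0 : ℤ) := by
        rw [form_toReal, hwh]; push_cast; rfl
      have hpv : 0 < form φ (toReal v) := by
        rw [hfv]; exact mul_pos hk' (by exact_mod_cast hpos)
      have hpw : form φ (toReal w) < 0 := by
        rw [hfw]; exact mul_neg_of_pos_of_neg hl' (by exact_mod_cast hneg)
      have hray := isRay_mix hv hw hpv hpw hadj
      -- The integer form of `mix φ v w`: the values of `φ` at `v` and `w` are `k` and `l` times the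
      -- recorded heads, of which the second is negative.
      refine ⟨hcond.1, (l * (e'.2.headD 0).natAbs) • v + (k * (e.2.headD 0).natAbs) • w, ?_⟩
      have ha1 : ((e'.2.headD 0).natAbs : ℤ) = -e'.2.headD 0 := by
        rw [Int.ofNat_natAbs_of_nonpos hneg.le]
      have ha2 : ((e.2.headD 0).natAbs : ℤ) = e.2.headD 0 := Int.natAbs_of_nonneg hpos.le
      have hreal : toReal ((l * (e'.2.headD 0).natAbs) • v + (k * (e.2.headD 0).natAbs) • w) =
          mix φ (toReal v) (toReal w) := by
        funext c
        have e1 : (((e'.2.headD 0).natAbs : ℕ) : ℝ) = -(e'.2.headD 0 : ℤ) := by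
          rw [← Int.cast_neg, ← ha1, Int.cast_natCast]
        have e2 : (((e.2.headD 0).natAbs : ℕ) : ℝ) = (e.2.headD 0 : ℤ) := by
          rw [← Int.cast_natCast, ha2]
        simp only [toReal, mix, hfv, hfw, Pi.add_apply, Pi.smul_apply, smul_eq_mul]
        push_cast
        rw [e1, e2]
        ring
      rw [hreal]
      refine ⟨hray, ?_, ?_⟩
      · rw [support_mix hv.1 hw.1 hpv hpw]
        exact hmv.union hmw
      · obtain ⟨g, hg, hg'⟩ := exists_eq_map_primitive (List.zipWith
          (fun a b => (-(e'.2.headD 0)) * a + e.2.headD 0 * b) e.2.tail e'.2.tail)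
        refine ⟨k * l * g, by positivity, ?_⟩
        have := zipWith_eq_map_mul (-(e'.2.headD 0)) (e.2.headD 0) k l Φ v w _ _ hvt hwt
        rw [hg', List.map_map] at this
        simp only [intForm_combination, Nat.cast_mul, ha1, ha2]
        rw [this]
        refine List.map_congr_left fun z _ => ?_
        simp only [Function.comp_apply]
        ring
  · intro x m hx hm ha
    by_cases hr : IsRay (cone E) x
    · obtain ⟨e, he, rfl⟩ := h.complete x m hr hm ha
      obtain ⟨-, v, hv, hmv, k, hk, hh, ht⟩ := h.exists_head he
      refine ⟨(e.1, e.2.tail), List.mem_append_left _ (List.mem_map.2 ⟨e, List.mem_filter.2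
        ⟨he, ?_⟩, rfl⟩), rfl⟩
      obtain ⟨t, ht, rfl⟩ := hv.exists_eq_smul hr.1 hr.2.1 (hm.set_unique hbit hmv).le
      have h0 := (mem_cone_insert.1 hx.1).2
      rw [form_smul, form_toReal, hh] at h0
      have : (k : ℝ) ≠ 0 := by exact_mod_cast hk.ne'
      simp only [mul_eq_zero, ht.ne', false_or, Int.cast_mul, Int.cast_natCast, this] at h0
      exact decide_eq_true (by exact_mod_cast h0)
    · obtain ⟨v, w, hv, hw, hpv, hpw, hun, hall⟩ := exists_rays_of_isRay_insert hx hr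
      obtain ⟨mv, hmv⟩ := exists_isMask bit (Function.support v)
      obtain ⟨mw, hmw⟩ := exists_isMask bit (Function.support w)
      have hmu := hmv.union hmw
      obtain rfl : m = Nat.lor mv mw := hm.unique (hun ▸ hmu)
      obtain ⟨e, he, rfl⟩ := h.complete v mv hv hmv (hadm _ _ ha
        ((hmv.below_iff hbit hmu).2 Set.subset_union_left))
      obtain ⟨e', he', rfl⟩ := h.complete w mw hw hmw (hadm _ _ ha
        ((hmw.below_iff hbit hmu).2 Set.subset_union_right))
      -- Rays and recorded values are known only up to positive factors, but this suffices to
      -- transfer signs.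
      have hsign : ∀ e ∈ L, ∀ y, IsRay (cone E) y → IsMask bit e.1 (Function.support y) →
          ∃ t : ℝ, 0 < t ∧ form φ y = t * (e.2.headD 0 : ℤ) := by
        intro e he y hy hmy
        obtain ⟨-, v, hv, hmv, k, hk, hh, -⟩ := h.exists_head he
        obtain ⟨t, ht, rfl⟩ := hv.exists_eq_smul hy.1 hy.2.1 (hmy.set_unique hbit hmv).le
        have : (0 : ℝ) < k := by exact_mod_cast hk
        refine ⟨t * k, by positivity, ?_⟩
        rw [form_smul, form_toReal, hh]; push_cast; ring
      obtain ⟨t, ht, h1⟩ := hsign e he v hv hmv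
      obtain ⟨t', ht', h1'⟩ := hsign e' he' w hw hmw
      have hpos : 0 < e.2.headD 0 := by
        rw [h1] at hpv; exact_mod_cast pos_of_mul_pos_right hpv ht.le
      have hneg : e'.2.headD 0 < 0 := by
        rw [h1'] at hpw
        by_contra hcon
        push Not at hcon
        have : (0 : ℝ) ≤ (e'.2.headD 0 : ℤ) := by exact_mod_cast hcon
        nlinarith
      have hne : e.1 ≠ e'.1 := fun hcon => by
        rw [h.mem_of_adm he he' hcon] at hpos
        exact absurd hpos hneg.not_gt
      refine ⟨combine e e', List.mem_append_right _ (List.mem_flatMap.2 ⟨e, List.mem_filter.2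
        ⟨he, decide_eq_true hpos⟩, List.mem_map.2 ⟨e', List.mem_filter.2 ⟨List.mem_filter.2
        ⟨he', decide_eq_true hneg⟩, ?_⟩, rfl⟩⟩), rfl⟩
      rw [Bool.and_eq_true]
      exact ⟨ha, (adjacent_iff hbit hadm h he he' hne hmv hmw ha).2
        fun z hz hzs => hall z hz (hun ▸ hzs)⟩
  · have hL : L.Nodup := h.nodup.of_map
    -- an adjacent pair is determined by the union of its supports
    have hpair : ∀ e ∈ L, ∀ e' ∈ L, e.1 ≠ e'.1 →
        countBelow (Nat.lor e.1 e'.1) (L.map Prod.fst) 2 = true →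
        ∀ f ∈ L, Nat.beq (Nat.lor f.1 (Nat.lor e.1 e'.1)) (Nat.lor e.1 e'.1) = true →
          f = e ∨ f = e' := by
      intro e he e' he' hne hc f hf hb
      obtain ⟨-, v, -, hmv, -⟩ := h.sound e he
      obtain ⟨-, w, -, hmw, -⟩ := h.sound e' he'
      have hmu := hmv.union hmw
      rw [countBelow_iff, countP_eq_two_iff h.nodup hne (List.mem_map_of_mem he)
        (List.mem_map_of_mem he') ((hmv.below_iff hbit hmu).2 Set.subset_union_left)
        ((hmw.below_iff hbit hmu).2 Set.subset_union_right)] at hc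
      exact (hc f.1 (List.mem_map_of_mem hf) hb).imp (h.mem_of_adm hf he) (h.mem_of_adm hf he')
    have hbelow : ∀ a b : ℕ, Nat.beq (Nat.lor a (Nat.lor a b)) (Nat.lor a b) = true ∧
        Nat.beq (Nat.lor b (Nat.lor a b)) (Nat.lor a b) = true := fun a b => by
      simp only [Nat.beq_eq]
      change a ||| (a ||| b) = a ||| b ∧ b ||| (a ||| b) = a ||| b
      exact ⟨by rw [← Nat.or_assoc, Nat.or_self],
        by rw [Nat.or_comm a b, ← Nat.or_assoc, Nat.or_self]⟩
    have hself : ∀ a : ℕ, Nat.beq (Nat.lor a a) a = true := fun a =>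
      (Nat.beq_eq (x := Nat.lor a a)).mpr (Nat.or_self a)
    have hneq : ∀ e ∈ L, ∀ e' ∈ L, 0 < e.2.headD 0 → e'.2.headD 0 < 0 → e.1 ≠ e'.1 := by
      intro e he e' he' hp hn hcon
      rw [h.mem_of_adm he he' hcon] at hp
      exact absurd hp hn.not_gt
    rw [List.map_append, List.nodup_append]
    refine ⟨?_, ?_, ?_⟩
    · rw [List.map_map]
      exact (h.nodup.sublist (List.filter_sublist.map _))
    · rw [List.map_flatMap, List.nodup_flatMap]
      constructor
      · intro e he
        obtain ⟨he, hpos⟩ := List.mem_filter.1 he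
        rw [List.map_map]
        refine List.Nodup.map_on ?_ ((hL.filter _).filter _)
        intro f hf g hg hfg
        simp only [List.mem_filter, decide_eq_true_eq, Bool.and_eq_true] at hf hg hpos
        change Nat.lor e.1 f.1 = Nat.lor e.1 g.1 at hfg
        have := hpair e he f hf.1.1 (hneq e he f hf.1.1 hpos hf.1.2) hf.2.2 g hg.1.1
          (hfg ▸ (hbelow e.1 g.1).2)
        rcases this with rfl | h1
        · exact absurd hpos hg.1.2.not_gt
        · exact h1.symm
      · refine ((List.nodup_iff_pairwise_ne.1 hL).filter _).imp_of_mem ?_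
        intro e f he hf hef
        obtain ⟨he, hpe⟩ := List.mem_filter.1 he
        obtain ⟨hf, hpf⟩ := List.mem_filter.1 hf
        replace hpe := of_decide_eq_true hpe
        replace hpf := of_decide_eq_true hpf
        change List.Disjoint _ _
        intro m hm hm'
        simp only [List.map_map, List.mem_map, List.mem_filter, decide_eq_true_eq,
          Bool.and_eq_true] at hm hm'
        obtain ⟨g, hg, rfl⟩ := hm
        obtain ⟨g', hg', hgg⟩ := hm'
        change Nat.lor f.1 g'.1 = Nat.lor e.1 g.1 at hgg
        rcases hpair e he g hg.1.1 (hneq e he g hg.1.1 hpe hg.1.2) hg.2.2 f hf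
          (hgg ▸ (hbelow f.1 g'.1).1) with h1 | rfl
        · exact hef h1.symm
        · exact absurd hpf hg.1.2.not_gt
    · intro a ha b hb hab
      subst hab
      simp only [List.map_map, List.mem_map, List.mem_filter, decide_eq_true_eq] at ha
      obtain ⟨f, ⟨hf, h0⟩, rfl⟩ := ha
      simp only [List.mem_map, List.mem_flatMap, List.mem_filter, decide_eq_true_eq,
        Bool.and_eq_true] at hb
      obtain ⟨-, ⟨e, ⟨he, hpos⟩, e', ⟨⟨he', hneg⟩, -, hc⟩, rfl⟩, hm⟩ := hb
      change Nat.lor e.1 e'.1 = f.1 at hm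
      rcases hpair e he e' he' (hneq e he e' he' hpos hneg) hc f hf (hm ▸ hself _) with rfl | rfl
      · exact absurd h0 hpos.ne'
      · exact absurd h0 hneg.ne

theorem Enumerates.steps {adm : ℕ → Bool} (hbit : Function.Injective bit)
    (hadm : ∀ m m', adm m' = true → Nat.beq (Nat.lor m m') m' = true → adm m = true)
    {Φ : List (ι → ℤ)} : ∀ (Ψ : List (ι → ℤ)) {E : Set (ι → ℤ)} {L : List Entry},
    Enumerates bit adm E (Ψ ++ Φ) L →
    Enumerates bit adm ({φ | φ ∈ Ψ} ∪ E) Φ (RayEnum.steps adm Ψ.length L)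
  | [], E, L, h => by
    have e : {φ | φ ∈ ([] : List (ι → ℤ))} ∪ E = E := by simp
    rw [e]; exact h
  | φ :: Ψ, E, L, h => by
    rw [List.length_cons, steps_succ]
    have := Enumerates.steps hbit hadm Ψ (h.step hbit hadm)
    convert this using 1
    ext ψ
    simp only [List.mem_cons, Set.mem_union, Set.mem_ofPred_eq, Set.mem_insert_iff]
    tauto

/-- The list of the unit vectors, which span the extremal rays of the orthant. -/
def unitEntries (bit : ι → ℕ) (Φ : List (ι → ℤ)) (l : List ι) : List Entry :=
  l.map fun c => (2 ^ bit c, Φ.map fun φ => φ c)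

/-- Starting point of the double description method: below any non-zero vector of the orthant there
is a unit vector. -/
theorem enumerates_unitEntries {adm : ℕ → Bool} (hbit : Function.Injective bit)
    (hunit : ∀ c, adm (2 ^ bit c) = true) (Φ : List (ι → ℤ)) {l : List ι} (hl : l.Nodup)
    (hall : ∀ c, c ∈ l) : Enumerates bit adm ∅ Φ (unitEntries bit Φ l) := by
  classical
  have hm : ∀ c, IsMask bit (2 ^ bit c) ({c} : Set ι) := fun c k => by
    simp [Nat.testBit_two_pow, eq_comm]
  have hsup : ∀ c, Function.support (toReal (Pi.single c 1 : ι → ℕ)) = {c} := fun c => by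
    ext d
    by_cases h : d = c <;> simp [toReal, h]
  constructor
  · intro e he
    obtain ⟨c, -, rfl⟩ := List.mem_map.1 he
    refine ⟨hunit c, Pi.single c 1, ⟨⟨fun d => Nat.cast_nonneg _, by simp⟩, ?_, ?_⟩, ?_, 1, one_pos,
      ?_⟩
    · intro h
      have := hsup c
      rw [h, Function.support_zero] at this
      exact (Set.singleton_ne_empty c) this.symm
    · intro y _ hs
      rw [hsup] at hs
      refine ⟨y c, funext fun d => ?_⟩
      by_cases h : d = c
      · subst h; simp [toReal]
      · have : y d = 0 := by
          by_contra hne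
          exact h (hs hne)
        simp [toReal, h, this]
    · rw [hsup]; exact hm c
    · simp [intForm, Pi.single_apply]
  · intro x m hx hxm _
    obtain ⟨c, hc⟩ := exists_pos_coord hx.1 hx.2.1
    refine ⟨_, List.mem_map_of_mem (hall c), ?_⟩
    refine (hm c).unique ?_
    have : Function.support (toReal (Pi.single c 1 : ι → ℕ)) = Function.support x := by
      refine hx.support_eq ⟨fun d => Nat.cast_nonneg _, by simp⟩ ?_ ?_
      · intro h
        have := hsup c
        rw [h, Function.support_zero] at this
        exact (Set.singleton_ne_empty c) this.symm
      · rw [hsup]; exact Set.singleton_subset_iff.2 hc.ne'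
    rwa [← hsup c, this]
  · rw [unitEntries, List.map_map]
    refine hl.map fun c d hcd => hbit ?_
    exact Nat.pow_right_injective le_rfl hcd

end RayEnum

/-! ### Extremal rays of a fibre product of a cone with itself -/

namespace PolyCone

variable {ι : Type} [Fintype ι] (E : Set (ι → ℤ)) (p : Fin 3 → ι → ℤ)

/-- The boundary values of `x` and `y` agree after exchanging the last two of them. -/
def Fits (x y : ι → ℝ) : Prop := ∀ i, form (p i) x = form (p (Equiv.swap 1 2 i)) y

/-- The pair `(x, y)` spans an extremal ray of the fibre product. -/
def IsPairRay (x y : ι → ℝ) : Prop :=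
  x ∈ cone E ∧ y ∈ cone E ∧ Fits p x y ∧ (x ≠ 0 ∨ y ≠ 0) ∧
    ∀ x' ∈ cone E, ∀ y' ∈ cone E, Fits p x' y' →
      Function.support x' ⊆ Function.support x → Function.support y' ⊆ Function.support y →
      ∃ t : ℝ, x' = t • x ∧ y' = t • y

variable {E p} {x y x' y' r s v w : ι → ℝ}

theorem Fits.symm (h : Fits p x y) : Fits p y x := fun i => by
  have := h (Equiv.swap 1 2 i)
  rw [Equiv.swap_apply_self] at this
  exact this.symm

theorem Fits.add (h : Fits p x y) (h' : Fits p x' y') : Fits p (x + x') (y + y') := fun i => by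
  rw [form_add, form_add, h, h']

theorem Fits.smul (h : Fits p x y) (t : ℝ) : Fits p (t • x) (t • y) := fun i => by
  rw [form_smul, form_smul, h]

theorem IsPairRay.symm (h : IsPairRay E p x y) : IsPairRay E p y x :=
  ⟨h.2.1, h.1, h.2.2.1.symm, h.2.2.2.1.symm, fun x' hx' y' hy' hf hs hs' => by
    obtain ⟨t, h1, h2⟩ := h.2.2.2.2 y' hy' x' hx' hf.symm hs' hs
    exact ⟨t, h2, h1⟩⟩

theorem exists_add_smul_nonneg (hx : ∀ c, 0 ≤ x c)
    (hs : Function.support v ⊆ Function.support x) :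
    ∃ ε : ℝ, 0 < ε ∧ ∀ δ, 0 ≤ δ → δ ≤ ε → ∀ c, 0 ≤ (x + δ • v) c := by
  classical
  have hpt : ∀ c, ∃ ε : ℝ, 0 < ε ∧ ∀ δ, 0 ≤ δ → δ ≤ ε → 0 ≤ (x + δ • v) c := by
    intro c
    by_cases hv : v c = 0
    · exact ⟨1, one_pos, fun δ _ _ => by simpa [hv] using hx c⟩
    · have hxc : 0 < x c := lt_of_le_of_ne (hx c) (Ne.symm (hs hv))
      refine ⟨x c / |v c|, div_pos hxc (abs_pos.2 hv), fun δ h0 hδ => ?_⟩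
      rw [le_div_iff₀ (abs_pos.2 hv)] at hδ
      have := neg_abs_le (v c)
      simp only [Pi.add_apply, Pi.smul_apply, smul_eq_mul]
      nlinarith
  choose ε hε h using hpt
  rcases isEmpty_or_nonempty ι with hι | hι
  · exact ⟨1, one_pos, fun _ _ _ c => hι.elim c⟩
  · obtain ⟨c₀, -, hmin⟩ := Finset.exists_min_image Finset.univ ε Finset.univ_nonempty
    exact ⟨ε c₀, hε c₀, fun δ h0 hδ c => h c δ h0 (hδ.trans (hmin c (Finset.mem_univ c)))⟩

/-- The pair ray spans the space of all solutions supported by it, not only the cone of the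
non-negative ones. -/
theorem IsPairRay.exists_eq_smul (h : IsPairRay E p x y) (hvE : ∀ φ ∈ E, form φ v = 0)
    (hwE : ∀ φ ∈ E, form φ w = 0) (hf : Fits p v w)
    (hv : Function.support v ⊆ Function.support x)
    (hw : Function.support w ⊆ Function.support y) : ∃ t : ℝ, v = t • x ∧ w = t • y := by
  obtain ⟨hx, hy, hxy, -, hmin⟩ := h
  obtain ⟨ε₁, h1, h1'⟩ := exists_add_smul_nonneg hx.1 hv
  obtain ⟨ε₂, h2, h2'⟩ := exists_add_smul_nonneg hy.1 hw
  have hε : 0 < min ε₁ ε₂ := lt_min h1 h2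
  have hsup : ∀ (a b : ι → ℝ) (δ : ℝ), Function.support b ⊆ Function.support a →
      Function.support (a + δ • b) ⊆ Function.support a := by
    intro a b δ hab c hc ha
    have hb : b c = 0 := by
      by_contra hne
      exact hab hne ha
    simp [ha, hb] at hc
  -- A small perturbation of `(x, y)` in the direction `(v, w)` stays non-negative and does not
  -- enlarge the supports, so minimality applies to it.
  obtain ⟨t, e1, e2⟩ := hmin (x + min ε₁ ε₂ • v)
    ⟨h1' _ hε.le (min_le_left _ _), fun φ hφ => by
      rw [form_add, form_smul, hx.2 φ hφ, hvE φ hφ, mul_zero, add_zero]⟩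
    (y + min ε₁ ε₂ • w)
    ⟨h2' _ hε.le (min_le_right _ _), fun φ hφ => by
      rw [form_add, form_smul, hy.2 φ hφ, hwE φ hφ, mul_zero, add_zero]⟩
    (hxy.add (hf.smul _)) (hsup _ _ _ hv) (hsup _ _ _ hw)
  have key : ∀ a b : ι → ℝ, a + min ε₁ ε₂ • b = t • a → b = ((t - 1) / min ε₁ ε₂) • a := by
    intro a b hab
    have : min ε₁ ε₂ • b = (t - 1) • a := by
      rw [sub_smul, one_smul, ← hab, add_sub_cancel_left]
    rw [div_eq_inv_mul, mul_smul, ← this, smul_smul, inv_mul_cancel₀ hε.ne', one_smul]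
  exact ⟨_, key _ _ e1, key _ _ e2⟩

/-! #### Pairs with an extremal component -/

/-- When `x` is extremal, the first component of any smaller pair is a multiple of `x`, so
extremality of the pair only concerns `y` in the slice `F`. A non-zero boundary value of `x` forces
the same factor on both components. -/
theorem isPairRay_iff_of_isRay {F : Set (ι → ℤ)} (hx : IsRay (cone E) x)
    (hF : ∀ z, z ∈ cone F ↔ z ∈ cone E ∧ ∃ t : ℝ, 0 ≤ t ∧ Fits p (t • x) z)
    (hx0 : ∃ i, form (p i) x ≠ 0) (hxy : Fits p x y) :
    IsPairRay E p x y ↔ IsRay (cone F) y := by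
  constructor
  · rintro ⟨-, hy, -, -, hmin⟩
    refine ⟨(hF y).2 ⟨hy, 1, zero_le_one, by simpa using hxy⟩, ?_, fun z hz hs => ?_⟩
    · rintro rfl
      obtain ⟨i, hi⟩ := hx0
      exact hi ((hxy i).trans (form_zero _))
    · obtain ⟨hzE, t, ht, htz⟩ := (hF z).1 hz
      obtain ⟨s, -, hs⟩ := hmin (t • x) (smul_mem_cone ht hx.1) z hzE htz
        (Function.support_const_smul_subset t x) hs
      exact ⟨s, hs⟩
  · rintro ⟨hy, hy0, hmin⟩
    refine ⟨hx.1, ((hF y).1 hy).1, hxy, Or.inl hx.2.1, fun x' hx' y' hy' hf hs hs' => ?_⟩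
    by_cases hx'0 : x' = 0
    · subst hx'0
      obtain ⟨t, rfl⟩ := hmin y' ((hF y').2 ⟨hy', 0, le_rfl, by simpa using hf⟩) hs'
      obtain ⟨i, hi⟩ := hx0
      have := hf i
      rw [form_zero, form_smul, ← hxy i, eq_comm, mul_eq_zero] at this
      refine ⟨t, ?_, rfl⟩
      rw [this.resolve_right hi, zero_smul]
    obtain ⟨t, ht, rfl⟩ := hx.exists_eq_smul hx' hx'0 hs
    obtain ⟨t', rfl⟩ := hmin y' ((hF y').2 ⟨hy', t, ht.le, hf⟩) hs'
    obtain ⟨i, hi⟩ := hx0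
    have := hf i
    rw [form_smul, form_smul, ← hxy i] at this
    exact ⟨t, rfl, by rw [mul_right_cancel₀ hi this]⟩

/-! #### Pairs without an extremal component -/

/-- A summand with positive coefficient would lie below `r` and hence have the support of `r`. -/
theorem IsRay.eq_zero_of_smul_eq_add (hr : IsRay (cone E) r) (hv : IsRay (cone E) v)
    (hw : IsRay (cone E) w) (h1 : Function.support v ≠ Function.support r)
    (h2 : Function.support w ≠ Function.support r) {a b c : ℝ} (hb : 0 ≤ b) (hc : 0 ≤ c)
    (h : a • r = b • v + c • w) : a = 0 ∧ b = 0 ∧ c = 0 := by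
  have hsr : Function.support (a • r) ⊆ Function.support r :=
    Function.support_const_smul_subset a r
  have hsup := support_add_of_nonneg (smul_mem_cone hb hv.1).1 (smul_mem_cone hc hw.1).1
  rw [← h] at hsup
  have hb0 : b = 0 := by
    by_contra hne
    apply h1
    apply hr.support_eq hv.1 hv.2.1
    rw [support_smul hne] at hsup
    exact (hsup ▸ Set.subset_union_left).trans hsr
  have hc0 : c = 0 := by
    by_contra hne
    apply h2
    apply hr.support_eq hw.1 hw.2.1
    rw [support_smul hne] at hsup
    exact (hsup ▸ Set.subset_union_right).trans hsr
  refine ⟨?_, hb0, hc0⟩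
  rw [hb0, hc0, zero_smul, zero_smul, zero_add, smul_eq_zero] at h
  exact h.resolve_right hr.2.1

/-- Three different extremal rays of a pointed cone are linearly independent. -/
theorem linearIndependent_rays (hr : IsRay (cone E) r) (hv : IsRay (cone E) v)
    (hw : IsRay (cone E) w) (h1 : Function.support v ≠ Function.support r)
    (h2 : Function.support w ≠ Function.support r) (h3 : Function.support v ≠ Function.support w)
    {a b c : ℝ} (h : a • r + b • v + c • w = 0) : a = 0 ∧ b = 0 ∧ c = 0 := by
  -- Up to a change of all signs, two of the three coefficients are non-negative; then the third ray
  -- is compared with a non-negative combination of the other two.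
  wlog hbc : (0 ≤ b ∧ 0 ≤ c) ∨ (0 ≤ a ∧ 0 ≤ c) ∨ (0 ≤ a ∧ 0 ≤ b) generalizing a b c
  · have := @this (-a) (-b) (-c) (by
      rw [neg_smul, neg_smul, neg_smul, ← neg_add, ← neg_add, h, neg_zero]) (by
      push Not at hbc
      simp only [Left.nonneg_neg_iff]
      rcases lt_or_ge b 0 with hb | hb
      · rcases lt_or_ge c 0 with hc | hc
        · exact Or.inl ⟨hb.le, hc.le⟩
        · refine Or.inr (Or.inr ⟨?_, hb.le⟩)
          by_contra ha
          exact (hbc.2.1 (le_of_not_ge ha)).not_ge hc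
      · refine Or.inr (Or.inl ⟨?_, (hbc.1 hb).le⟩)
        by_contra ha
        exact (hbc.2.2 (le_of_not_ge ha)).not_ge hb)
    simpa using this
  rcases hbc with ⟨hb, hc⟩ | ⟨ha, hc⟩ | ⟨ha, hb⟩
  · have := hr.eq_zero_of_smul_eq_add (a := -a) hv hw h1 h2 hb hc (by
      rw [neg_smul, eq_comm, ← add_eq_zero_iff_eq_neg, ← h]; abel)
    simpa using this
  · have := hv.eq_zero_of_smul_eq_add (a := -b) hr hw h1.symm h3.symm ha hc (by
      rw [neg_smul, eq_comm, ← add_eq_zero_iff_eq_neg, ← h]; abel)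
    simp only [neg_eq_zero] at this
    tauto
  · have := hw.eq_zero_of_smul_eq_add (a := -c) hr hv h2.symm h3 ha hb (by
      rw [neg_smul, eq_comm, ← add_eq_zero_iff_eq_neg, ← h])
    simp only [neg_eq_zero] at this
    tauto

theorem linearIndependent_two_rays (hr : IsRay (cone E) r) (hs : IsRay (cone E) s)
    (h : Function.support r ≠ Function.support s) {a b : ℝ} (hab : a • r + b • s = 0) :
    a = 0 ∧ b = 0 := by
  have e : a • r = -(b • s) := eq_neg_of_add_eq_zero_left hab
  rcases le_total 0 b with hb | hb
  · have := hr.eq_zero_of_smul_eq_add (a := -a) hs hs h.symm h.symm hb le_rfl (by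
      rw [neg_smul, e]; simp)
    exact ⟨neg_eq_zero.1 this.1, this.2.1⟩
  · have := hr.eq_zero_of_smul_eq_add (a := a) (b := -b) hs hs h.symm h.symm
      (neg_nonneg.2 hb) le_rfl (by rw [e]; simp)
    exact ⟨this.1, neg_eq_zero.1 this.2.1⟩

theorem exists_two_rays (hx : x ∈ cone E) (hx0 : x ≠ 0) (hn : ¬ IsRay (cone E) x) :
    ∃ r s, IsRay (cone E) r ∧ IsRay (cone E) s ∧ Function.support r ⊆ Function.support x ∧
      Function.support s ⊆ Function.support x ∧ Function.support r ≠ Function.support s := by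
  obtain ⟨r, hr, hrs⟩ := exists_ray_le hx hx0
  by_contra! hcon
  obtain ⟨a, b, ha, hb, rfl⟩ := exists_eq_add_of_rays (v := r) (w := r) hx (fun z hz hzs => by
    obtain ⟨t, ht, rfl⟩ := hr.exists_eq_smul hz.1 hz.2.1 (hcon r z hr hz hrs hzs).symm.le
    exact ⟨t, 0, ht.le, le_rfl, by simp⟩)
  rw [← add_smul] at hn hx0
  apply hn
  refine hr.smul (lt_of_le_of_ne (add_nonneg ha hb) ?_)
  intro h0
  rw [← h0, zero_smul] at hx0
  exact hx0 rfl

/-- In a pair ray without extremal components, no component has more than two extremal rays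
below it. -/
theorem IsPairRay.eq_or_eq (h : IsPairRay E p x y) {r₁ r₂ s₁ s₂ z : ι → ℝ}
    (hr₁ : IsRay (cone E) r₁) (hr₂ : IsRay (cone E) r₂) (hs₁ : IsRay (cone E) s₁)
    (hs₂ : IsRay (cone E) s₂) (hz : IsRay (cone E) z)
    (hr : Function.support r₁ ≠ Function.support r₂)
    (hs : Function.support s₁ ≠ Function.support s₂)
    (hr₁x : Function.support r₁ ⊆ Function.support x)
    (hr₂x : Function.support r₂ ⊆ Function.support x)
    (hzx : Function.support z ⊆ Function.support x)
    (hs₁y : Function.support s₁ ⊆ Function.support y)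
    (hs₂y : Function.support s₂ ⊆ Function.support y) :
    Function.support z = Function.support r₁ ∨ Function.support z = Function.support r₂ := by
  by_contra! hcon
  obtain ⟨c₀, hc₀⟩ := exists_pos_coord hr₁.1 hr₁.2.1
  have hx₀ : x c₀ ≠ 0 := hr₁x hc₀.ne'
  -- Dimension count: five coefficients (three rays below `x`, two below `y`) against four
  -- equations, namely three matching conditions and the vanishing at `c₀`. A non-trivial solution
  -- is a multiple of `(x, y)`; since `x c₀ ≠ 0` that multiple is zero, which contradicts the
  -- independence of the rays.
  let f : (Fin 5 → ℝ) →ₗ[ℝ] ℝ × ℝ × ℝ × ℝ :=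
    { toFun := fun a => (form (p 0) (a 0 • r₁ + a 1 • r₂ + a 2 • z)
          - form (p (Equiv.swap 1 2 0)) (a 3 • s₁ + a 4 • s₂),
        form (p 1) (a 0 • r₁ + a 1 • r₂ + a 2 • z)
          - form (p (Equiv.swap 1 2 1)) (a 3 • s₁ + a 4 • s₂),
        form (p 2) (a 0 • r₁ + a 1 • r₂ + a 2 • z)
          - form (p (Equiv.swap 1 2 2)) (a 3 • s₁ + a 4 • s₂),
        (a 0 • r₁ + a 1 • r₂ + a 2 • z) c₀)
      map_add' := fun a b => by
        simp only [form_add, form_smul, Pi.add_apply, Pi.smul_apply, smul_eq_mul, Prod.mk_add_mk,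
          Prod.mk.injEq]
        refine ⟨?_, ?_, ?_, ?_⟩ <;> ring
      map_smul' := fun t a => by
        simp only [form_add, form_smul, Pi.add_apply, Pi.smul_apply, smul_eq_mul, Prod.smul_mk,
          RingHom.id_apply, Prod.mk.injEq]
        refine ⟨?_, ?_, ?_, ?_⟩ <;> ring }
  have hker : LinearMap.ker f ≠ ⊥ := LinearMap.ker_ne_bot_of_finrank_lt (by simp)
  obtain ⟨a, ha, ha0⟩ := (Submodule.ne_bot_iff _).1 hker
  have hfa : f a = 0 := ha
  have h0 : form _ _ - form _ _ = 0 := congrArg (fun q => q.1) hfa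
  have h1 : form _ _ - form _ _ = 0 := congrArg (fun q => q.2.1) hfa
  have h2 : form _ _ - form _ _ = 0 := congrArg (fun q => q.2.2.1) hfa
  have h3 : (a 0 • r₁ + a 1 • r₂ + a 2 • z) c₀ = 0 := congrArg (fun q => q.2.2.2) hfa
  have hfit : Fits p (a 0 • r₁ + a 1 • r₂ + a 2 • z) (a 3 • s₁ + a 4 • s₂) := fun i =>
    match i with
    | 0 => sub_eq_zero.1 h0
    | 1 => sub_eq_zero.1 h1
    | 2 => sub_eq_zero.1 h2
  have hsup : ∀ (u v : ι → ℝ) (a : ℝ), Function.support u ⊆ Function.support v →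
      Function.support (a • u) ⊆ Function.support v := fun u v a huv =>
    (Function.support_const_smul_subset a u).trans huv
  have hadd : ∀ u v w : ι → ℝ, Function.support u ⊆ Function.support w →
      Function.support v ⊆ Function.support w →
      Function.support (u + v) ⊆ Function.support w := fun u v w hu hv =>
    (Function.support_add u v).trans (Set.union_subset hu hv)
  obtain ⟨t, e1, e2⟩ := h.exists_eq_smul
    (fun φ hφ => by
      rw [form_add, form_add, form_smul, form_smul, form_smul, hr₁.1.2 φ hφ, hr₂.1.2 φ hφ,
        hz.1.2 φ hφ]; simp)
    (fun φ hφ => by rw [form_add, form_smul, form_smul, hs₁.1.2 φ hφ, hs₂.1.2 φ hφ]; simp)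
    hfit (hadd _ _ _ (hadd _ _ _ (hsup _ _ _ hr₁x) (hsup _ _ _ hr₂x)) (hsup _ _ _ hzx))
    (hadd _ _ _ (hsup _ _ _ hs₁y) (hsup _ _ _ hs₂y))
  have ht : t = 0 := by
    rw [e1, Pi.smul_apply, smul_eq_mul, mul_eq_zero] at h3
    exact h3.resolve_right hx₀
  rw [ht, zero_smul] at e1 e2
  have l1 := linearIndependent_rays hr₁ hr₂ hz hr.symm hcon.1 hcon.2.symm e1
  have l2 := linearIndependent_two_rays hs₁ hs₂ hs e2
  apply ha0
  exact funext fun i => match i with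
    | 0 => l1.1
    | 1 => l1.2.1
    | 2 => l1.2.2
    | 3 => l2.1
    | 4 => l2.2

end PolyCone

namespace RayEnum

open PolyCone

/-! ### Crossing segments -/

/-- The determinant of three vectors in the plane at infinity. -/
def det3 {R : Type} [CommRing R] (u v w : R × R × R) : R :=
  (u.2.1 * v.2.2 - u.2.2 * v.2.1) * w.1 + (u.2.2 * v.1 - u.1 * v.2.2) * w.2.1 +
    (u.1 * v.2.1 - u.2.1 * v.1) * w.2.2

/-- The two numbers have opposite signs. -/
def opposite (a b : ℤ) : Bool := (decide (0 < a) && decide (b < 0)) ||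
  (decide (a < 0) && decide (0 < b))

theorem opposite_iff {a b : ℤ} : opposite a b = true ↔ (0 < a ∧ b < 0) ∨ (a < 0 ∧ 0 < b) := by
  simp [opposite]

/-- The open planar cones spanned by `u, v` and by `w, z` intersect in exactly one ray. -/
def crosses (u v w z : ℤ × ℤ × ℤ) : Bool :=
  opposite (det3 u v w) (det3 u v z) && opposite (det3 w z u) (det3 w z v)

def castTriple (u : ℤ × ℤ × ℤ) : ℝ × ℝ × ℝ := (u.1, u.2.1, u.2.2)

theorem det3_cast (u v w : ℤ × ℤ × ℤ) :
    det3 (castTriple u) (castTriple v) (castTriple w) = ((det3 u v w : ℤ) : ℝ) := by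
  simp [det3, castTriple]

theorem exists_comb_eq_zero_of_det3 {u v w : ℝ × ℝ × ℝ} (h : det3 u v w = 0) :
    ∃ a b c : ℝ, (a ≠ 0 ∨ b ≠ 0 ∨ c ≠ 0) ∧ a • u + b • v + c • w = 0 := by
  have hdet : (!![u.1, v.1, w.1; u.2.1, v.2.1, w.2.1; u.2.2, v.2.2, w.2.2] :
      Matrix (Fin 3) (Fin 3) ℝ).det = 0 := by
    rw [Matrix.det_fin_three]
    simp only [det3] at h
    simp
    linarith
  obtain ⟨x, hx, hx0⟩ := Matrix.exists_mulVec_eq_zero_iff.2 hdet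
  refine ⟨x 0, x 1, x 2, ?_, ?_⟩
  · by_contra! hcon
    apply hx
    funext i
    fin_cases i
    · exact hcon.1
    · exact hcon.2.1
    · exact hcon.2.2
  · have h0 := congrFun hx0 0
    have h1 := congrFun hx0 1
    have h2 := congrFun hx0 2
    simp [Matrix.mulVec, dotProduct, Fin.sum_univ_three] at h0 h1 h2
    ext
    · simp; linarith
    · simp; linarith
    · simp; linarith

/-- The functional `det3 u v` kills `u` and `v`; apply it to both sides. -/
theorem det3_comb (u v : ℝ × ℝ × ℝ) (a b c d : ℝ) (w z : ℝ × ℝ × ℝ)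
    (h : a • u + b • v = c • w + d • z) : c * det3 u v w + d * det3 u v z = 0 := by
  have h0 := congrArg (fun q => q.1) h
  have h1 := congrArg (fun q => q.2.1) h
  have h2 := congrArg (fun q => q.2.2) h
  simp only [Prod.fst_add, Prod.snd_add, Prod.smul_fst, Prod.smul_snd, smul_eq_mul] at h0 h1 h2
  simp only [det3]
  linear_combination (-(u.2.1 * v.2.2 - u.2.2 * v.2.1)) * h0 -
    (u.2.2 * v.1 - u.1 * v.2.2) * h1 - (u.1 * v.2.1 - u.2.1 * v.1) * h2

/-- The sign conditions say that each pair of vectors is separated by the plane through the other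
pair. This allows the first cone to meet either the second one or its negative; non-negativity of
the vectors excludes the latter. -/
theorem exists_of_crosses {u v w z : ℝ × ℝ × ℝ} (hu : 0 ≤ u) (hv : 0 ≤ v) (hw : 0 ≤ w)
    (hz : 0 ≤ z) (h1 : det3 u v w * det3 u v z < 0) (h2 : det3 w z u * det3 w z v < 0) :
    ∃ a b c d : ℝ, 0 < a ∧ 0 < b ∧ 0 < c ∧ 0 < d ∧ a • u + b • v = c • w + d • z := by
  -- The line in which the planes of `u, v` and of `w, z` meet, written in both bases. The signs of
  -- the four determinants tell whether it yields the desired relation or a vanishing positive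
  -- combination.
  have key : det3 u v z • w - det3 u v w • z = det3 w z u • v - det3 w z v • u := by
    ext <;> simp [det3] <;> ring
  have pos : ∀ {a b : ℝ} {p q : ℝ × ℝ × ℝ}, 0 ≤ p → 0 ≤ q → 0 < a → 0 < b →
      0 ≤ a • p + b • q := fun hp hq ha hb =>
    add_nonneg (smul_nonneg ha.le hp) (smul_nonneg hb.le hq)
  have zero : ∀ {a b : ℝ} {p q : ℝ × ℝ × ℝ}, 0 ≤ p → 0 ≤ q → 0 < a → 0 < b →
      a • p + b • q = 0 → p = 0 := fun {a b p q} hp hq ha hb h => by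
    have := (add_eq_zero_iff_of_nonneg (smul_nonneg ha.le hp) (smul_nonneg hb.le hq)).1 h
    exact (smul_eq_zero.1 this.1).resolve_left ha.ne'
  rcases mul_neg_iff.1 h1 with ⟨h3, h4⟩ | ⟨h3, h4⟩ <;>
    rcases mul_neg_iff.1 h2 with ⟨h5, h6⟩ | ⟨h5, h6⟩
  · exfalso
    have e : (-det3 u v z) • w + det3 u v w • z + ((-det3 w z v) • u + det3 w z u • v) = 0 := by
      linear_combination (norm := module) -key
    have := (add_eq_zero_iff_of_nonneg (pos hw hz (by linarith) h3)
      (pos hu hv (by linarith) h5)).1 e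
    have hu0 := zero hu hv (by linarith) h5 this.2
    rw [hu0] at h5
    simp [det3] at h5
  · exact ⟨det3 w z v, -det3 w z u, -det3 u v z, det3 u v w, h6, by linarith, by linarith, h3,
      by linear_combination (norm := module) key⟩
  · exact ⟨-det3 w z v, det3 w z u, det3 u v z, -det3 u v w, by linarith, h5, h4, by linarith,
      by linear_combination (norm := module) -key⟩
  · exfalso
    have e : det3 u v z • w + (-det3 u v w) • z + (det3 w z v • u + (-det3 w z u) • v) = 0 := by
      linear_combination (norm := module) key
    have := (add_eq_zero_iff_of_nonneg (pos hw hz h4 (by linarith))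
      (pos hu hv h6 (by linarith))).1 e
    have hu0 := zero hu hv h6 (by linarith) this.2
    rw [hu0] at h5
    simp [det3] at h5

/-- Pairing with `det3 u v` fixes the ratio of the coefficients of `w` and `z`, pairing with `det3 w
z` that of `u` and `v`; the sum is not zero, so both scale alike. -/
theorem unique_of_crosses {u v w z : ℝ × ℝ × ℝ} (hu : 0 ≤ u) (hv : 0 ≤ v)
    (h1 : det3 u v w * det3 u v z < 0) (h2 : det3 w z u * det3 w z v < 0)
    {a b c d a' b' c' d' : ℝ} (ha : 0 < a) (hb : 0 < b) (hc : 0 < c)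
    (h : a • u + b • v = c • w + d • z) (h' : a' • u + b' • v = c' • w + d' • z) :
    ∃ t : ℝ, a' = t * a ∧ b' = t * b ∧ c' = t * c ∧ d' = t * d := by
  have e1 := det3_comb u v a b c d w z h
  have e1' := det3_comb u v a' b' c' d' w z h'
  have e2 := det3_comb w z c d a b u v h.symm
  have e2' := det3_comb w z c' d' a' b' u v h'.symm
  have hz : det3 u v z ≠ 0 := by rintro h; simp [h] at h1
  have hv0 : det3 w z v ≠ 0 := by rintro h; simp [h] at h2
  have hd : d' = c' / c * d := by
    have : (c' * d - c * d') * det3 u v z = 0 := by linear_combination c' * e1 - c * e1'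
    have := (mul_eq_zero.1 this).resolve_right hz
    field_simp
    linarith
  have hb' : b' = a' / a * b := by
    have : (a' * b - a * b') * det3 w z v = 0 := by linear_combination a' * e2 - a * e2'
    have := (mul_eq_zero.1 this).resolve_right hv0
    field_simp
    linarith
  have hc' : c' = c' / c * c := by field_simp
  have ha' : a' = a' / a * a := by field_simp
  have hsum : a • u + b • v ≠ 0 := by
    intro h0
    have := (add_eq_zero_iff_of_nonneg (smul_nonneg ha.le hu) (smul_nonneg hb.le hv)).1 h0
    have hu0 := (smul_eq_zero.1 this.1).resolve_left ha.ne'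
    rw [hu0] at h2
    simp [det3] at h2
  have : (a' / a) • (a • u + b • v) = (c' / c) • (a • u + b • v) := by
    conv_rhs => rw [h]
    rw [smul_add, smul_add, smul_smul, smul_smul, smul_smul, smul_smul, ← ha', ← hb', ← hc', ← hd]
    exact h'
  have heq : a' / a = c' / c := smul_left_injective ℝ hsum this
  exact ⟨a' / a, ha', hb', heq ▸ hc', heq ▸ hd⟩

/-- If a determinant vanished, a linear dependence would be a solution in which one coefficient is
zero; it is no multiple of the positive solution. Once they do not vanish, `det3_comb` makes the
signs opposite. -/
theorem crosses_of_unique {u v w z : ℝ × ℝ × ℝ} {a b c d : ℝ} (ha : 0 < a) (hb : 0 < b)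
    (hc : 0 < c) (hd : 0 < d) (h : a • u + b • v = c • w + d • z)
    (huniq : ∀ a' b' c' d' : ℝ, a' • u + b' • v = c' • w + d' • z →
      ∃ t : ℝ, a' = t * a ∧ b' = t * b ∧ c' = t * c ∧ d' = t * d) :
    det3 u v w * det3 u v z < 0 ∧ det3 w z u * det3 w z v < 0 := by
  have e1 := det3_comb u v a b c d w z h
  have e2 := det3_comb w z c d a b u v h.symm
  have n1 : det3 u v w ≠ 0 := by
    intro h0
    obtain ⟨x, y, s, hne, hs⟩ := exists_comb_eq_zero_of_det3 h0
    obtain ⟨t, h1, h2, h3, h4⟩ := huniq x y (-s) 0 (by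
      rw [zero_smul, add_zero, neg_smul]; exact eq_neg_of_add_eq_zero_left hs)
    have ht : t = 0 := by
      rcases mul_eq_zero.1 h4.symm with h | h
      · exact h
      · exact absurd h hd.ne'
    rw [ht, zero_mul] at h1 h2 h3
    rw [neg_eq_zero] at h3
    tauto
  have n2 : det3 w z u ≠ 0 := by
    intro h0
    obtain ⟨x, y, s, hne, hs⟩ := exists_comb_eq_zero_of_det3 h0
    obtain ⟨t, h1, h2, h3, h4⟩ := huniq (-s) 0 x y (by
      rw [zero_smul, add_zero, neg_smul]; exact (eq_neg_of_add_eq_zero_left hs).symm)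
    have ht : t = 0 := by
      rcases mul_eq_zero.1 h2.symm with h | h
      · exact h
      · exact absurd h hb.ne'
    rw [ht, zero_mul] at h1 h3 h4
    rw [neg_eq_zero] at h1
    tauto
  have main : ∀ {c d α β : ℝ}, 0 < c → 0 < d → α ≠ 0 → c * α + d * β = 0 → α * β < 0 := by
    intro c d α β hc hd hα h
    have h1 : d * (α * β) = -(c * α ^ 2) := by linear_combination α * h
    have h2 : 0 < c * α ^ 2 := by positivity
    by_contra hcon
    have : 0 ≤ d * (α * β) := mul_nonneg hd.le (not_lt.1 hcon)
    linarith
  exact ⟨main hc hd n1 e1, main ha hb n2 e2⟩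

theorem opposite_iff_mul_neg {a b : ℤ} : opposite a b = true ↔ (a : ℝ) * b < 0 := by
  rw [opposite_iff, mul_neg_iff]
  norm_cast

theorem crosses_iff {u v w z : ℤ × ℤ × ℤ} : crosses u v w z = true ↔
    det3 (castTriple u) (castTriple v) (castTriple w) *
      det3 (castTriple u) (castTriple v) (castTriple z) < 0 ∧
    det3 (castTriple w) (castTriple z) (castTriple u) *
      det3 (castTriple w) (castTriple z) (castTriple v) < 0 := by
  simp only [crosses, Bool.and_eq_true, opposite_iff_mul_neg, det3_cast]

end RayEnum

namespace RayEnum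

open PolyCone

/-! ### Boundary values -/

def flip3 {α : Type} (u : α × α × α) : α × α × α := (u.1, u.2.2, u.2.1)

/-- The first three values recorded by an entry. -/
def val (e : Entry) : ℤ × ℤ × ℤ := (e.2.getD 0 0, e.2.getD 1 0, e.2.getD 2 0)

/-- The two vectors are proportional, and `v` is not zero. -/
def parallel (u v : ℤ × ℤ × ℤ) : Bool :=
  decide (v ≠ (0, 0, 0)) && (decide (u.2.1 * v.1 = u.1 * v.2.1) &&
    (decide (u.2.2 * v.2.1 = u.2.1 * v.2.2) && decide (u.1 * v.2.2 = u.2.2 * v.1)))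

variable {ι : Type} [Fintype ι]

/-- Linear forms that vanish where the values of `p` are proportional to `u`. -/
def dirForms (p : Fin 3 → ι → ℤ) (u : ℤ × ℤ × ℤ) : List (ι → ℤ) :=
  [u.2.1 • p 0 - u.1 • p 1, u.2.2 • p 1 - u.2.1 • p 2, u.1 • p 2 - u.2.2 • p 0]

noncomputable def bdry (p : Fin 3 → ι → ℤ) (x : ι → ℝ) : ℝ × ℝ × ℝ :=
  (form (p 0) x, form (p 1) x, form (p 2) x)

section

variable {p : Fin 3 → ι → ℤ} {x y : ι → ℝ}

theorem fits_iff : Fits p x y ↔ bdry p x = flip3 (bdry p y) := by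
  have h0 : Equiv.swap (1 : Fin 3) 2 0 = 0 := by decide
  simp [Fits, bdry, flip3, Fin.forall_fin_succ, h0]

theorem bdry_smul (t : ℝ) : bdry p (t • x) = t • bdry p x := by
  simp [bdry, form_smul]

theorem bdry_add : bdry p (x + y) = bdry p x + bdry p y := by
  simp [bdry, form_add]

theorem bdry_nonneg (hp : ∀ i c, 0 ≤ p i c) (hx : ∀ c, 0 ≤ x c) : 0 ≤ bdry p x := by
  have : ∀ i, 0 ≤ form (p i) x := fun i =>
    Finset.sum_nonneg fun c _ => mul_nonneg (by exact_mod_cast hp i c) (hx c)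
  exact ⟨this 0, this 1, this 2⟩

theorem castTriple_flip3 (u : ℤ × ℤ × ℤ) : castTriple (flip3 u) = flip3 (castTriple u) := rfl

theorem flip3_smul (t : ℝ) (u : ℝ × ℝ × ℝ) : flip3 (t • u) = t • flip3 u := rfl

theorem flip3_flip3 {α : Type} (u : α × α × α) : flip3 (flip3 u) = u := rfl

theorem castTriple_eq_zero {u : ℤ × ℤ × ℤ} : castTriple u = 0 ↔ u = (0, 0, 0) := by
  obtain ⟨a, b, c⟩ := u
  simp [castTriple]

/-- A non-negative vector that is proportional to `u` is a non-negative multiple of it. -/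
theorem exists_eq_smul_of_proportional {u : ℤ × ℤ × ℤ} (hu : 0 ≤ castTriple u)
    (hu0 : u ≠ (0, 0, 0)) {w : ℝ × ℝ × ℝ} (hw : 0 ≤ w) (h1 : (u.2.1 : ℝ) * w.1 = u.1 * w.2.1)
    (h2 : (u.2.2 : ℝ) * w.2.1 = u.2.1 * w.2.2) (h3 : (u.1 : ℝ) * w.2.2 = u.2.2 * w.1) :
    ∃ t : ℝ, 0 ≤ t ∧ w = t • castTriple u := by
  obtain ⟨a, b, c⟩ := u
  obtain ⟨w0, w1, w2⟩ := w
  simp only [castTriple, ne_eq, Prod.mk.injEq, not_and_or] at *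
  obtain ⟨ha, hb, hc⟩ : (0 : ℝ) ≤ a ∧ (0 : ℝ) ≤ b ∧ (0 : ℝ) ≤ c := ⟨hu.1, hu.2.1, hu.2.2⟩
  obtain ⟨hw0, hw1, hw2⟩ : 0 ≤ w0 ∧ 0 ≤ w1 ∧ 0 ≤ w2 := ⟨hw.1, hw.2.1, hw.2.2⟩
  rcases hu0 with h | h | h
  · have h' : (a : ℝ) ≠ 0 := by exact_mod_cast h
    refine ⟨w0 / a, by positivity, ?_⟩
    simp only [Prod.smul_mk, smul_eq_mul, Prod.mk.injEq]
    refine ⟨by field_simp, ?_, ?_⟩ <;> field_simp <;> linarith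
  · have h' : (b : ℝ) ≠ 0 := by exact_mod_cast h
    refine ⟨w1 / b, by positivity, ?_⟩
    simp only [Prod.smul_mk, smul_eq_mul, Prod.mk.injEq]
    refine ⟨?_, by field_simp, ?_⟩ <;> field_simp <;> linarith
  · have h' : (c : ℝ) ≠ 0 := by exact_mod_cast h
    refine ⟨w2 / c, by positivity, ?_⟩
    simp only [Prod.smul_mk, smul_eq_mul, Prod.mk.injEq]
    refine ⟨?_, ?_, by field_simp⟩ <;> field_simp <;> linarith

theorem form_sub_zsmul (a b : ℤ) (φ ψ : ι → ℤ) (z : ι → ℝ) :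
    form (a • φ - b • ψ) z = a * form φ z - b * form ψ z := by
  simp only [form, Finset.mul_sum, ← Finset.sum_sub_distrib]
  refine Finset.sum_congr rfl fun c _ => ?_
  simp only [Pi.sub_apply, Pi.smul_apply, smul_eq_mul]
  push_cast
  ring

theorem mem_cone_dirForms {E : Set (ι → ℤ)} {u : ℤ × ℤ × ℤ} {z : ι → ℝ} :
    z ∈ cone ({φ | φ ∈ dirForms p u} ∪ E) ↔ z ∈ cone E ∧
      (u.2.1 : ℝ) * (bdry p z).1 = u.1 * (bdry p z).2.1 ∧
      (u.2.2 : ℝ) * (bdry p z).2.1 = u.2.1 * (bdry p z).2.2 ∧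
      (u.1 : ℝ) * (bdry p z).2.2 = u.2.2 * (bdry p z).1 := by
  simp only [cone, dirForms, Set.mem_union, Set.mem_ofPred_eq, List.mem_cons, List.not_mem_nil,
    or_false, or_imp, forall_and, forall_eq, form_sub_zsmul, sub_eq_zero, bdry]
  tauto

theorem exists_eq_smul_of_mem_dirForms {E : Set (ι → ℤ)} (hp : ∀ i c, 0 ≤ p i c)
    {u : ℤ × ℤ × ℤ} (hu : 0 ≤ castTriple u) (hu0 : u ≠ (0, 0, 0)) {z : ι → ℝ}
    (hz : z ∈ cone ({φ | φ ∈ dirForms p u} ∪ E)) :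
    ∃ t : ℝ, 0 ≤ t ∧ bdry p z = t • castTriple u := by
  obtain ⟨hzE, h1, h2, h3⟩ := mem_cone_dirForms.1 hz
  exact exists_eq_smul_of_proportional hu hu0 (bdry_nonneg hp hzE.1) h1 h2 h3

theorem mem_cone_dirForms_of_eq {E : Set (ι → ℤ)} {u : ℤ × ℤ × ℤ} {z : ι → ℝ}
    (hz : z ∈ cone E) {t : ℝ} (h : bdry p z = t • castTriple u) :
    z ∈ cone ({φ | φ ∈ dirForms p u} ∪ E) := by
  refine mem_cone_dirForms.2 ⟨hz, ?_⟩
  rw [h]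
  simp only [castTriple, Prod.smul_mk, smul_eq_mul]
  refine ⟨?_, ?_, ?_⟩ <;> ring

end

/-! ### Counting pairs -/

variable {bit : ι → ℕ} {adm : ℕ → Bool} {E F : Set (ι → ℤ)} {p : Fin 3 → ι → ℤ}
  {R L : List Entry} {V : ℤ × ℤ × ℤ → List Entry} {e f : Entry} {x y : ι → ℝ}

theorem Enumerates.exists_bdry_eq (hbit : Function.Injective bit)
    (h : Enumerates bit adm F [p 0, p 1, p 2] L) (he : e ∈ L) (hx : x ∈ cone F) (hx0 : x ≠ 0)
    (hm : IsMask bit e.1 (Function.support x)) :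
    ∃ k : ℝ, 0 < k ∧ bdry p x = k • castTriple (val e) := by
  obtain ⟨-, v, hv, hmv, k, hk, hval⟩ := h.sound e he
  obtain ⟨t, ht, rfl⟩ := hv.exists_eq_smul hx hx0 (hm.set_unique hbit hmv).le
  refine ⟨t * k, mul_pos ht (by exact_mod_cast hk), ?_⟩
  obtain ⟨m, l⟩ := e
  rcases l with _ | ⟨a, _ | ⟨b, _ | ⟨c, _ | ⟨d, l⟩⟩⟩⟩
  · simp at hval
  · simp at hval
  · simp at hval
  · simp only [List.map_cons, List.map_nil, List.cons.injEq, and_true] at hval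
    rw [bdry_smul, bdry, form_toReal, form_toReal, form_toReal, hval.1, hval.2.1, hval.2.2, mul_smul]
    simp [val, castTriple]
  · simp at hval

theorem Enumerates.exists_ray (h : Enumerates bit adm F [p 0, p 1, p 2] L) (he : e ∈ L) :
    ∃ v : ι → ℝ, IsRay (cone F) v ∧ IsMask bit e.1 (Function.support v) := by
  obtain ⟨-, v, hv, hmv, -⟩ := h.sound e he
  exact ⟨toReal v, hv, hmv⟩

theorem Enumerates.isRay_of_mask (hbit : Function.Injective bit)
    (h : Enumerates bit adm F [p 0, p 1, p 2] L) (he : e ∈ L) (hx : x ∈ cone F) (hx0 : x ≠ 0)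
    (hm : IsMask bit e.1 (Function.support x)) : IsRay (cone F) x := by
  obtain ⟨v, hv, hmv⟩ := h.exists_ray he
  obtain ⟨t, ht, rfl⟩ := hv.exists_eq_smul hx hx0 (hm.set_unique hbit hmv).le
  exact hv.smul ht

/-- Non-negativity turns proportionality of the boundary values, which is a set of linear equations,
into being a non-negative multiple, which is the condition that defines the slice. -/
theorem isPairRay_iff_isRay_dirForms (hp : ∀ i c, 0 ≤ p i c) {u : ℤ × ℤ × ℤ}
    (hx : IsRay (cone E) x) {k : ℝ} (hk : 0 < k) (hxu : bdry p x = k • castTriple u)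
    (hu0 : u ≠ (0, 0, 0)) (hxy : Fits p x y) :
    IsPairRay E p x y ↔ IsRay (cone ({φ | φ ∈ dirForms p (flip3 u)} ∪ E)) y := by
  have hu : 0 ≤ castTriple u := by
    have := smul_nonneg (inv_pos.2 hk).le (bdry_nonneg hp hx.1.1)
    rwa [hxu, smul_smul, inv_mul_cancel₀ hk.ne', one_smul] at this
  have hfu : 0 ≤ castTriple (flip3 u) := ⟨hu.1, hu.2.2, hu.2.1⟩
  have hfu0 : flip3 u ≠ (0, 0, 0) := fun h => hu0 (by rw [← flip3_flip3 u, h]; rfl)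
  refine isPairRay_iff_of_isRay hx (fun z => ⟨fun hz => ?_, ?_⟩) ?_ hxy
  · obtain ⟨t, ht, hzt⟩ := exists_eq_smul_of_mem_dirForms hp hfu hfu0 hz
    refine ⟨(mem_cone_dirForms.1 hz).1, t / k, by positivity, fits_iff.2 ?_⟩
    rw [bdry_smul, hxu, hzt, smul_smul, div_mul_cancel₀ _ hk.ne']
    rfl
  · rintro ⟨hzE, t, -, hf⟩
    refine mem_cone_dirForms_of_eq hzE (t := t * k) ?_
    have := fits_iff.1 hf
    rw [bdry_smul, hxu, smul_smul] at this
    rw [← flip3_flip3 (bdry p z), ← this]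
    rfl
  · by_contra! hcon
    have : bdry p x = 0 := by
      simp only [bdry, hcon]; rfl
    rw [hxu, smul_eq_zero, castTriple_eq_zero] at this
    exact this.elim hk.ne' hu0

/-- Masks of pairs whose first component is an extremal ray that satisfies `c`. -/
def rayPairs (R : List Entry) (V : ℤ × ℤ × ℤ → List Entry) (c : Entry → Bool) : List (ℕ × ℕ) :=
  (R.filter c).flatMap fun e =>
    ((V (flip3 (val e))).filter fun f => decide (val f ≠ (0, 0, 0))).map fun f => (e.1, f.1)

/-- The slice along a direction also contains rays with zero boundary; these cannot be scaled to fit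
a ray with non-zero boundary and are filtered out. Each remaining ray fits after one rescaling. -/
theorem mem_rayPairs (hbit : Function.Injective bit) (hp : ∀ i c, 0 ≤ p i c)
    (hR : Enumerates bit adm E [p 0, p 1, p 2] R)
    (hV : ∀ u, Enumerates bit adm ({φ | φ ∈ dirForms p u} ∪ E) [p 0, p 1, p 2] (V u))
    {c : Entry → Bool} (hc : ∀ e, c e = true → val e ≠ (0, 0, 0)) (q : ℕ × ℕ) :
    q ∈ rayPairs R V c ↔ ∃ e ∈ R, c e = true ∧ e.1 = q.1 ∧ adm q.2 = true ∧
      ∃ x y, IsPairRay E p x y ∧ IsMask bit q.1 (Function.support x) ∧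
        IsMask bit q.2 (Function.support y) := by
  simp only [rayPairs, List.mem_flatMap, List.mem_map, List.mem_filter, decide_eq_true_eq]
  constructor
  · rintro ⟨e, ⟨he, hce⟩, f, ⟨hf, hf0⟩, rfl⟩
    refine ⟨e, he, hce, rfl, (hV _).sound f hf |>.1, ?_⟩
    obtain ⟨x, hx, hmx⟩ := hR.exists_ray he
    obtain ⟨y, hy, hmy⟩ := (hV _).exists_ray hf
    obtain ⟨k, hk, hxk⟩ := hR.exists_bdry_eq hbit he hx.1 hx.2.1 hmx
    obtain ⟨l, hl, hyl⟩ := (hV _).exists_bdry_eq hbit hf hy.1 hy.2.1 hmy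
    have hu : 0 ≤ castTriple (val e) := by
      have := smul_nonneg (inv_pos.2 hk).le (bdry_nonneg hp hx.1.1)
      rwa [hxk, smul_smul, inv_mul_cancel₀ hk.ne', one_smul] at this
    obtain ⟨t, ht, hyt⟩ := exists_eq_smul_of_mem_dirForms hp
      (u := flip3 (val e)) ⟨hu.1, hu.2.2, hu.2.1⟩
      (fun h => hc e hce (by rw [← flip3_flip3 (val e), h]; rfl)) hy.1
    have ht0 : t ≠ 0 := by
      rintro rfl
      rw [zero_smul, hyl, smul_eq_zero, castTriple_eq_zero] at hyt
      exact hyt.elim hl.ne' hf0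
    have htp : 0 < t := lt_of_le_of_ne ht (Ne.symm ht0)
    have hkt : 0 < k / t := div_pos hk htp
    -- The boundary values of `x` and `y` are `k` and `t` times the same triple up to `flip3`.
    refine ⟨x, (k / t) • y, ?_, hmx, by rwa [support_smul hkt.ne']⟩
    refine (isPairRay_iff_isRay_dirForms hp hx hk hxk (hc e hce) (fits_iff.2 ?_)).2 (hy.smul hkt)
    rw [bdry_smul, hyt, smul_smul, div_mul_cancel₀ _ ht0, hxk]
    rfl
  · rintro ⟨e, he, hce, heq, hadm, x, y, hxy, hmx, hmy⟩
    rw [← heq] at hmx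
    have hx0 : x ≠ 0 := by
      rintro rfl
      obtain ⟨v, hv, hmv⟩ := hR.exists_ray he
      have := hmx.set_unique hbit hmv
      rw [Function.support_zero] at this
      exact hv.2.1 (Function.support_eq_empty_iff.1 this.symm)
    have hx := hR.isRay_of_mask hbit he hxy.1 hx0 hmx
    obtain ⟨k, hk, hxk⟩ := hR.exists_bdry_eq hbit he hx.1 hx.2.1 hmx
    have hy := (isPairRay_iff_isRay_dirForms hp hx hk hxk (hc e hce) hxy.2.2.1).1 hxy
    obtain ⟨f, hf, hfq⟩ := (hV _).complete y q.2 hy hmy hadm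
    refine ⟨e, ⟨he, hce⟩, f, ⟨hf, ?_⟩, Prod.ext heq hfq⟩
    intro hf0
    obtain ⟨l, hl, hyl⟩ := (hV _).exists_bdry_eq hbit hf hy.1 hy.2.1 (hfq ▸ hmy)
    rw [hf0, castTriple_eq_zero.2 rfl, smul_zero] at hyl
    have := fits_iff.1 hxy.2.2.1
    rw [hyl, hxk] at this
    have h0 : k • castTriple (val e) = 0 := this
    rw [smul_eq_zero, castTriple_eq_zero] at h0
    exact h0.elim hk.ne' (hc e hce)

theorem nodup_flatMap_map {α β : Type} {k : α → ℕ} {k' : β → ℕ} {R : List α}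
    (hR : (R.map k).Nodup) {W : α → List β} (hW : ∀ e ∈ R, ((W e).map k').Nodup) :
    (R.flatMap fun e => (W e).map fun f => (k e, k' f)).Nodup := by
  rw [List.nodup_flatMap]
  constructor
  · intro e he
    have := (hW e he).map (f := fun m => (k e, m)) (fun a b h => (Prod.ext_iff.1 h).2)
    rwa [List.map_map] at this
  · rw [List.nodup_iff_pairwise_ne, List.pairwise_map] at hR
    refine hR.imp fun hne => ?_
    change List.Disjoint _ _
    intro q hq hq'
    obtain ⟨f, -, rfl⟩ := List.mem_map.1 hq
    obtain ⟨f', -, h⟩ := List.mem_map.1 hq'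
    exact hne (Prod.ext_iff.1 h).1.symm

theorem nodup_rayPairs (hR : Enumerates bit adm E [p 0, p 1, p 2] R)
    (hV : ∀ u, Enumerates bit adm ({φ | φ ∈ dirForms p u} ∪ E) [p 0, p 1, p 2] (V u))
    (c : Entry → Bool) : (rayPairs R V c).Nodup :=
  nodup_flatMap_map (k := Prod.fst) (k' := Prod.fst) (hR.nodup.sublist (List.filter_sublist.map _)) fun _ _ =>
    (hV _).nodup.sublist (List.filter_sublist.map _)

theorem length_rayPairs (c : Entry → Bool) : (rayPairs R V c).length =
    ((R.filter c).map fun e =>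
      (V (flip3 (val e))).countP fun f => decide (val f ≠ (0, 0, 0))).sum := by
  simp [rayPairs, List.length_flatMap, List.countP_eq_length_filter]

/-- Masks of pairs of extremal rays of which the first satisfies `c`. -/
def doubleRayPairs (R : List Entry) (c : Entry → Bool) : List (ℕ × ℕ) :=
  (R.filter c).flatMap fun e =>
    (R.filter fun f => parallel (flip3 (val e)) (val f)).map fun f => (e.1, f.1)

theorem mem_doubleRayPairs (hbit : Function.Injective bit) (hp : ∀ i c, 0 ≤ p i c)
    (hR : Enumerates bit adm E [p 0, p 1, p 2] R)
    {c : Entry → Bool} (hc : ∀ e, c e = true → val e ≠ (0, 0, 0)) (q : ℕ × ℕ) :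
    q ∈ doubleRayPairs R c ↔ ∃ e ∈ R, c e = true ∧ e.1 = q.1 ∧ (∃ f ∈ R, f.1 = q.2) ∧
      ∃ x y, IsPairRay E p x y ∧ IsMask bit q.1 (Function.support x) ∧
        IsMask bit q.2 (Function.support y) := by
  simp only [doubleRayPairs, List.mem_flatMap, List.mem_map, List.mem_filter]
  constructor
  · rintro ⟨e, ⟨he, hce⟩, f, ⟨hf, hpar⟩, rfl⟩
    refine ⟨e, he, hce, rfl, ⟨f, hf, rfl⟩, ?_⟩
    obtain ⟨x, hx, hmx⟩ := hR.exists_ray he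
    obtain ⟨y, hy, hmy⟩ := hR.exists_ray hf
    obtain ⟨k, hk, hxk⟩ := hR.exists_bdry_eq hbit he hx.1 hx.2.1 hmx
    obtain ⟨l, hl, hyl⟩ := hR.exists_bdry_eq hbit hf hy.1 hy.2.1 hmy
    have hu : 0 ≤ castTriple (val e) := by
      have := smul_nonneg (inv_pos.2 hk).le (bdry_nonneg hp hx.1.1)
      rwa [hxk, smul_smul, inv_mul_cancel₀ hk.ne', one_smul] at this
    simp only [parallel, Bool.and_eq_true, decide_eq_true_eq] at hpar
    obtain ⟨hf0, h1, h2, h3⟩ := hpar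
    have hyF : y ∈ cone ({φ | φ ∈ dirForms p (flip3 (val e))} ∪ E) := by
      refine mem_cone_dirForms.2 ⟨hy.1, ?_⟩
      rw [hyl]
      simp only [castTriple, Prod.smul_mk, smul_eq_mul]
      have h1' : ((flip3 (val e)).2.1 : ℝ) * (val f).1 = (flip3 (val e)).1 * (val f).2.1 := by
        exact_mod_cast h1
      have h2' : ((flip3 (val e)).2.2 : ℝ) * (val f).2.1 = (flip3 (val e)).2.1 * (val f).2.2 := by
        exact_mod_cast h2
      have h3' : ((flip3 (val e)).1 : ℝ) * (val f).2.2 = (flip3 (val e)).2.2 * (val f).1 := by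
        exact_mod_cast h3
      exact ⟨by linear_combination l * h1', by linear_combination l * h2',
        by linear_combination l * h3'⟩
    obtain ⟨t, ht, hyt⟩ := exists_eq_smul_of_mem_dirForms hp
      (u := flip3 (val e)) ⟨hu.1, hu.2.2, hu.2.1⟩
      (fun h => hc e hce (by rw [← flip3_flip3 (val e), h]; rfl)) hyF
    have ht0 : t ≠ 0 := by
      rintro rfl
      rw [zero_smul, hyl, smul_eq_zero, castTriple_eq_zero] at hyt
      exact hyt.elim hl.ne' hf0
    have htp : 0 < t := lt_of_le_of_ne ht (Ne.symm ht0)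
    have hkt : 0 < k / t := div_pos hk htp
    refine ⟨x, (k / t) • y, ?_, hmx, by rwa [support_smul hkt.ne']⟩
    refine (isPairRay_iff_isRay_dirForms hp hx hk hxk (hc e hce) (fits_iff.2 ?_)).2 ?_
    · rw [bdry_smul, hyt, smul_smul, div_mul_cancel₀ _ ht0, hxk]
      rfl
    -- A ray of the full cone that lies in the slice is also a ray of the slice.
    · have hr := hy.smul hkt
      exact ⟨smul_mem_cone hkt.le hyF, hr.2.1,
        fun z hz => hr.2.2 z (mem_cone_dirForms.1 hz).1⟩
  · rintro ⟨e, he, hce, heq, ⟨f, hf, hfq⟩, x, y, hxy, hmx, hmy⟩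
    rw [← heq] at hmx
    rw [← hfq] at hmy
    have hne : ∀ {e : Entry} {x : ι → ℝ}, e ∈ R → IsMask bit e.1 (Function.support x) →
        x ≠ 0 := by
      rintro e x he hmx rfl
      obtain ⟨v, hv, hmv⟩ := hR.exists_ray he
      have := hmx.set_unique hbit hmv
      rw [Function.support_zero] at this
      exact hv.2.1 (Function.support_eq_empty_iff.1 this.symm)
    obtain ⟨k, hk, hxk⟩ := hR.exists_bdry_eq hbit he hxy.1 (hne he hmx) hmx
    obtain ⟨l, hl, hyl⟩ := hR.exists_bdry_eq hbit hf hxy.2.1 (hne hf hmy) hmy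
    refine ⟨e, ⟨he, hce⟩, f, ⟨hf, ?_⟩, Prod.ext heq hfq⟩
    have hfit := fits_iff.1 hxy.2.2.1
    rw [hyl, hxk] at hfit
    have hfit' : k • castTriple (flip3 (val e)) = l • castTriple (val f) := by
      rw [castTriple_flip3, ← flip3_smul, hfit]; rfl
    have hval : castTriple (val f) = (k / l) • castTriple (flip3 (val e)) := by
      rw [div_eq_inv_mul, mul_smul, hfit', smul_smul, inv_mul_cancel₀ hl.ne', one_smul]
    simp only [parallel, Bool.and_eq_true, decide_eq_true_eq]
    refine ⟨fun h0 => ?_, ?_⟩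
    · rw [h0, castTriple_eq_zero.2 rfl, eq_comm, smul_eq_zero, castTriple_eq_zero] at hval
      refine hval.elim (div_pos hk hl).ne' fun h => hc e hce ?_
      rw [← flip3_flip3 (val e), h]; rfl
    · have g1 := congrArg (fun q => q.1) hval
      have g2 := congrArg (fun q => q.2.1) hval
      have g3 := congrArg (fun q => q.2.2) hval
      simp only [castTriple, Prod.smul_mk, smul_eq_mul] at g1 g2 g3
      have c1 : ((flip3 (val e)).2.1 : ℝ) * (val f).1 = (flip3 (val e)).1 * (val f).2.1 := by
        rw [g1, g2]; ring
      have c2 : ((flip3 (val e)).2.2 : ℝ) * (val f).2.1 = (flip3 (val e)).2.1 * (val f).2.2 := by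
        rw [g2, g3]; ring
      have c3 : ((flip3 (val e)).1 : ℝ) * (val f).2.2 = (flip3 (val e)).2.2 * (val f).1 := by
        rw [g1, g3]; ring
      exact ⟨by exact_mod_cast c1, by exact_mod_cast c2, by exact_mod_cast c3⟩

theorem nodup_doubleRayPairs (hR : Enumerates bit adm E [p 0, p 1, p 2] R) (c : Entry → Bool) :
    (doubleRayPairs R c).Nodup :=
  nodup_flatMap_map (k := Prod.fst) (k' := Prod.fst) (hR.nodup.sublist (List.filter_sublist.map _)) fun _ _ =>
    hR.nodup.sublist (List.filter_sublist.map _)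

theorem length_doubleRayPairs (c : Entry → Bool) : (doubleRayPairs R c).length =
    ((R.filter c).map fun e =>
      R.countP fun f => parallel (flip3 (val e)) (val f)).sum := by
  simp [doubleRayPairs, List.length_flatMap, List.countP_eq_length_filter]

end RayEnum

namespace RayEnum

open PolyCone

/-! ### Pairs of edges -/

/-- All pairs of members of a list, each in the order of the list. -/
def pairsOf {α : Type} : List α → List (α × α)
  | [] => []
  | a :: l => l.map (fun b => (a, b)) ++ pairsOf l

section

variable {α : Type} {l : List α} {a b : α}

theorem mem_of_mem_pairsOf (h : (a, b) ∈ pairsOf l) : a ∈ l ∧ b ∈ l := by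
  induction l with
  | nil => simp [pairsOf] at h
  | cons c l ih =>
    simp only [pairsOf, List.mem_append, List.mem_map, Prod.mk.injEq] at h
    rcases h with ⟨d, hd, rfl, rfl⟩ | h
    · exact ⟨List.mem_cons_self, List.mem_cons_of_mem _ hd⟩
    · exact ⟨List.mem_cons_of_mem _ (ih h).1, List.mem_cons_of_mem _ (ih h).2⟩

theorem pairsOf_mem_or (hab : a ≠ b) (ha : a ∈ l) (hb : b ∈ l) :
    (a, b) ∈ pairsOf l ∨ (b, a) ∈ pairsOf l := by
  induction l with
  | nil => simp at ha
  | cons c l ih =>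
    simp only [pairsOf, List.mem_append, List.mem_map, Prod.mk.injEq, List.mem_cons] at *
    rcases ha with rfl | ha <;> rcases hb with rfl | hb
    · exact absurd rfl hab
    · exact Or.inl (Or.inl ⟨b, hb, rfl, rfl⟩)
    · exact Or.inr (Or.inl ⟨a, ha, rfl, rfl⟩)
    · exact (ih ha hb).imp Or.inr Or.inr

theorem ne_of_mem_pairsOf (hl : l.Nodup) (h : (a, b) ∈ pairsOf l) : a ≠ b := by
  induction l with
  | nil => simp [pairsOf] at h
  | cons c l ih =>
    simp only [pairsOf, List.mem_append, List.mem_map, Prod.mk.injEq] at h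
    rcases h with ⟨d, hd, rfl, rfl⟩ | h
    · rintro rfl
      exact (List.nodup_cons.1 hl).1 hd
    · exact ih (List.nodup_cons.1 hl).2 h

theorem not_mem_pairsOf_swap (hl : l.Nodup) (h : (a, b) ∈ pairsOf l) : (b, a) ∉ pairsOf l := by
  induction l with
  | nil => simp [pairsOf] at h
  | cons c l ih =>
    have hc := (List.nodup_cons.1 hl).1
    intro h'
    simp only [pairsOf, List.mem_append, List.mem_map, Prod.mk.injEq] at h h'
    rcases h with ⟨d, hd, rfl, rfl⟩ | h <;> rcases h' with ⟨d', hd', rfl, rfl⟩ | h'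
    · exact hc hd
    · exact hc (mem_of_mem_pairsOf h').2
    · exact hc (mem_of_mem_pairsOf h).2
    · exact ih (List.nodup_cons.1 hl).2 h h'

theorem nodup_pairsOf (hl : l.Nodup) : (pairsOf l).Nodup := by
  induction l with
  | nil => exact List.nodup_nil
  | cons c l ih =>
    obtain ⟨hc, hl⟩ := List.nodup_cons.1 hl
    rw [pairsOf, List.nodup_append]
    refine ⟨hl.map fun a b h => (Prod.ext_iff.1 h).2, ih hl, fun q hq q' hq' hqq => ?_⟩
    obtain ⟨d, -, rfl⟩ := List.mem_map.1 hq
    subst hqq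
    exact hc (mem_of_mem_pairsOf hq').1

end

/-- The pairs of extremal rays that span an admissible two-dimensional face. -/
noncomputable def edges (adm : ℕ → Bool) (R : List Entry) : List (Entry × Entry) :=
  (pairsOf R).filter fun g => adm (Nat.lor g.1.1 g.2.1) &&
    countBelow (Nat.lor g.1.1 g.2.1) (R.map Prod.fst) 2

/-- The images of two edges cross. -/
def edgesCross (g h : Entry × Entry) : Bool :=
  crosses (val g.1) (val g.2) (flip3 (val h.1)) (flip3 (val h.2))

/-- Masks of the pairs of faces spanned by crossing edges. -/
noncomputable def edgePairs (adm : ℕ → Bool) (R : List Entry) : List (ℕ × ℕ) :=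
  (edges adm R).flatMap fun g => ((edges adm R).filter fun h => edgesCross g h).map fun h =>
    (Nat.lor g.1.1 g.2.1, Nat.lor h.1.1 h.2.1)

theorem support_comb_subset {ι : Type} {r s x : ι → ℝ} (hr : Function.support r ⊆ Function.support x)
    (hs : Function.support s ⊆ Function.support x) (a b : ℝ) :
    Function.support (a • r + b • s) ⊆ Function.support x :=
  (Function.support_add _ _).trans (Set.union_subset
    ((Function.support_const_smul_subset a r).trans hr)
    ((Function.support_const_smul_subset b s).trans hs))

variable {ι : Type} [Fintype ι] {bit : ι → ℕ} {adm : ℕ → Bool} {E : Set (ι → ℤ)}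
  {p : Fin 3 → ι → ℤ} {R : List Entry} {V : ℤ × ℤ × ℤ → List Entry} {e f : Entry}
  {g h : Entry × Entry} {x y : ι → ℝ} {m m' : ℕ}

theorem Enumerates.exists_ray_val (hbit : Function.Injective bit)
    (hR : Enumerates bit adm E [p 0, p 1, p 2] R) (he : e ∈ R) :
    ∃ r, IsRay (cone E) r ∧ IsMask bit e.1 (Function.support r) ∧
      bdry p r = castTriple (val e) := by
  obtain ⟨r, hr, hmr⟩ := hR.exists_ray he
  obtain ⟨k, hk, hrk⟩ := hR.exists_bdry_eq hbit he hr.1 hr.2.1 hmr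
  have hk' := inv_pos.2 hk
  refine ⟨k⁻¹ • r, hr.smul hk', by rwa [support_smul hk'.ne'], ?_⟩
  rw [bdry_smul, hrk, smul_smul, inv_mul_cancel₀ hk.ne', one_smul]

/-- Since `y` is not extremal, two different rays lie below it, and `IsPairRay.eq_or_eq` leaves
exactly two rays below `x`. They are thus adjacent, and `x` is a combination of them in which both
coefficients are positive because `x` is not extremal. -/
theorem exists_edge (hbit : Function.Injective bit)
    (hadm : ∀ m m', adm m' = true → Nat.beq (Nat.lor m m') m' = true → adm m = true)
    (hR : Enumerates bit adm E [p 0, p 1, p 2] R) (hxy : IsPairRay E p x y)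
    (hx0 : x ≠ 0) (hy0 : y ≠ 0) (hx : ¬ IsRay (cone E) x) (hy : ¬ IsRay (cone E) y)
    (hm : IsMask bit m (Function.support x)) (ha : adm m = true) :
    ∃ g ∈ edges adm R, Nat.lor g.1.1 g.2.1 = m ∧ ∃ r s, IsRay (cone E) r ∧ IsRay (cone E) s ∧
      Function.support r ≠ Function.support s ∧
      bdry p r = castTriple (val g.1) ∧ bdry p s = castTriple (val g.2) ∧
      Function.support r ⊆ Function.support x ∧ Function.support s ⊆ Function.support x ∧
      ∃ a b : ℝ, 0 < a ∧ 0 < b ∧ x = a • r + b • s := by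
  obtain ⟨s₁, s₂, hs₁, hs₂, hs₁y, hs₂y, hs⟩ := exists_two_rays hxy.2.1 hy0 hy
  obtain ⟨r₁, r₂, hr₁, hr₂, hr₁x, hr₂x, hr⟩ := exists_two_rays hxy.1 hx0 hx
  have hall : ∀ z, IsRay (cone E) z → Function.support z ⊆ Function.support x →
      Function.support z = Function.support r₁ ∨ Function.support z = Function.support r₂ :=
    fun z hz hzx => hxy.eq_or_eq hr₁ hr₂ hs₁ hs₂ hz hr hs hr₁x hr₂x hzx hs₁y hs₂y
  -- the two entries, in either order
  have main : ∀ g : Entry × Entry, g ∈ pairsOf R → ∀ r₁ r₂, IsRay (cone E) r₁ →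
      IsRay (cone E) r₂ → Function.support r₁ ≠ Function.support r₂ →
      Function.support r₁ ⊆ Function.support x → Function.support r₂ ⊆ Function.support x →
      IsMask bit g.1.1 (Function.support r₁) → IsMask bit g.2.1 (Function.support r₂) →
      (∀ z, IsRay (cone E) z → Function.support z ⊆ Function.support x →
        Function.support z = Function.support r₁ ∨ Function.support z = Function.support r₂) →
      ∃ g ∈ edges adm R, Nat.lor g.1.1 g.2.1 = m ∧ ∃ r s, IsRay (cone E) r ∧ IsRay (cone E) s ∧
      Function.support r ≠ Function.support s ∧
      bdry p r = castTriple (val g.1) ∧ bdry p s = castTriple (val g.2) ∧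
      Function.support r ⊆ Function.support x ∧ Function.support s ⊆ Function.support x ∧
      ∃ a b : ℝ, 0 < a ∧ 0 < b ∧ x = a • r + b • s := by
    rintro ⟨e, e'⟩ hg r₁ r₂ hr₁ hr₂ hr hr₁x hr₂x hm₁ hm₂ hall
    obtain ⟨he, he'⟩ := mem_of_mem_pairsOf hg
    obtain ⟨r, hrr, hmr, hbr⟩ := hR.exists_ray_val hbit he
    obtain ⟨s, hss, hms, hbs⟩ := hR.exists_ray_val hbit he'
    have er : Function.support r₁ = Function.support r := hm₁.set_unique hbit hmr
    have es : Function.support r₂ = Function.support s := hm₂.set_unique hbit hms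
    rw [er, es] at hr hall
    rw [er] at hr₁x
    rw [es] at hr₂x
    obtain ⟨a, b, ha', hb', hxab⟩ := exists_eq_add_of_rays (v := r) (w := s) hxy.1
      (fun z hz hzs => by
        rcases hall z hz hzs with h | h
        · obtain ⟨t, ht, rfl⟩ := hrr.exists_eq_smul hz.1 hz.2.1 h.le
          exact ⟨t, 0, ht.le, le_rfl, by simp⟩
        · obtain ⟨t, ht, rfl⟩ := hss.exists_eq_smul hz.1 hz.2.1 h.le
          exact ⟨0, t, le_rfl, ht.le, by simp⟩)
    have ha0 : 0 < a := by
      refine lt_of_le_of_ne ha' fun h0 => hx ?_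
      rw [← h0, zero_smul, zero_add] at hxab
      rw [hxab]
      refine hss.smul (lt_of_le_of_ne hb' fun h0 => hx0 ?_)
      rw [hxab, ← h0, zero_smul]
    have hb0 : 0 < b := by
      refine lt_of_le_of_ne hb' fun h0 => hx ?_
      rw [← h0, zero_smul, add_zero] at hxab
      rw [hxab]
      exact hrr.smul ha0
    have hun : Function.support x = Function.support r ∪ Function.support s := by
      rw [hxab, support_add_of_nonneg (smul_mem_cone ha'  hrr.1).1 (smul_mem_cone hb' hss.1).1,
        support_smul ha0.ne', support_smul hb0.ne']
    have hmu := hmr.union hms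
    have hlor : Nat.lor e.1 e'.1 = m := hmu.unique (hun ▸ hm)
    refine ⟨(e, e'), List.mem_filter.2 ⟨hg, ?_⟩, hlor, r, s, hrr, hss, hr, hbr, hbs,
      hr₁x, hr₂x, a, b, ha0, hb0, hxab⟩
    rw [Bool.and_eq_true]
    have hne : e.1 ≠ e'.1 := fun hcon => hr ((hcon ▸ hmr).set_unique hbit hms)
    refine ⟨hlor ▸ ha, (adjacent_iff hbit hadm hR he he' hne hmr hms (hlor ▸ ha)).2 ?_⟩
    rw [← hun]
    exact hall
  obtain ⟨m₁, hm₁⟩ := exists_isMask bit (Function.support r₁)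
  obtain ⟨m₂, hm₂⟩ := exists_isMask bit (Function.support r₂)
  obtain ⟨e, he, rfl⟩ := hR.complete r₁ m₁ hr₁ hm₁ (hadm _ _ ha ((hm₁.below_iff hbit hm).2 hr₁x))
  obtain ⟨e', he', rfl⟩ := hR.complete r₂ m₂ hr₂ hm₂ (hadm _ _ ha ((hm₂.below_iff hbit hm).2 hr₂x))
  have hne : e ≠ e' := fun hcon => hr ((hcon ▸ hm₁).set_unique hbit hm₂)
  rcases pairsOf_mem_or hne he he' with hg | hg
  · exact main _ hg r₁ r₂ hr₁ hr₂ hr hr₁x hr₂x hm₁ hm₂ hall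
  · exact main _ hg r₂ r₁ hr₂ hr₁ hr.symm hr₂x hr₁x hm₂ hm₁ fun z hz hzs => (hall z hz hzs).symm

theorem form_eq_zero_of_comb {r s : ι → ℝ} (hr : r ∈ cone E) (hs : s ∈ cone E) (a b : ℝ) :
    ∀ φ ∈ E, form φ (a • r + b • s) = 0 := fun φ hφ => by
  rw [form_add, form_smul, form_smul, hr.2 φ hφ, hs.2 φ hφ]; simp

theorem flip3_comb (a b : ℝ) (u v : ℝ × ℝ × ℝ) :
    flip3 (a • u + b • v) = a • flip3 u + b • flip3 v := rfl

theorem coeff_eq_of_comb_eq {r s : ι → ℝ} (hr : IsRay (cone E) r) (hs : IsRay (cone E) s)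
    (hrs : Function.support r ≠ Function.support s) {a b a' b' t : ℝ}
    (h : a' • r + b' • s = t • (a • r + b • s)) : a' = t * a ∧ b' = t * b := by
  have : (a' - t * a) • r + (b' - t * b) • s = 0 := by
    rw [sub_smul, sub_smul, mul_smul, mul_smul, sub_add_sub_comm, h, smul_add, sub_self]
  have := linearIndependent_two_rays hr hs hrs this
  exact ⟨sub_eq_zero.1 this.1, sub_eq_zero.1 this.2⟩

/-- The data provided by an edge. -/
theorem exists_rays_of_mem_edges (hbit : Function.Injective bit)
    (hadm : ∀ m m', adm m' = true → Nat.beq (Nat.lor m m') m' = true → adm m = true)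
    (hR : Enumerates bit adm E [p 0, p 1, p 2] R) (hg : g ∈ edges adm R) :
    adm (Nat.lor g.1.1 g.2.1) = true ∧ ∃ r s, IsRay (cone E) r ∧ IsRay (cone E) s ∧
      Function.support r ≠ Function.support s ∧
      IsMask bit g.1.1 (Function.support r) ∧ IsMask bit g.2.1 (Function.support s) ∧
      bdry p r = castTriple (val g.1) ∧ bdry p s = castTriple (val g.2) ∧
      ∀ z ∈ cone E, Function.support z ⊆ Function.support r ∪ Function.support s →
        ∃ a b : ℝ, z = a • r + b • s := by
  obtain ⟨e, e'⟩ := g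
  obtain ⟨hp, hg⟩ := List.mem_filter.1 hg
  rw [Bool.and_eq_true] at hg
  obtain ⟨he, he'⟩ := mem_of_mem_pairsOf hp
  have hne : e.1 ≠ e'.1 := fun hcon =>
    ne_of_mem_pairsOf hR.nodup.of_map hp (hR.mem_of_adm he he' hcon)
  obtain ⟨r, hrr, hmr, hbr⟩ := hR.exists_ray_val hbit he
  obtain ⟨s, hss, hms, hbs⟩ := hR.exists_ray_val hbit he'
  refine ⟨hg.1, r, s, hrr, hss, fun hcon => hne (hmr.unique (hcon ▸ hms)), hmr, hms, hbr, hbs,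
    fun z hz hzs => ?_⟩
  have hadj := (adjacent_iff hbit hadm hR he he' hne hmr hms hg.1).1 hg.2
  obtain ⟨a, b, -, -, h⟩ := exists_eq_add_of_rays (v := r) (w := s) hz (fun z' hz' hzs' => by
    rcases hadj z' hz' (hzs'.trans hzs) with h | h
    · obtain ⟨t, ht, rfl⟩ := hrr.exists_eq_smul hz'.1 hz'.2.1 h.le
      exact ⟨t, 0, ht.le, le_rfl, by simp⟩
    · obtain ⟨t, ht, rfl⟩ := hss.exists_eq_smul hz'.1 hz'.2.1 h.le
      exact ⟨0, t, le_rfl, ht.le, by simp⟩)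
  exact ⟨a, b, h⟩

variable (bit adm E p) in
/-- The masks of the admissible pair rays with the prescribed kind of boundary. -/
def pairMasks : Set (ℕ × ℕ) := {q | adm q.1 = true ∧ adm q.2 = true ∧
  ∃ x y, IsPairRay E p x y ∧ IsMask bit q.1 (Function.support x) ∧
    IsMask bit q.2 (Function.support y) ∧ 0 < form (p 0) x + form (p 1) x}

/-- For `x` and `y` inside two-dimensional faces, the fitting pairs with these supports are the
solutions of one equation in the plane at infinity, and a pair ray means a positive solution that is
unique up to scaling; this is what crossing expresses. -/
theorem mem_edgePairs (hbit : Function.Injective bit)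
    (hadm : ∀ m m', adm m' = true → Nat.beq (Nat.lor m m') m' = true → adm m = true)
    (hp : ∀ i c, 0 ≤ p i c) (hR : Enumerates bit adm E [p 0, p 1, p 2] R) (q : ℕ × ℕ) :
    q ∈ edgePairs adm R ↔ q ∈ pairMasks bit adm E p ∧ q.1 ∉ R.map Prod.fst ∧
      q.2 ∉ R.map Prod.fst := by
  simp only [edgePairs, List.mem_flatMap, List.mem_map (f := fun h : Entry × Entry => _),
    List.mem_filter]
  constructor
  · rintro ⟨g, hg, h, ⟨hh, hcr⟩, rfl⟩
    obtain ⟨hag, r, r', hr, hr', hrr, hmr, hmr', hbr, hbr', hgen⟩ :=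
      exists_rays_of_mem_edges hbit hadm hR hg
    obtain ⟨hah, s, s', hs, hs', hss, hms, hms', hbs, hbs', hgen'⟩ :=
      exists_rays_of_mem_edges hbit hadm hR hh
    obtain ⟨c1, c2⟩ := crosses_iff.1 hcr
    rw [castTriple_flip3, castTriple_flip3, ← hbr, ← hbr', ← hbs, ← hbs'] at c1 c2
    have nr := bdry_nonneg hp hr.1.1
    have nr' := bdry_nonneg hp hr'.1.1
    have ns : 0 ≤ flip3 (bdry p s) :=
      have h := bdry_nonneg hp hs.1.1
      ⟨h.1, h.2.2, h.2.1⟩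
    have ns' : 0 ≤ flip3 (bdry p s') :=
      have h := bdry_nonneg hp hs'.1.1
      ⟨h.1, h.2.2, h.2.1⟩
    obtain ⟨a, b, c, d, ha, hb, hc, hd, hsol⟩ := exists_of_crosses nr nr' ns ns' c1 c2
    have hfit : ∀ a b c d : ℝ, Fits p (a • r + b • r') (c • s + d • s') ↔
        a • bdry p r + b • bdry p r' = c • flip3 (bdry p s) + d • flip3 (bdry p s') :=
      fun a b c d => by
        rw [fits_iff, bdry_add, bdry_add, bdry_smul, bdry_smul, bdry_smul, bdry_smul, flip3_comb]
    have hsx : Function.support (a • r + b • r') = Function.support r ∪ Function.support r' := by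
      rw [support_add_of_nonneg (smul_mem_cone ha.le hr.1).1 (smul_mem_cone hb.le hr'.1).1,
        support_smul ha.ne', support_smul hb.ne']
    have hsy : Function.support (c • s + d • s') = Function.support s ∪ Function.support s' := by
      rw [support_add_of_nonneg (smul_mem_cone hc.le hs.1).1 (smul_mem_cone hd.le hs'.1).1,
        support_smul hc.ne', support_smul hd.ne']
    have hx0 : a • r + b • r' ≠ 0 := fun h0 =>
      ha.ne' (linearIndependent_two_rays hr hr' hrr h0).1
    have hpair : IsPairRay E p (a • r + b • r') (c • s + d • s') := by
      refine ⟨add_mem_cone (smul_mem_cone ha.le hr.1) (smul_mem_cone hb.le hr'.1),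
        add_mem_cone (smul_mem_cone hc.le hs.1) (smul_mem_cone hd.le hs'.1),
        (hfit a b c d).2 hsol, Or.inl hx0, fun x' hx' y' hy' hf hsx' hsy' => ?_⟩
      obtain ⟨a', b', rfl⟩ := hgen x' hx' (hsx ▸ hsx')
      obtain ⟨c', d', rfl⟩ := hgen' y' hy' (hsy ▸ hsy')
      obtain ⟨t, rfl, rfl, rfl, rfl⟩ := unique_of_crosses nr nr' c1 c2 ha hb hc hsol
        ((hfit a' b' c' d').1 hf)
      exact ⟨t, by module, by module⟩
    -- The support of an edge contains those of two different rays, so it is not the support of a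
    -- ray.
    have hnot : ∀ g ∈ edges adm R, Nat.lor g.1.1 g.2.1 ∉ R.map Prod.fst := by
      intro g hg hcon
      obtain ⟨-, r, r', hr, hr', hrr, hmr, hmr', -, -, -⟩ :=
        exists_rays_of_mem_edges hbit hadm hR hg
      obtain ⟨e, he, heq⟩ := List.mem_map.1 hcon
      obtain ⟨v, hv, hmv⟩ := hR.exists_ray he
      have hsv := hmv.set_unique hbit (heq.symm ▸ hmr.union hmr')
      apply hrr
      rw [hv.support_eq hr.1 hr.2.1 (hsv ▸ Set.subset_union_left),
        hv.support_eq hr'.1 hr'.2.1 (hsv ▸ Set.subset_union_right)]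
    refine ⟨⟨hag, hah, _, _, hpair, hsx ▸ hmr.union hmr', hsy ▸ hms.union hms', ?_⟩,
      hnot g hg, hnot h hh⟩
    -- If the first two boundary values of the combination vanished, they would vanish at both ends
    -- of the edge; the images of the ends would be parallel and the determinants zero.
    have nn := bdry_nonneg hp hpair.1.1
    refine lt_of_le_of_ne (add_nonneg nn.1 nn.2.1) fun h0 => ?_
    obtain ⟨z1, z2⟩ := (add_eq_zero_iff_of_nonneg nn.1 nn.2.1).1 h0.symm
    have z1' : form (p 0) (a • r + b • r') = 0 := z1
    have z2' : form (p 1) (a • r + b • r') = 0 := z2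
    rw [form_add, form_smul, form_smul] at z1' z2'
    have q1 : form (p 0) r = 0 := by
      have h1 : 0 ≤ form (p 0) r := nr.1
      have h2 : 0 ≤ form (p 0) r' := nr'.1
      nlinarith [mul_nonneg ha.le h1, mul_nonneg hb.le h2]
    have q2 : form (p 0) r' = 0 := by
      rw [q1, mul_zero, zero_add, mul_eq_zero] at z1'
      exact z1'.resolve_left hb.ne'
    have q3 : form (p 1) r = 0 := by
      have h1 : 0 ≤ form (p 1) r := nr.2.1
      have h2 : 0 ≤ form (p 1) r' := nr'.2.1
      nlinarith [mul_nonneg ha.le h1, mul_nonneg hb.le h2]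
    have q4 : form (p 1) r' = 0 := by
      rw [q3, mul_zero, zero_add, mul_eq_zero] at z2'
      exact z2'.resolve_left hb.ne'
    simp [det3, bdry, q1, q2, q3, q4] at c1
  · rintro ⟨⟨ha1, ha2, x, y, hxy, hmx, hmy, hpos⟩, hn1, hn2⟩
    have hx0 : x ≠ 0 := by
      rintro rfl
      simp [form_zero] at hpos
    have hy0 : y ≠ 0 := by
      rintro rfl
      have h1 := hxy.2.2.1 0
      have h2 := hxy.2.2.1 1
      rw [form_zero] at h1 h2
      rw [h1, h2, add_zero] at hpos
      exact lt_irrefl _ hpos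
    have hx : ¬ IsRay (cone E) x := fun hr => by
      obtain ⟨e, he, heq⟩ := hR.complete x _ hr hmx ha1
      exact hn1 (List.mem_map.2 ⟨e, he, heq⟩)
    have hy : ¬ IsRay (cone E) y := fun hr => by
      obtain ⟨e, he, heq⟩ := hR.complete y _ hr hmy ha2
      exact hn2 (List.mem_map.2 ⟨e, he, heq⟩)
    obtain ⟨g, hg, hgm, r, r', hr, hr', hrr, hbr, hbr', hrx, hrx', a, b, ha, hb, hxe⟩ :=
      exists_edge hbit hadm hR hxy hx0 hy0 hx hy hmx ha1
    obtain ⟨h, hh, hhm, s, s', hs, hs', hss, hbs, hbs', hsy, hsy', c, d, hc, hd, hye⟩ :=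
      exists_edge hbit hadm hR hxy.symm hy0 hx0 hy hx hmy ha2
    refine ⟨g, hg, h, ⟨hh, ?_⟩, Prod.ext hgm hhm⟩
    have hfit : ∀ a b c d : ℝ, Fits p (a • r + b • r') (c • s + d • s') ↔
        a • bdry p r + b • bdry p r' = c • flip3 (bdry p s) + d • flip3 (bdry p s') :=
      fun a b c d => by
        rw [fits_iff, bdry_add, bdry_add, bdry_smul, bdry_smul, bdry_smul, bdry_smul, flip3_comb]
    rw [edgesCross, crosses_iff, castTriple_flip3, castTriple_flip3, ← hbr, ← hbr', ← hbs, ← hbs']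
    -- Uniqueness is needed for coefficients of any sign; `IsPairRay.exists_eq_smul` provides it
    -- because it does not ask for non-negative vectors.
    refine crosses_of_unique ha hb hc hd ((hfit a b c d).1 (hxe ▸ hye ▸ hxy.2.2.1)) ?_
    intro a' b' c' d' he
    obtain ⟨t, h1, h2⟩ := hxy.exists_eq_smul (form_eq_zero_of_comb hr.1 hr'.1 a' b')
      (form_eq_zero_of_comb hs.1 hs'.1 c' d') ((hfit a' b' c' d').2 he)
      (support_comb_subset hrx hrx' a' b') (support_comb_subset hsy hsy' c' d')
    rw [hxe] at h1
    rw [hye] at h2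
    obtain ⟨g1, g2⟩ := coeff_eq_of_comb_eq hr hr' hrr h1
    obtain ⟨g3, g4⟩ := coeff_eq_of_comb_eq hs hs' hss h2
    exact ⟨t, g1, g2, g3, g4⟩

/-- By adjacency the union of the two supports determines the unordered pair, and the order of the
list determines which entry comes first. -/
theorem nodup_edgePairs (hbit : Function.Injective bit)
    (hadm : ∀ m m', adm m' = true → Nat.beq (Nat.lor m m') m' = true → adm m = true)
    (hR : Enumerates bit adm E [p 0, p 1, p 2] R) : (edgePairs adm R).Nodup := by
  have hRn : R.Nodup := hR.nodup.of_map
  have key : ((edges adm R).map fun g => Nat.lor g.1.1 g.2.1).Nodup := by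
    refine List.Nodup.map_on ?_ ((nodup_pairsOf hRn).filter _)
    rintro ⟨e, e'⟩ hg ⟨f, f'⟩ hh hm
    obtain ⟨-, r, r', hr, hr', hrr, hmr, hmr', -, -, -⟩ :=
      exists_rays_of_mem_edges hbit hadm hR hg
    obtain ⟨-, s, s', hs, hs', hss, hms, hms', -, -, -⟩ :=
      exists_rays_of_mem_edges hbit hadm hR hh
    obtain ⟨hpg, hg⟩ := List.mem_filter.1 hg
    obtain ⟨hph, hh⟩ := List.mem_filter.1 hh
    rw [Bool.and_eq_true] at hg
    obtain ⟨he, he'⟩ := mem_of_mem_pairsOf hpg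
    obtain ⟨hf, hf'⟩ := mem_of_mem_pairsOf hph
    have hne : e.1 ≠ e'.1 := fun hcon => ne_of_mem_pairsOf hRn hpg (hR.mem_of_adm he he' hcon)
    have hadj := (adjacent_iff hbit hadm hR he he' hne hmr hmr' hg.1).1 hg.2
    have hun : Function.support s ∪ Function.support s' =
        Function.support r ∪ Function.support r' :=
      (hms.union hms').set_unique hbit (hm ▸ hmr.union hmr')
    have hcase : ∀ {f : Entry} {s : ι → ℝ}, f ∈ R → IsRay (cone E) s →
        IsMask bit f.1 (Function.support s) →
        Function.support s ⊆ Function.support r ∪ Function.support r' → f = e ∨ f = e' := by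
      intro f s hf hs hms hsub
      rcases hadj s hs hsub with h | h
      · exact Or.inl (hR.mem_of_adm hf he (hms.unique (h ▸ hmr)))
      · exact Or.inr (hR.mem_of_adm hf he' (hms.unique (h ▸ hmr')))
    have hff := ne_of_mem_pairsOf hRn hph
    rcases hcase hf hs hms (hun ▸ Set.subset_union_left) with rfl | rfl <;>
      rcases hcase hf' hs' hms' (hun ▸ Set.subset_union_right) with rfl | rfl
    · exact absurd rfl hff
    · rfl
    · exact absurd hph (not_mem_pairsOf_swap hRn hpg)
    · exact absurd rfl hff
  exact nodup_flatMap_map key fun g _ => key.sublist (List.filter_sublist.map _)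

theorem length_edgePairs : (edgePairs adm R).length =
    ((edges adm R).map fun g => (edges adm R).countP fun h => edgesCross g h).sum := by
  simp [edgePairs, List.length_flatMap, List.countP_eq_length_filter]

/-! ### The total count -/

theorem ncard_setOf_mem {α : Type} {l : List α} (hl : l.Nodup) : {q | q ∈ l}.ncard = l.length := by
  classical
  rw [← List.toFinset_card_of_nodup hl, ← Set.ncard_coe_finset]
  congr 1
  ext q; simp

/-- The extremal ray meets the boundary in the prescribed way, as a first component. -/
def firstKind (e : Entry) : Bool := decide (0 < (val e).1 + (val e).2.1)

/-- The extremal ray meets the boundary in the prescribed way, as a second component. -/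
def secondKind (e : Entry) : Bool := decide (0 < (val e).1 + (val e).2.2)

/-- Inclusion and exclusion over pairs whose first component is extremal, whose second component is
extremal, or neither. -/
theorem ncard_pairMasks (hbit : Function.Injective bit)
    (hadm : ∀ m m', adm m' = true → Nat.beq (Nat.lor m m') m' = true → adm m = true)
    (hp : ∀ i c, 0 ≤ p i c) (hR : Enumerates bit adm E [p 0, p 1, p 2] R)
    (hV : ∀ u, Enumerates bit adm ({φ | φ ∈ dirForms p u} ∪ E) [p 0, p 1, p 2] (V u)) :
    (pairMasks bit adm E p).ncard + (doubleRayPairs R firstKind).length =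
      (rayPairs R V firstKind).length + (rayPairs R V secondKind).length +
        (edgePairs adm R).length := by
  have hc1 : ∀ e, firstKind e = true → val e ≠ (0, 0, 0) := fun e he h0 => by
    simp [firstKind, h0] at he
  have hc2 : ∀ e, secondKind e = true → val e ≠ (0, 0, 0) := fun e he h0 => by
    simp [secondKind, h0] at he
  have hne : ∀ {e : Entry} {x : ι → ℝ}, e ∈ R → IsMask bit e.1 (Function.support x) →
      x ≠ 0 := by
    rintro e x he hmx rfl
    obtain ⟨v, hv, hmv⟩ := hR.exists_ray he
    have := hmx.set_unique hbit hmv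
    rw [Function.support_zero] at this
    exact hv.2.1 (Function.support_eq_empty_iff.1 this.symm)
  have hk1 : ∀ {e : Entry} {x : ι → ℝ}, e ∈ R → x ∈ cone E →
      IsMask bit e.1 (Function.support x) →
      (0 < form (p 0) x + form (p 1) x ↔ firstKind e = true) := by
    intro e x he hx hmx
    obtain ⟨k, hk, hb⟩ := hR.exists_bdry_eq hbit he hx (hne he hmx) hmx
    have b0 : form (p 0) x = k * (val e).1 := congrArg (fun q => q.1) hb
    have b1 : form (p 1) x = k * (val e).2.1 := congrArg (fun q => q.2.1) hb
    rw [b0, b1, ← mul_add, mul_pos_iff_of_pos_left hk, firstKind, decide_eq_true_eq]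
    norm_cast
  have hk2 : ∀ {e : Entry} {x : ι → ℝ}, e ∈ R → x ∈ cone E →
      IsMask bit e.1 (Function.support x) →
      (0 < form (p 0) x + form (p 2) x ↔ secondKind e = true) := by
    intro e x he hx hmx
    obtain ⟨k, hk, hb⟩ := hR.exists_bdry_eq hbit he hx (hne he hmx) hmx
    have b0 : form (p 0) x = k * (val e).1 := congrArg (fun q => q.1) hb
    have b1 : form (p 2) x = k * (val e).2.2 := congrArg (fun q => q.2.2) hb
    rw [b0, b1, ← mul_add, mul_pos_iff_of_pos_left hk, secondKind, decide_eq_true_eq]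
    norm_cast
  -- The exchange of the last two boundary values turns the condition on the first component into
  -- `secondKind` for the second.
  have hfit : ∀ {x y : ι → ℝ}, Fits p x y →
      form (p 0) x + form (p 1) x = form (p 0) y + form (p 2) y := fun h => by
    rw [h 0, h 1]; rfl
  have hA : pairMasks bit adm E p ∩ {q | q.1 ∈ R.map Prod.fst} =
      {q | q ∈ rayPairs R V firstKind} := by
    ext q
    rw [Set.mem_ofPred_eq, mem_rayPairs hbit hp hR hV hc1]
    constructor
    · rintro ⟨⟨-, ha2, x, y, hxy, hmx, hmy, hpos⟩, hq⟩
      obtain ⟨e, he, heq⟩ := List.mem_map.1 hq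
      exact ⟨e, he, (hk1 he hxy.1 (heq ▸ hmx)).1 hpos, heq, ha2, x, y, hxy, hmx, hmy⟩
    · rintro ⟨e, he, hk, heq, ha2, x, y, hxy, hmx, hmy⟩
      exact ⟨⟨heq ▸ (hR.sound e he).1, ha2, x, y, hxy, hmx, hmy,
        (hk1 he hxy.1 (heq ▸ hmx)).2 hk⟩, List.mem_map.2 ⟨e, he, heq⟩⟩
  have hB : pairMasks bit adm E p ∩ {q | q.2 ∈ R.map Prod.fst} =
      Prod.swap '' {q | q ∈ rayPairs R V secondKind} := by
    ext q
    rw [Set.image_swap_eq_preimage_swap, Set.mem_preimage, Set.mem_ofPred_eq,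
      mem_rayPairs hbit hp hR hV hc2]
    constructor
    · rintro ⟨⟨ha1, -, x, y, hxy, hmx, hmy, hpos⟩, hq⟩
      obtain ⟨e, he, heq⟩ := List.mem_map.1 hq
      rw [hfit hxy.2.2.1] at hpos
      exact ⟨e, he, (hk2 he hxy.2.1 (heq ▸ hmy)).1 hpos, heq, ha1, y, x, hxy.symm, hmy, hmx⟩
    · rintro ⟨e, he, hk, heq, ha1, y, x, hxy, hmy, hmx⟩
      rw [Prod.fst_swap] at heq
      refine ⟨⟨ha1, heq ▸ (hR.sound e he).1, x, y, hxy.symm, hmx, hmy, ?_⟩,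
        List.mem_map.2 ⟨e, he, heq⟩⟩
      rw [hfit hxy.symm.2.2.1]
      exact (hk2 he hxy.1 (heq ▸ hmy)).2 hk
  have hAB : pairMasks bit adm E p ∩ {q | q.1 ∈ R.map Prod.fst} ∩
      (pairMasks bit adm E p ∩ {q | q.2 ∈ R.map Prod.fst}) =
      {q | q ∈ doubleRayPairs R firstKind} := by
    ext q
    rw [Set.mem_ofPred_eq, mem_doubleRayPairs hbit hp hR hc1]
    constructor
    · rintro ⟨⟨⟨-, -, x, y, hxy, hmx, hmy, hpos⟩, hq⟩, -, hq2⟩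
      obtain ⟨e, he, heq⟩ := List.mem_map.1 hq
      exact ⟨e, he, (hk1 he hxy.1 (heq ▸ hmx)).1 hpos, heq, List.mem_map.1 hq2, x, y, hxy, hmx,
        hmy⟩
    · rintro ⟨e, he, hk, heq, ⟨f, hf, hfq⟩, x, y, hxy, hmx, hmy⟩
      have hS : q ∈ pairMasks bit adm E p := ⟨heq ▸ (hR.sound e he).1,
        hfq ▸ (hR.sound f hf).1, x, y, hxy, hmx, hmy, (hk1 he hxy.1 (heq ▸ hmx)).2 hk⟩
      exact ⟨⟨hS, List.mem_map.2 ⟨e, he, heq⟩⟩, hS, List.mem_map.2 ⟨f, hf, hfq⟩⟩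
  have hC : pairMasks bit adm E p ∩ {q | q.1 ∉ R.map Prod.fst ∧ q.2 ∉ R.map Prod.fst} =
      {q | q ∈ edgePairs adm R} := by
    ext q
    rw [Set.mem_ofPred_eq, mem_edgePairs hbit hadm hp hR]
    rfl
  have hS : pairMasks bit adm E p = (pairMasks bit adm E p ∩ {q | q.1 ∈ R.map Prod.fst} ∪
      pairMasks bit adm E p ∩ {q | q.2 ∈ R.map Prod.fst}) ∪
      pairMasks bit adm E p ∩ {q | q.1 ∉ R.map Prod.fst ∧ q.2 ∉ R.map Prod.fst} := by
    ext q
    simp only [Set.mem_union, Set.mem_inter_iff, Set.mem_ofPred_eq]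
    tauto
  have hdisj : Disjoint (pairMasks bit adm E p ∩ {q | q.1 ∈ R.map Prod.fst} ∪
      pairMasks bit adm E p ∩ {q | q.2 ∈ R.map Prod.fst})
      (pairMasks bit adm E p ∩ {q | q.1 ∉ R.map Prod.fst ∧ q.2 ∉ R.map Prod.fst}) := by
    rw [Set.disjoint_left]
    rintro q (⟨-, h⟩ | ⟨-, h⟩) ⟨-, h1, h2⟩
    · exact h1 h
    · exact h2 h
  have fin : ∀ {α : Type} (l : List α), {q | q ∈ l}.Finite := fun l => l.finite_toSet
  have hfA : (pairMasks bit adm E p ∩ {q | q.1 ∈ R.map Prod.fst}).Finite := hA ▸ fin _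
  have hfB : (pairMasks bit adm E p ∩ {q | q.2 ∈ R.map Prod.fst}).Finite :=
    hB ▸ (fin _).image _
  have hfC : (pairMasks bit adm E p ∩
      {q | q.1 ∉ R.map Prod.fst ∧ q.2 ∉ R.map Prod.fst}).Finite := hC ▸ fin _
  have n1 := Set.ncard_union_add_ncard_inter _ _ hfA hfB
  have n2 := Set.ncard_union_eq hdisj (hfA.union hfB) hfC
  rw [← hS] at n2
  rw [hAB, ncard_setOf_mem (nodup_doubleRayPairs hR _)] at n1
  have e1 := ncard_setOf_mem (nodup_rayPairs hR hV firstKind)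
  have e2 := ncard_setOf_mem (nodup_rayPairs hR hV secondKind)
  rw [← hA] at e1
  rw [← Set.ncard_image_of_injective _ Prod.swap_injective, ← hB] at e2
  have e3 := ncard_setOf_mem (nodup_edgePairs hbit hadm hR)
  rw [← hC] at e3
  omega

end RayEnum

namespace RayEnum

open PolyCone

/-! ### Computing the number of crossing pairs of edges -/

/-- Increases the multiplicity of `c` in a list of numbers with multiplicities. -/
noncomputable def insertTally {α : Type} (c : ℕ) (T : List (ℕ × ℕ)) : (List (ℕ × ℕ) → α) → α :=
  List.rec (fun f => f [(c, 1)]) (fun q t ih f =>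
    Bool.rec (ih fun t' => f (q :: t')) (forceNat (Nat.succ q.2) fun k => f ((q.1, k) :: t))
      (Nat.beq c q.1)) T

/-- The members of a list with their multiplicities. -/
noncomputable def tally {α : Type} (l : List ℕ) : (List (ℕ × ℕ) → α) → α :=
  List.rec (fun f => f []) (fun c _ ih f => forceNat c fun c => ih fun T => insertTally c T f) l

theorem insertTally_eq (c : ℕ) (T : List (ℕ × ℕ)) : ∀ {α : Type} (f : List (ℕ × ℕ) → α),
    insertTally c T f = f (insertTally c T id) := by
  induction T with
  | nil => intro α f; rfl
  | cons q t ih =>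
    have h : ∀ {β : Type} (f : List (ℕ × ℕ) → β), insertTally c (q :: t) f =
        Bool.rec (insertTally c t fun t' => f (q :: t'))
          (forceNat (Nat.succ q.2) fun k => f ((q.1, k) :: t)) (Nat.beq c q.1) := fun f => rfl
    intro α f
    rw [h, h]
    cases Nat.beq c q.1 with
    | false =>
      change insertTally c t (fun t' => f (q :: t')) = f (insertTally c t fun t' => q :: t')
      rw [ih, ih fun t' => q :: t']
    | true =>
      change forceNat _ _ = f (forceNat _ _)
      rw [forceNat_eq, forceNat_eq]; rfl

theorem sum_insertTally (F : ℕ → ℕ) (c : ℕ) (T : List (ℕ × ℕ)) :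
    ((insertTally c T id).map fun q => q.2 * F q.1).sum =
      F c + (T.map fun q => q.2 * F q.1).sum := by
  induction T with
  | nil => change ([(c, 1)].map fun q : ℕ × ℕ => q.2 * F q.1).sum = _; simp
  | cons q t ih =>
    have h : insertTally c (q :: t) id =
        Bool.rec (insertTally c t fun t' => q :: t')
          (forceNat (Nat.succ q.2) fun k => (q.1, k) :: t) (Nat.beq c q.1) := rfl
    rw [h]
    cases hb : Nat.beq c q.1 with
    | false =>
      change ((insertTally c t fun t' => q :: t').map _).sum = _
      rw [insertTally_eq, List.map_cons, List.sum_cons, ih, List.map_cons, List.sum_cons]; omega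
    | true =>
      change (List.map _ (forceNat (Nat.succ q.2) fun k => (q.1, k) :: t)).sum = _
      rw [Nat.beq_eq] at hb
      rw [forceNat_eq, List.map_cons, List.sum_cons, List.map_cons, List.sum_cons, hb]
      simp only [Nat.succ_eq_add_one]; ring

theorem tally_eq (l : List ℕ) : ∀ {α : Type} (f : List (ℕ × ℕ) → α),
    tally l f = f (tally l id) := by
  induction l with
  | nil => intro α f; rfl
  | cons c l ih =>
    have h : ∀ {β : Type} (f : List (ℕ × ℕ) → β), tally (c :: l) f =
        forceNat c fun c => tally l fun T => insertTally c T f := fun f => rfl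
    intro α f
    rw [h, h, forceNat_eq, forceNat_eq, ih, ih fun T => insertTally c T id, insertTally_eq]

/-- Sums over a list can be evaluated on its distinct members, weighted with multiplicities. -/
theorem sum_tally (F : ℕ → ℕ) (l : List ℕ) :
    ((tally l id).map fun q => q.2 * F q.1).sum = (l.map F).sum := by
  induction l with
  | nil => rfl
  | cons c l ih =>
    have h : tally (c :: l) id = forceNat c fun c => tally l fun T => insertTally c T id := rfl
    rw [h, forceNat_eq, tally_eq, sum_insertTally, ih, List.map_cons, List.sum_cons]

/-- The keys of the edges. -/
noncomputable def edgeKeys (adm : ℕ → Bool) (key : Entry → Entry → ℕ) (R : List Entry) : List ℕ :=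
  forceMasks R fun masks => List.rec [] (fun e l ih => List.rec ih (fun e' _ ih' =>
    forceNat (Nat.lor e.1 e'.1) fun m =>
      Bool.rec ih' (Bool.rec ih' (key e e' :: ih') (countBelow m masks 2)) (adm m)) l) R

theorem edgeKeys_eq (adm : ℕ → Bool) (key : Entry → Entry → ℕ) (R : List Entry) :
    edgeKeys adm key R = (edges adm R).map fun g => key g.1 g.2 := by
  rw [edgeKeys, forceMasks_eq, edges]
  generalize R.map Prod.fst = masks
  induction R with
  | nil => rfl
  | cons e l ih =>
    rw [pairsOf, List.filter_append, List.map_append]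
    simp only
    rw [ih]
    clear ih
    generalize List.map (fun g : Entry × Entry => key g.1 g.2) (List.filter _ (pairsOf l)) = r
    induction l with
    | nil => rfl
    | cons e' l ih =>
      simp only
      rw [forceNat_eq, ih, List.map_cons, List.filter_cons]
      cases adm (Nat.lor e.1 e'.1) with
      | false => rfl
      | true => cases countBelow (Nat.lor e.1 e'.1) masks 2 <;> rfl

/-! Triples of small natural numbers are encoded in one number. -/

def encode (u : ℤ × ℤ × ℤ) : ℕ := (u.1.toNat * 16 + u.2.1.toNat) * 16 + u.2.2.toNat

/-- The factor 4096 = 16³ separates two triples of base 16 digits. -/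
noncomputable def entryKey (e e' : Entry) : ℕ := encode (val e) * 4096 + encode (val e')

def decode (c : ℕ) : ℕ × ℕ × ℕ := (c / 256, c / 16 % 16, c % 16)

def castNat (u : ℕ × ℕ × ℕ) : ℤ × ℤ × ℤ := (u.1, u.2.1, u.2.2)

/-- Whether the determinants `det3 u v w` and `det3 u v z` have opposite signs. -/
def oppositeNat (u v w z : ℕ × ℕ × ℕ) : Bool :=
  -- `f` and `g` collect the positive and the negative terms of the determinant, so that its sign is
  -- a comparison of natural numbers.
  let f (w : ℕ × ℕ × ℕ) := Nat.add (Nat.add (Nat.mul (Nat.mul u.2.1 v.2.2) w.1)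
    (Nat.mul (Nat.mul u.2.2 v.1) w.2.1)) (Nat.mul (Nat.mul u.1 v.2.1) w.2.2)
  let g (w : ℕ × ℕ × ℕ) := Nat.add (Nat.add (Nat.mul (Nat.mul u.2.2 v.2.1) w.1)
    (Nat.mul (Nat.mul u.1 v.2.2) w.2.1)) (Nat.mul (Nat.mul u.2.1 v.1) w.2.2)
  (Nat.blt (g w) (f w) && Nat.blt (f z) (g z)) || (Nat.blt (f w) (g w) && Nat.blt (g z) (f z))

theorem blt_iff {a b : ℕ} : Nat.blt a b = true ↔ a < b :=
  Iff.of_eq Nat.ble_eq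

theorem oppositeNat_eq (u v w z : ℕ × ℕ × ℕ) : oppositeNat u v w z =
    opposite (det3 (castNat u) (castNat v) (castNat w))
      (det3 (castNat u) (castNat v) (castNat z)) := by
  rw [Bool.eq_iff_iff, opposite_iff]
  simp only [oppositeNat, Bool.or_eq_true, Bool.and_eq_true, blt_iff, det3, castNat,
    Nat.add_eq, Nat.mul_eq]
  zify
  constructor
  · rintro (⟨h, h'⟩ | ⟨h, h'⟩)
    · exact Or.inl ⟨by linarith, by linarith⟩
    · exact Or.inr ⟨by linarith, by linarith⟩
  · rintro (⟨h, h'⟩ | ⟨h, h'⟩)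
    · exact Or.inl ⟨by linarith, by linarith⟩
    · exact Or.inr ⟨by linarith, by linarith⟩

def crossesNat (c d : ℕ) : Bool :=
  oppositeNat (decode (c / 4096)) (decode (c % 4096)) (flip3 (decode (d / 4096)))
    (flip3 (decode (d % 4096))) &&
  oppositeNat (flip3 (decode (d / 4096))) (flip3 (decode (d % 4096))) (decode (c / 4096))
    (decode (c % 4096))

/-- The values are recovered from their encoding. -/
def IsSmall (e : Entry) : Prop := encode (val e) < 4096 ∧ castNat (decode (encode (val e))) = val e

theorem edgesCross_eq {g h : Entry × Entry} (hg1 : IsSmall g.1) (hg2 : IsSmall g.2)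
    (hh1 : IsSmall h.1) (hh2 : IsSmall h.2) :
    edgesCross g h = crossesNat (entryKey g.1 g.2) (entryKey h.1 h.2) := by
  have key : ∀ {e e' : Entry}, IsSmall e' → entryKey e e' / 4096 = encode (val e) ∧
      entryKey e e' % 4096 = encode (val e') := fun {e e'} h => by
    have := h.1
    constructor <;> · rw [entryKey]; omega
  have hf : ∀ u, castNat (flip3 u) = flip3 (castNat u) := fun _ => rfl
  rw [edgesCross, crosses, crossesNat, (key hg2).1, (key hg2).2, (key hh2).1, (key hh2).2,
    oppositeNat_eq, oppositeNat_eq, hf, hf, hg1.2, hg2.2, hh1.2, hh2.2]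

/-- The number of crossing pairs, from the edge keys with their multiplicities. -/
def sumCrosses (T : List (ℕ × ℕ)) : ℕ :=
  (T.map fun q => q.2 * (T.map fun r => r.2 * (crossesNat q.1 r.1).toNat).sum).sum

/-- Whether two edges cross depends only on the boundary values of their ends. Edges with equal
values are grouped, which turns a quadratic computation in the number of edges into one in the
number of keys. -/
theorem length_edgePairs_eq {adm : ℕ → Bool} {R : List Entry} (hR : ∀ e ∈ R, IsSmall e) :
    (edgePairs adm R).length = sumCrosses (tally (edgeKeys adm entryKey R) id) := by
  have hs : ∀ g ∈ edges adm R, IsSmall g.1 ∧ IsSmall g.2 := fun g hg =>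
    (mem_of_mem_pairsOf (List.mem_of_mem_filter hg)).imp (hR _) (hR _)
  rw [length_edgePairs, sumCrosses, sum_tally (fun c => ((tally (edgeKeys adm entryKey R) id).map
    fun r => r.2 * (crossesNat c r.1).toNat).sum), edgeKeys_eq, List.map_map]
  congr 1
  refine List.map_congr_left fun g hg => ?_
  rw [Function.comp_apply, sum_tally (fun d => (crossesNat (entryKey g.1 g.2) d).toNat),
    List.map_map]
  have hmain : ∀ l : List (Entry × Entry), (∀ h ∈ l, h ∈ edges adm R) →
      l.countP (fun h => edgesCross g h) = (l.map
        ((fun d => (crossesNat (entryKey g.1 g.2) d).toNat) ∘ fun h => entryKey h.1 h.2)).sum := by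
    intro l
    induction l with
    | nil => intro _; rfl
    | cons h l ih =>
      intro hl
      have hh := hl h List.mem_cons_self
      rw [List.countP_cons, ih fun k hk => hl k (List.mem_cons_of_mem _ hk), List.map_cons,
        List.sum_cons, Function.comp_apply, ← edgesCross_eq (hs g hg).1 (hs g hg).2 (hs h hh).1
        (hs h hh).2]
      cases edgesCross g h <;> simp [add_comm]
  exact hmain _ fun _ h => h

end RayEnum

/-! ### The half of the explicit triangulation on one side of its first tetrahedron -/

open PolyCone RayEnum

/-- The linear form that counts the normal arcs around vertex `a` in face `f` of tetrahedron `i`. -/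
def arcForm {ι : Type} [DecidableEq ι] (i : ι) (f a : Fin 4) : ι × (Fin 4 ⊕ Fin 3) → ℤ
  | (j, Sum.inl b) => if j = i ∧ b = a then 1 else 0
  | (j, Sum.inr q) => if j = i ∧ Triangulation.SameSide q a f then 1 else 0

/-- The linear forms whose vanishing expresses the matching equations at face `f` of
tetrahedron `i`. -/
def matchingForms {ι : Type} [DecidableEq ι] (g : Gluing ι) (i : ι) (f : Fin 4) :
    List (ι × (Fin 4 ⊕ Fin 3) → ℤ) :=
  match g i f with
  | none => []
  | some (j, p) => ([0, 1, 2, 3].filter fun a => decide (a ≠ f)).map fun a =>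
      arcForm i f a - arcForm j (p f) (p a)

/-! ### Recording further values of linear forms -/

namespace RayEnum

variable {ι : Type} [Fintype ι] {bit : ι → ℕ} {adm : ℕ → Bool} {E : Set (ι → ℤ)}
  {Φ Ψ : List (ι → ℤ)} {L L' : List Entry}

theorem Enumerates.perm (h : Enumerates bit adm E Φ L) (hL : L.Perm L') :
    Enumerates bit adm E Φ L' where
  sound e he := h.sound e (hL.mem_iff.2 he)
  complete x m hx hm ha := (h.complete x m hx hm ha).imp fun _ he => ⟨hL.mem_iff.1 he.1, he.2⟩
  nodup := (hL.map _).nodup_iff.1 h.nodup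

/-- Values that depend linearly on recorded ones can be added without knowing the rays; they carry
the same unknown factor `k`. -/
theorem Enumerates.prepend (h : Enumerates bit adm E Φ L) (Ψ : List (ι → ℤ))
    (f : Entry → List ℤ) (hf : ∀ (e : Entry) (v : ι → ℕ) (k : ℕ),
      Φ.map (fun φ => intForm φ v) = e.2.map (fun z => (k : ℤ) * z) →
      Ψ.map (fun φ => intForm φ v) = (f e).map fun z => (k : ℤ) * z) :
    Enumerates bit adm E (Ψ ++ Φ) (L.map fun e => (e.1, f e ++ e.2)) where
  sound e' he' := by
    obtain ⟨e, he, rfl⟩ := List.mem_map.1 he'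
    obtain ⟨ha, v, hv, hm, k, hk, hval⟩ := h.sound e he
    refine ⟨ha, v, hv, hm, k, hk, ?_⟩
    rw [List.map_append, List.map_append, hval, hf e v k hval]
  complete x m hx hm ha := by
    obtain ⟨e, he, rfl⟩ := h.complete x m hx hm ha
    exact ⟨_, List.mem_map_of_mem he, rfl⟩
  nodup := by
    rw [List.map_map]
    exact h.nodup

theorem intForm_sub_zsmul (a b : ℤ) (φ ψ : ι → ℤ) (v : ι → ℕ) :
    intForm (a • φ - b • ψ) v = a * intForm φ v - b * intForm ψ v := by
  simp only [intForm, Finset.mul_sum, ← Finset.sum_sub_distrib]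
  refine Finset.sum_congr rfl fun c _ => ?_
  simp only [Pi.sub_apply, Pi.smul_apply, smul_eq_mul]
  ring

end RayEnum

/-! ### Data and kernel computations for the triangulation with five tetrahedra -/

namespace TriH

open Equiv in
/-- The gluings of a triangulation with tetrahedra `0, …, 4`, isomorphic to the part of `triG` that
consists of the tetrahedra `1, 3, 7, 4, 8`. -/
def glue : Gluing (Fin 5) := ![
  ![none, some (3, swap 1 3), some (1, swap 2 3), none],
  ![none, some (2, 1), some (2, swap 0 2 * swap 1 3), some (0, swap 2 3)],
  ![some (1, swap 0 2 * swap 1 3), some (1, 1), none, none],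
  ![none, some (4, 1), some (4, swap 0 2 * swap 1 3), some (0, swap 1 3)],
  ![some (3, swap 0 2 * swap 1 3), some (3, 1), none, none]]

abbrev Piece : Type := Fin 5 × (Fin 4 ⊕ Fin 3)

/-- The position of a normal piece in a binary encoding. -/
def bit : Piece → ℕ
  | (i, Sum.inl a) => 7 * i + a
  | (i, Sum.inr q) => 7 * i + 4 + q

def pieces : List Piece := [0, 1, 2, 3, 4].flatMap fun i =>
  [(i, Sum.inl 0), (i, Sum.inl 1), (i, Sum.inl 2), (i, Sum.inl 3),
    (i, Sum.inr 0), (i, Sum.inr 1), (i, Sum.inr 2)]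

/-- The positions of the quadrilaterals. -/
def quadMask : ℕ := 7 * (2 ^ 4 + 2 ^ 11 + 2 ^ 18 + 2 ^ 25 + 2 ^ 32)

/-- There are no two different quadrilateral types in the same tetrahedron. -/
noncomputable def adm (m : ℕ) : Bool :=
  -- Digits of quadrilaterals of one tetrahedron differ by 1 or 2 positions, those of different
  -- tetrahedra by at least 5; so overlaps with the shifts by 1 and by 2 detect exactly the
  -- forbidden pairs.
  forceNat (Nat.land m quadMask) fun z =>
    Bool.rec false (Nat.beq (Nat.land z (Nat.shiftRight z 2)) 0)
      (Nat.beq (Nat.land z (Nat.shiftRight z 1)) 0)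

/-- These equations hold inside the two branches with tetrahedra 1, 2 and 3, 4. They are solved
once, and the result is the common starting point for `rays` and for all slices `raysAlong u`. -/
def outerForms : List (Piece → ℤ) :=
  matchingForms glue 1 2 ++ matchingForms glue 1 1 ++ matchingForms glue 3 2 ++
    matchingForms glue 3 1

def innerForms : List (Piece → ℤ) := matchingForms glue 0 2 ++ matchingForms glue 0 1

/-- The normal arcs in the face `(012)` of tetrahedron `0`. -/
def boundaryForm (a : Fin 3) : Piece → ℤ := arcForm 0 3 a.castSucc

def boundaryForms : List (Piece → ℤ) := [boundaryForm 0, boundaryForm 1, boundaryForm 2]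

/-- The extremal rays for the outer matching equations, with the values of the other forms. -/
def outerRays : List Entry := [
  (1, [1, 0, 0, 1, 0, 0, 1, 0, 0]), (2, [0, 1, 0, 0, 0, 0, 0, 1, 0]),
  (4, [0, 0, 0, 0, 1, 0, 0, 0, 1]), (8, [0, 0, 1, 0, 0, 1, 0, 0, 0]),
  (16, [0, 0, 1, 1, 0, 0, 0, 0, 1]), (32, [1, 0, 0, 0, 0, 1, 0, 1, 0]),
  (64, [0, 1, 0, 0, 1, 0, 1, 0, 0]), (528384, [0, -1, 0, 0, 0, 0, 0, 0, 0]),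
  (1056768, [-1, 0, 0, 0, 0, 0, 0, 0, 0]), (264192, [0, 0, -1, 0, 0, 0, 0, 0, 0]),
  (51200, [0, 0, -1, 0, 0, 0, 0, 0, 0]), (1049344, [0, -1, -1, 0, 0, 0, 0, 0, 0]),
  (82560, [-1, 0, -1, 0, 0, 0, 0, 0, 0]), (468096, [-1, 0, 0, 0, 0, 0, 0, 0, 0]),
  (165120, [0, -1, 0, 0, 0, 0, 0, 0, 0]), (574592, [-1, 0, 0, 0, 0, 0, 0, 0, 0]),
  (255104, [-1, 0, 0, 0, 0, 0, 0, 0, 0]), (201472, [0, -2, -1, 0, 0, 0, 0, 0, 0]),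
  (460672, [-1, -1, -1, 0, 0, 0, 0, 0, 0]), (8657043456, [0, 0, 0, 0, 0, -1, 0, 0, 0]),
  (17314086912, [0, 0, 0, -1, 0, 0, 0, 0, 0]), (4328521728, [0, 0, 0, 0, -1, 0, 0, 0, 0]),
  (838860800, [0, 0, 0, 0, -1, 0, 0, 0, 0]), (17192452096, [0, 0, 0, 0, -1, -1, 0, 0, 0]),
  (1352663040, [0, 0, 0, -1, -1, 0, 0, 0, 0]), (7669284864, [0, 0, 0, -1, 0, 0, 0, 0, 0]),
  (2705326080, [0, 0, 0, 0, 0, -1, 0, 0, 0]), (9414115328, [0, 0, 0, -1, 0, 0, 0, 0, 0]),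
  (4179623936, [0, 0, 0, -1, 0, 0, 0, 0, 0]), (3300917248, [0, 0, 0, 0, -1, -2, 0, 0, 0]),
  (7547650048, [0, 0, 0, -1, -1, -1, 0, 0, 0])]

/-- The extremal rays for all matching equations, sorted by their boundary values. -/
def rays : List Entry := [
  (2705377288, [0, 0, 0]), (2705590280, [0, 0, 0]), (8657094664, [0, 0, 0]),
  (8657307656, [0, 0, 0]), (838860804, [0, 0, 1]), (1352714260, [0, 0, 1]),
  (1352927252, [0, 0, 1]), (3300968460, [0, 0, 1]), (3301181452, [0, 0, 1]),
  (4179675152, [0, 0, 1]), (4179888144, [0, 0, 1]), (4328521732, [0, 0, 1]),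
  (7547701276, [0, 0, 1]), (7547914268, [0, 0, 1]), (7669336080, [0, 0, 1]),
  (7669549072, [0, 0, 1]), (9414166544, [0, 0, 1]), (9414379536, [0, 0, 1]),
  (17192503308, [0, 0, 1]), (17192716300, [0, 0, 1]), (17314138128, [0, 0, 1]),
  (17314351120, [0, 0, 1]), (165122, [0, 1, 0]), (528386, [0, 1, 0]), (2705408680, [0, 1, 0]),
  (2705527562, [0, 1, 0]), (2705581216, [0, 1, 0]), (2705786794, [0, 1, 0]),
  (2705794208, [0, 1, 0]), (2705900704, [0, 1, 0]), (2706375434, [0, 1, 0]),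
  (2706382880, [0, 1, 0]), (8657126056, [0, 1, 0]), (8657244938, [0, 1, 0]),
  (8657298592, [0, 1, 0]), (8657504170, [0, 1, 0]), (8657511584, [0, 1, 0]),
  (8657618080, [0, 1, 0]), (8658092810, [0, 1, 0]), (8658100256, [0, 1, 0]),
  (1352864534, [0, 1, 1]), (3300999852, [0, 1, 1]), (4180673298, [0, 1, 1]),
  (7548699422, [0, 1, 1]), (7670334226, [0, 1, 1]), (9415164690, [0, 1, 1]),
  (17192707236, [0, 1, 1]), (17192912814, [0, 1, 1]), (17192920228, [0, 1, 1]),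
  (17193026724, [0, 1, 1]), (17193501454, [0, 1, 1]), (17193508900, [0, 1, 1]),
  (17315136274, [0, 1, 1]), (1353712406, [0, 1, 2]), (17192534700, [0, 1, 2]),
  (3301172388, [0, 2, 1]), (3301377966, [0, 2, 1]), (3301385380, [0, 2, 1]),
  (3301491876, [0, 2, 1]), (3301966606, [0, 2, 1]), (3301974052, [0, 2, 1]),
  (4179825426, [0, 2, 1]), (7547851550, [0, 2, 1]), (7669486354, [0, 2, 1]),
  (9414316818, [0, 2, 1]), (17192653582, [0, 2, 1]), (17314288402, [0, 2, 1]),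
  (3301118734, [0, 4, 1]), (839025984, [1, 0, 0]), (839389248, [1, 0, 0]),
  (1352918465, [1, 0, 0]), (1353164225, [1, 0, 0]), (1353241793, [1, 0, 0]),
  (1353369025, [1, 0, 0]), (1353884993, [1, 0, 0]), (3007517512, [1, 0, 0]),
  (3008365384, [1, 0, 0]), (3301100872, [1, 0, 0]), (3301346632, [1, 0, 0]),
  (3302017864, [1, 0, 0]), (3571667913, [1, 0, 0]), (3571697609, [1, 0, 0]),
  (3571914697, [1, 0, 0]), (3571943369, [1, 0, 0]), (3572060873, [1, 0, 0]),
  (3572507465, [1, 0, 0]), (3572581321, [1, 0, 0]), (4058207177, [1, 0, 0]),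
  (4058236873, [1, 0, 0]), (4058449865, [1, 0, 0]), (4058600137, [1, 0, 0]),
  (4059046729, [1, 0, 0]), (4059120585, [1, 0, 0]), (4179879041, [1, 0, 0]),
  (4180092033, [1, 0, 0]), (4180198529, [1, 0, 0]), (4180680705, [1, 0, 0]),
  (4183900809, [1, 0, 0]), (4328686912, [1, 0, 0]), (4329050176, [1, 0, 0]),
  (7034049352, [1, 0, 0]), (7034897224, [1, 0, 0]), (7547897801, [1, 0, 0]),
  (7548110793, [1, 0, 0]), (7548261065, [1, 0, 0]), (7548358089, [1, 0, 0]),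
  (7548707657, [1, 0, 0]), (7614976969, [1, 0, 0]), (7615890377, [1, 0, 0]),
  (7669539969, [1, 0, 0]), (7669752961, [1, 0, 0]), (7669859457, [1, 0, 0]),
  (7670341633, [1, 0, 0]), (8084739017, [1, 0, 0]), (8085652425, [1, 0, 0]),
  (8210432649, [1, 0, 0]), (9414370433, [1, 0, 0]), (9414583425, [1, 0, 0]),
  (9414689921, [1, 0, 0]), (9415172097, [1, 0, 0]), (9481306761, [1, 0, 0]),
  (10009924553, [1, 0, 0]), (10009954249, [1, 0, 0]), (10010167241, [1, 0, 0]),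
  (10010317513, [1, 0, 0]), (10010764105, [1, 0, 0]), (10010837961, [1, 0, 0]),
  (11565875849, [1, 0, 0]), (11599808457, [1, 0, 0]), (17192635720, [1, 0, 0]),
  (17192881480, [1, 0, 0]), (17193501512, [1, 0, 0]), (17314342017, [1, 0, 0]),
  (17314555009, [1, 0, 0]), (17314661505, [1, 0, 0]), (17315143681, [1, 0, 0]),
  (17326887881, [1, 0, 0]), (17326917577, [1, 0, 0]), (17327130569, [1, 0, 0]),
  (17327280841, [1, 0, 0]), (18031514440, [1, 0, 0]), (18536944585, [1, 0, 0]),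
  (18536974281, [1, 0, 0]), (18537191369, [1, 0, 0]), (18537220041, [1, 0, 0]),
  (18537337545, [1, 0, 0]), (20019495561, [1, 0, 0]), (1352918149, [1, 0, 1]),
  (1353131141, [1, 0, 1]), (1353237637, [1, 0, 1]), (1353719813, [1, 0, 1]),
  (4058071693, [1, 0, 1]), (4179706513, [1, 0, 1]), (7547732621, [1, 0, 1]),
  (7548226701, [1, 0, 1]), (7669367441, [1, 0, 1]), (9414197905, [1, 0, 1]),
  (10009789069, [1, 0, 1]), (17314169489, [1, 0, 1]), (17326752397, [1, 0, 1]),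
  (18536809101, [1, 0, 2]), (1352745621, [1, 0, 3]), (3301966666, [1, 1, 0]),
  (4184278923, [1, 1, 0]), (8210810763, [1, 1, 0]), (9481684875, [1, 1, 0]),
  (11566253963, [1, 1, 0]), (17192653642, [1, 1, 0]), (20019873675, [1, 1, 0]),
  (4058449807, [1, 1, 1]), (4180084627, [1, 1, 1]), (7547905189, [1, 1, 1]),
  (7548110735, [1, 1, 1]), (7548118181, [1, 1, 1]), (7548224677, [1, 1, 1]),
  (7548706853, [1, 1, 1]), (7548707599, [1, 1, 1]), (7669745555, [1, 1, 1]),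
  (9414576019, [1, 1, 1]), (10010167183, [1, 1, 1]), (17314547603, [1, 1, 1]),
  (17327130511, [1, 1, 1]), (18537187215, [1, 1, 2]), (1353123735, [1, 1, 3]),
  (3301118794, [1, 3, 0]), (18537187277, [2, 0, 1]), (3571532429, [2, 0, 3]),
  (3571910543, [2, 2, 3]), (3571910605, [4, 0, 1])]

/-- The extremal rays for all matching equations and the condition that the boundary values are
proportional to `u`. -/
noncomputable def raysAlong (u : ℤ × ℤ × ℤ) : List Entry :=
  -- Nine steps: three forms for the direction and the six inner matching equations. The inner forms
  -- occupy positions 0 to 5 of an outer entry, the boundary values positions 6 to 8.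
  steps adm 9 (outerRays.map fun e => (e.1,
    [u.2.1 * e.2.getD 6 0 - u.1 * e.2.getD 7 0, u.2.2 * e.2.getD 7 0 - u.2.1 * e.2.getD 8 0,
      u.1 * e.2.getD 8 0 - u.2.2 * e.2.getD 6 0] ++ e.2))

set_option maxRecDepth 100000

theorem bit_injective : Function.Injective bit := by decide +kernel

theorem nodup_pieces : pieces.Nodup := by decide +kernel

theorem mem_pieces (c : Piece) : c ∈ pieces := by
  obtain ⟨i, a | q⟩ := c <;> fin_cases i
  all_goals first | (fin_cases a <;> simp [pieces]) | (fin_cases q <;> simp [pieces])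

theorem adm_two_pow_bit : ∀ c, adm (2 ^ bit c) = true := by decide +kernel

theorem boundaryForm_nonneg : ∀ a c, 0 ≤ boundaryForm a c := by decide +kernel

theorem steps_unitEntries : steps adm outerForms.length
    (unitEntries bit (outerForms ++ (innerForms ++ boundaryForms)) pieces) = outerRays := by
  decide +kernel

theorem perm_rays : (steps adm innerForms.length outerRays).Perm rays := by decide +kernel

/-- Directions of the boundary values, with the numbers of extremal rays along them. -/
def dirCounts : List ((ℤ × ℤ × ℤ) × ℕ) := [((0, 1, 0), 18), ((0, 0, 1), 18), ((0, 1, 1), 63),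
  ((0, 2, 1), 88), ((0, 1, 2), 64), ((0, 1, 4), 68), ((1, 0, 0), 79), ((1, 1, 0), 132),
  ((1, 2, 0), 148), ((1, 3, 0), 143), ((1, 0, 1), 58), ((1, 1, 1), 127), ((1, 2, 1), 165),
  ((1, 3, 1), 155), ((1, 0, 3), 72), ((2, 1, 0), 153), ((2, 3, 0), 148), ((2, 3, 2), 165),
  ((4, 1, 0), 153)]

theorem lookup_dirCounts : ∀ q ∈ dirCounts, dirCounts.lookup q.1 = some q.2 := by decide +kernel

theorem countP_raysAlong : ∀ q ∈ dirCounts,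
    (raysAlong q.1).countP (fun f => decide (val f ≠ (0, 0, 0))) = q.2 := by
  decide +kernel

/-- Few directions occur among the rays, so the double description method has to be run only once
for each of them and its count can be looked up. -/
theorem exists_mem_dirCounts : ∀ e ∈ rays, val e ≠ (0, 0, 0) →
    ∃ q ∈ dirCounts, q.1 = flip3 (val e) := by
  decide +kernel

theorem isSmall_rays : ∀ e ∈ rays, encode (val e) < 4096 ∧
    castNat (decode (encode (val e))) = val e := by
  decide +kernel

theorem sumCrosses_tally : tally (edgeKeys adm entryKey rays) sumCrosses = 11836 := by
  decide +kernel

theorem length_doubleRayPairs_rays : (doubleRayPairs rays firstKind).length = 7135 := by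
  rw [length_doubleRayPairs]
  decide +kernel

/-- The matching equations. -/
def equations : Set (Piece → ℤ) := {φ | φ ∈ innerForms} ∪ {φ | φ ∈ outerForms}

/-! ### Admissibility in terms of binary digits -/

theorem adm_iff_land {m : ℕ} : adm m = true ↔
    (m &&& quadMask) &&& ((m &&& quadMask) >>> 1) = 0 ∧
      (m &&& quadMask) &&& ((m &&& quadMask) >>> 2) = 0 := by
  rw [adm, forceNat_eq]
  change Bool.rec false (Nat.beq ((m &&& quadMask) &&& ((m &&& quadMask) >>> 2)) 0)
    (Nat.beq ((m &&& quadMask) &&& ((m &&& quadMask) >>> 1)) 0) = true ↔ _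
  rw [← Nat.beq_eq, ← Nat.beq_eq]
  cases Nat.beq ((m &&& quadMask) &&& ((m &&& quadMask) >>> 1)) 0 <;> simp

theorem land_shiftRight_eq_zero {z s : ℕ} :
    z &&& (z >>> s) = 0 ↔ ∀ k, z.testBit k = true → z.testBit (s + k) = true → False := by
  constructor
  · intro h k h1 h2
    have := congrArg (fun n => n.testBit k) h
    simp [Nat.testBit_and, Nat.testBit_shiftRight, h1, h2] at this
  · intro h
    refine Nat.eq_of_testBit_eq fun k => ?_
    rw [Nat.testBit_and, Nat.testBit_shiftRight, Nat.zero_testBit, Bool.and_eq_false_iff]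
    by_contra hcon
    push Not at hcon
    simp only [ne_eq, Bool.not_eq_false] at hcon
    exact h k hcon.1 hcon.2

theorem quadMask_bits : ∀ (i : Fin 5) (q q' : Fin 3), q ≠ q' →
    quadMask.testBit (bit (i, Sum.inr q)) = true ∧
    (bit (i, Sum.inr q') = 1 + bit (i, Sum.inr q) ∨ bit (i, Sum.inr q') = 2 + bit (i, Sum.inr q) ∨
      bit (i, Sum.inr q) = 1 + bit (i, Sum.inr q') ∨
      bit (i, Sum.inr q) = 2 + bit (i, Sum.inr q')) := by
  decide +kernel

/-- The highest digit of `quadMask` is at position 34, so 37 positions cover all cases. -/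
theorem exists_of_quadMask_bits : ∀ (k : Fin 37) (s : Fin 2),
    quadMask.testBit k = true → quadMask.testBit (s + 1 + k) = true → ∃ (i : Fin 5) (q q' : Fin 3), q ≠ q' ∧
      bit (i, Sum.inr q) = k ∧ bit (i, Sum.inr q') = s + 1 + k := by
  decide +kernel

theorem adm_iff {m : ℕ} : adm m = true ↔ ∀ (i : Fin 5) (q q' : Fin 3),
    m.testBit (bit (i, Sum.inr q)) = true → m.testBit (bit (i, Sum.inr q')) = true → q = q' := by
  rw [adm_iff_land, land_shiftRight_eq_zero, land_shiftRight_eq_zero]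
  simp only [Nat.testBit_and, Bool.and_eq_true]
  constructor
  · rintro ⟨h1, h2⟩ i q q' hq hq'
    by_contra hne
    obtain ⟨ha, h⟩ := quadMask_bits i q q' hne
    obtain ⟨hb, -⟩ := quadMask_bits i q' q (Ne.symm hne)
    rcases h with h | h | h | h
    · exact h1 _ ⟨hq, ha⟩ (h ▸ ⟨hq', hb⟩)
    · exact h2 _ ⟨hq, ha⟩ (h ▸ ⟨hq', hb⟩)
    · exact h1 _ ⟨hq', hb⟩ (h ▸ ⟨hq, ha⟩)
    · exact h2 _ ⟨hq', hb⟩ (h ▸ ⟨hq, ha⟩)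
  · intro h
    have key : ∀ (s : Fin 2) (k : ℕ), m.testBit k = true ∧ quadMask.testBit k = true →
        m.testBit (s + 1 + k) = true ∧
        quadMask.testBit (s + 1 + k) = true → False := by
      intro s k h1 h2
      have hk : k < 37 := by
        by_contra hcon
        have : quadMask.testBit k = false := Nat.testBit_lt_two_pow
          (lt_of_lt_of_le (by decide : quadMask < 2 ^ 37)
            (Nat.pow_le_pow_right two_pos (not_lt.1 hcon)))
        rw [this] at h1
        exact Bool.false_ne_true h1.2
      obtain ⟨i, q, q', hne, hq, hq'⟩ := exists_of_quadMask_bits ⟨k, hk⟩ s h1.2 h2.2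
      exact hne (h i q q' (hq ▸ h1.1) (hq' ▸ h2.1))
    exact ⟨key 0, key 1⟩

/-- Heredity of the quadrilateral constraints, which justifies the pruning. -/
theorem adm_mono (m m' : ℕ) (h : adm m' = true) (hb : Nat.beq (Nat.lor m m') m' = true) :
    adm m = true := by
  rw [adm_iff] at h ⊢
  rw [Nat.beq_eq] at hb
  have hk : ∀ k, m.testBit k = true → m'.testBit k = true := fun k hk => by
    rw [← hb]
    change (m ||| m').testBit k = true
    rw [Nat.testBit_or, hk, Bool.true_or]
  exact fun i q q' h1 h2 => h i q q' (hk _ h1) (hk _ h2)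

/-! ### Correctness of the tables and the resulting count -/

theorem enumerates_outerRays : Enumerates bit adm {φ | φ ∈ outerForms}
    (innerForms ++ boundaryForms) outerRays := by
  have := (enumerates_unitEntries bit_injective adm_two_pow_bit
    (outerForms ++ (innerForms ++ boundaryForms)) nodup_pieces mem_pieces).steps bit_injective
    adm_mono outerForms
  rwa [steps_unitEntries, Set.union_empty] at this

theorem enumerates_rays : Enumerates bit adm equations boundaryForms rays :=
  (enumerates_outerRays.steps bit_injective adm_mono innerForms).perm perm_rays

/-- The three direction forms are combinations of the recorded boundary values, so they can be put
in front of the inner forms and the method continues from `outerRays`. -/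
theorem enumerates_raysAlong (u : ℤ × ℤ × ℤ) :
    Enumerates bit adm ({φ | φ ∈ dirForms boundaryForm u} ∪ equations) boundaryForms
      (raysAlong u) := by
  have h : Enumerates bit adm {φ | φ ∈ outerForms}
      ((dirForms boundaryForm u ++ innerForms) ++ boundaryForms) (outerRays.map fun e => (e.1,
      [u.2.1 * e.2.getD 6 0 - u.1 * e.2.getD 7 0, u.2.2 * e.2.getD 7 0 - u.2.1 * e.2.getD 8 0,
      u.1 * e.2.getD 8 0 - u.2.2 * e.2.getD 6 0] ++ e.2)) := by
    rw [List.append_assoc]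
    refine enumerates_outerRays.prepend _ _ fun e v k h => ?_
    have key : ∀ i, intForm ((innerForms ++ boundaryForms).getD i 0) v = k * e.2.getD i 0 := by
      intro i
      have := congrArg (fun l => l.getD i 0) h
      have h0 : intForm 0 v = 0 := by simp [intForm]
      rw [← h0, List.getD_map] at this
      rw [this]
      have h1 := List.getD_map (l := e.2) (d := 0) (n := i) (fun z : ℤ => (k : ℤ) * z)
      rw [mul_zero] at h1
      rw [h0, h1]
    have k0 : intForm (boundaryForm 0) v = k * e.2.getD 6 0 := key 6
    have k1 : intForm (boundaryForm 1) v = k * e.2.getD 7 0 := key 7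
    have k2 : intForm (boundaryForm 2) v = k * e.2.getD 8 0 := key 8
    simp only [dirForms, List.map_cons, List.map_nil, intForm_sub_zsmul, k0, k1, k2]
    simp only [List.cons.injEq, and_true]
    refine ⟨?_, ?_, ?_⟩ <;> ring
  have hE : {φ | φ ∈ dirForms boundaryForm u} ∪ equations =
      {φ | φ ∈ dirForms boundaryForm u ++ innerForms} ∪ {φ | φ ∈ outerForms} := by
    ext φ
    simp only [equations, Set.mem_union, Set.mem_ofPred_eq, List.mem_append, or_assoc]
  rw [hE]
  exact h.steps bit_injective adm_mono

theorem length_rayPairs_rays {c : Entry → Bool} (hc : ∀ e ∈ rays, c e = true → val e ≠ (0, 0, 0)) :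
    (rayPairs rays raysAlong c).length =
      ((rays.filter c).map fun e => (dirCounts.lookup (flip3 (val e))).getD 0).sum := by
  rw [length_rayPairs]
  congr 1
  refine List.map_congr_left fun e he => ?_
  obtain ⟨he, hce⟩ := List.mem_filter.1 he
  obtain ⟨q, hq, hqe⟩ := exists_mem_dirCounts e he (hc e he hce)
  rw [← hqe, countP_raysAlong q hq, lookup_dirCounts q hq, Option.getD_some]

/-- The arithmetic is 13471 + 13471 + 11836 − 7135. -/
theorem ncard_pairMasks_equations :
    (pairMasks bit adm equations boundaryForm).ncard = 31643 := by
  have h := ncard_pairMasks bit_injective adm_mono boundaryForm_nonneg enumerates_rays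
    enumerates_raysAlong
  have h1 : (rayPairs rays raysAlong firstKind).length = 13471 := by
    rw [length_rayPairs_rays (by decide +kernel)]
    decide +kernel
  have h2 : (rayPairs rays raysAlong secondKind).length = 13471 := by
    rw [length_rayPairs_rays (by decide +kernel)]
    decide +kernel
  rw [length_doubleRayPairs_rays, h1, h2, length_edgePairs_eq isSmall_rays, ← tally_eq _ sumCrosses,
    sumCrosses_tally] at h
  omega

end TriH

/-! ### Normal surfaces in terms of extremal rays -/

open PolyCone RayEnum

namespace Triangulation

variable {T : Triangulation}

section

variable (T)

/-- The linear forms whose vanishing expresses the matching equations. -/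
def equations [DecidableEq T.Tet] : Set (T.Piece → ℤ) := {φ | ∃ i f j p a,
  T.glue i f = some (j, p) ∧ a ≠ f ∧ φ = arcForm i f a - arcForm j (p f) (p a)}

/-- The quadrilateral constraints in terms of supports. -/
def QuadSet (S : Set T.Piece) : Prop :=
  ∀ i q q', (i, Sum.inr q) ∈ S → (i, Sum.inr q') ∈ S → q = q'

end

theorem arcs_toReal (x : T.Piece → ℕ) (i : T.Tet) (f a : Fin 4) :
    arcs (toReal x) i f a = ((arcs x i f a : ℕ) : ℝ) := by
  simp [arcs, toReal]

theorem arcs_smul (t : ℝ) (x : T.Piece → ℝ) (i : T.Tet) (f a : Fin 4) :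
    arcs (t • x) i f a = t * arcs x i f a := by
  simp [arcs, mul_add, Finset.mul_sum]

variable [Fintype T.Tet] [DecidableEq T.Tet]

theorem form_arcForm (x : T.Piece → ℝ) (i : T.Tet) (f a : Fin 4) :
    form (arcForm i f a) x = arcs x i f a := by
  rw [form, Fintype.sum_prod_type, Finset.sum_eq_single i, Fintype.sum_sum_type]
  · simp [arcForm, arcs]
  · intro j _ hj
    simp [Fintype.sum_sum_type, arcForm, hj]
  · simp

theorem form_sub_left {ι : Type} [Fintype ι] (φ ψ : ι → ℤ) (x : ι → ℝ) :
    form (φ - ψ) x = form φ x - form ψ x := by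
  simp [form, sub_mul]

theorem mem_cone_equations {x : T.Piece → ℝ} : x ∈ cone T.equations ↔ InCone x := by
  refine and_congr_right fun _ => ⟨fun h i f j p hg a ha => ?_, ?_⟩
  · have := h _ ⟨i, f, j, p, a, hg, ha, rfl⟩
    rwa [form_sub_left, form_arcForm, form_arcForm, sub_eq_zero] at this
  · rintro h φ ⟨i, f, j, p, a, hg, ha, rfl⟩
    rw [form_sub_left, form_arcForm, form_arcForm, sub_eq_zero]
    exact h i f j p hg a ha

/-- A summand of `x` lies below `x`; conversely a small multiple of any vector below `x` is a
summand of `x`. -/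
theorem isRay_cone_iff {ι : Type} [Fintype ι] {E : Set (ι → ℤ)} {x : ι → ℝ} :
    IsRay (cone E) x ↔ x ∈ cone E ∧ x ≠ 0 ∧
      ∀ y z, y ∈ cone E → z ∈ cone E → y + z = x → ∃ t : ℝ, y = t • x := by
  refine and_congr_right fun hx => and_congr_right fun _ => ⟨?_, ?_⟩
  · rintro h y z hy hz rfl
    refine h y hy ?_
    rw [support_add_of_nonneg hy.1 hz.1]
    exact Set.subset_union_left
  · intro h y hy hs
    obtain ⟨ε, hε, hnn⟩ := exists_add_smul_nonneg (v := -y) hx.1 (by simpa using hs)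
    obtain ⟨t, ht⟩ := h (ε • y) (x + ε • -y) (smul_mem_cone hε.le hy)
      ⟨hnn ε hε.le le_rfl, fun φ hφ => by
        rw [form_add, form_smul, form_neg, hx.2 φ hφ, hy.2 φ hφ]; simp⟩ (by simp)
    refine ⟨ε⁻¹ * t, ?_⟩
    rw [mul_smul, ← ht, smul_smul, inv_mul_cancel₀ hε.ne', one_smul]

theorem onExtremalRay_iff {x : T.Piece → ℝ} : OnExtremalRay x ↔ IsRay (cone T.equations) x := by
  simp only [isRay_cone_iff, mem_cone_equations]
  rfl

/-- Rays of a cone with integer equations are rational. The double description method with every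
support admissible already yields integer vectors on all rays. -/
theorem exists_toReal_of_isRay {ι : Type} [Fintype ι] {E : Set (ι → ℤ)} (hE : E.Finite)
    {x : ι → ℝ} (hx : IsRay (cone E) x) :
    ∃ v : ι → ℕ, IsRay (cone E) (toReal v) ∧
      Function.support (toReal v) = Function.support x := by
  classical
  let b : ι → ℕ := fun c => Fintype.equivFin ι c
  have hb : Function.Injective b := fun c d h => (Fintype.equivFin ι).injective (Fin.ext h)
  have h := (enumerates_unitEntries (adm := fun _ => true) hb (fun _ => rfl) (hE.toFinset.toList ++ [])
    (Finset.nodup_toList Finset.univ) (fun c => by simp)).steps hb (fun _ _ _ _ => rfl)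
    hE.toFinset.toList
  have hEE : {φ | φ ∈ hE.toFinset.toList} ∪ ∅ = E := by ext; simp
  rw [hEE] at h
  obtain ⟨m, hm⟩ := exists_isMask b (Function.support x)
  obtain ⟨e, he, rfl⟩ := h.complete x m hx hm rfl
  obtain ⟨-, v, hv, hmv, -⟩ := h.sound e he
  exact ⟨v, hv, hmv.set_unique hb hm⟩

theorem finite_equations : T.equations.Finite := by
  have : T.equations ⊆ Set.range fun s : T.Tet × Fin 4 × T.Tet × Equiv.Perm (Fin 4) × Fin 4 =>
      (arcForm s.1 s.2.1 s.2.2.2.2 - arcForm s.2.2.1 (s.2.2.2.1 s.2.1) (s.2.2.2.1 s.2.2.2.2) :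
        T.Piece → ℤ) := by
    rintro φ ⟨i, f, j, p, a, -, -, rfl⟩
    exact ⟨(i, f, j, p, a), rfl⟩
  exact (Set.finite_range _).subset this

/-- Every ray that contains a non-zero integer point contains a smallest one. -/
theorem exists_minimal_multiple {ι : Type} {v : ι → ℕ} (hv : v ≠ 0) :
    ∃ x : ι → ℕ, x ≠ 0 ∧ (∃ t : ℝ, 0 < t ∧ toReal x = t • toReal v) ∧
      ∀ y : ι → ℕ, y ≠ 0 → (∃ t : ℝ, toReal y = t • toReal x) → x ≤ y := by
  classical
  obtain ⟨c, hc⟩ := Function.ne_iff.1 hv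
  have hvc : (0 : ℝ) < v c := by exact_mod_cast Nat.pos_of_ne_zero hc
  let s : Set (ι → ℕ) := {x | x ≠ 0 ∧ ∃ t : ℝ, 0 < t ∧ toReal x = t • toReal v}
  have hs : s.Nonempty := ⟨v, hv, 1, one_pos, (one_smul _ _).symm⟩
  -- All points of the ray are ordered by their coordinate at `c`, where `v` is positive; so
  -- minimising this coordinate minimises all of them.
  obtain ⟨x, ⟨hx0, t, ht, hx⟩, hmin⟩ :=
    WellFounded.has_min (measure fun x : ι → ℕ => x c).wf s hs
  refine ⟨x, hx0, ⟨t, ht, hx⟩, ?_⟩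
  rintro y hy0 ⟨u, hu⟩
  have hu0 : 0 < u := by
    obtain ⟨d, hd⟩ := Function.ne_iff.1 hy0
    have h1 := congrFun hu d
    simp only [toReal, Pi.smul_apply, smul_eq_mul] at h1
    have h2 : (0 : ℝ) < y d := by exact_mod_cast Nat.pos_of_ne_zero hd
    rw [h1] at h2
    exact pos_of_mul_pos_left h2 (Nat.cast_nonneg _)
  have hle : x c ≤ y c := not_lt.1 (hmin y ⟨hy0, u * t, mul_pos hu0 ht, by rw [hu, hx, smul_smul]⟩)
  have hxc : (0 : ℝ) < x c := by
    have := congrFun hx c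
    simp only [toReal, Pi.smul_apply, smul_eq_mul] at this
    rw [this]; positivity
  have h1 : 1 ≤ u := by
    have := congrFun hu c
    simp only [toReal, Pi.smul_apply, smul_eq_mul] at this
    have h3 : (x c : ℝ) ≤ y c := by exact_mod_cast hle
    rw [this] at h3
    exact le_of_mul_le_mul_right (by linarith) hxc
  intro d
  have := congrFun hu d
  simp only [toReal, Pi.smul_apply, smul_eq_mul] at this
  have h3 : (x d : ℝ) ≤ y d := by
    rw [this]
    exact le_mul_of_one_le_left (Nat.cast_nonneg _) h1
  exact_mod_cast h3

/-- The supports of the vertex normal surfaces that are counted by `alpha`. -/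
def alphaSupports (F : T.Face) (a : Fin 4) : Set (Set T.Piece) := {S | T.QuadSet S ∧
  ∃ x : T.Piece → ℝ, IsRay (cone T.equations) x ∧ Function.support x = S ∧
    0 < arcs x F.1 F.2 a ∧ ∀ b, b ≠ F.2 → b ≠ a → arcs x F.1 F.2 b = 0}

/-- The support determines the ray, and the ray determines its smallest integer point. -/
theorem support_toReal_injOn :
    Set.InjOn (fun x : T.Piece → ℕ => Function.support (toReal x)) {x | IsVertexNormal x} := by
  intro x hx y hy h
  have h1 := onExtremalRay_iff.1 hx.2.1
  have h2 := onExtremalRay_iff.1 hy.2.1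
  have ne : ∀ {x : T.Piece → ℕ}, IsVertexNormal x → x ≠ 0 := by
    rintro x hx rfl
    exact hx.2.1.2.1 (funext fun c => Nat.cast_zero)
  refine le_antisymm (hx.2.2 y (ne hy) (h1.2.2 _ h2.1 ?_)) (hy.2.2 x (ne hx) (h2.2.2 _ h1.1 ?_))
  · exact h.symm.le
  · exact h.le

/-- The number of arcs is homogeneous, so both conditions on the marked face depend on the ray only
and may be tested at any real point of it. -/
theorem alpha_eq_ncard_alphaSupports (F : T.Face) (a : Fin 4) :
    T.alpha F a = (alphaSupports F a).ncard := by
  rw [alpha, ← (support_toReal_injOn.mono fun x hx => hx.1).ncard_image]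
  congr 1
  ext S
  constructor
  · rintro ⟨x, ⟨hx, hpos, h0⟩, rfl⟩
    refine ⟨fun i q q' h h' => hx.1 i q q' (by simpa [toReal] using h)
      (by simpa [toReal] using h'), toReal x, onExtremalRay_iff.1 hx.2.1, rfl, ?_, fun b hb hb' => ?_⟩
    · rw [arcs_toReal]; exact_mod_cast hpos
    · rw [arcs_toReal, h0 b hb hb', Nat.cast_zero]
  · rintro ⟨hS, x, hx, rfl, hpos, h0⟩
    obtain ⟨v, hv, hvx⟩ := exists_toReal_of_isRay finite_equations hx
    have hv0 : v ≠ 0 := by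
      rintro rfl
      exact hv.2.1 (funext fun c => Nat.cast_zero)
    obtain ⟨y, hy0, ⟨t, ht, hy⟩, hmin⟩ := exists_minimal_multiple hv0
    have hyr : IsRay (cone T.equations) (toReal y) := hy ▸ hv.smul ht
    have hys : Function.support (toReal y) = Function.support x := by
      rw [hy, support_smul ht.ne', hvx]
    obtain ⟨u, hu, hyx⟩ := hx.exists_eq_smul hyr.1 hyr.2.1 hys.le
    refine ⟨y, ⟨⟨?_, onExtremalRay_iff.2 hyr, hmin⟩, ?_, ?_⟩, hys⟩
    · intro i q q' h h'
      refine hS i q q' ?_ ?_ <;> rw [← hys] <;> simpa [toReal]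
    · have : (0 : ℝ) < (arcs y F.1 F.2 a : ℕ) := by
        rw [← arcs_toReal, hyx, arcs_smul]; positivity
      exact_mod_cast this
    · intro b hb hb'
      have : ((arcs y F.1 F.2 b : ℕ) : ℝ) = 0 := by
        rw [← arcs_toReal, hyx, arcs_smul, h0 b hb hb', mul_zero]
      exact_mod_cast this

theorem finite_isVertexNormal : {x : T.Piece → ℕ | IsVertexNormal x}.Finite :=
  Set.Finite.of_injOn (t := Set.univ) (fun _ _ => Set.mem_univ _) support_toReal_injOn
    Set.finite_univ

theorem alpha_le_sigma (F : T.Face) (a : Fin 4) : T.alpha F a ≤ T.sigma :=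
  Set.ncard_le_ncard (fun _ h => h.1) finite_isVertexNormal

end Triangulation

/-! ### Vertex normal surfaces of a doubled triangulation -/

open PolyCone RayEnum

/-- How the face opposite vertex `3` of each of the two copies is attached to the new
tetrahedron. -/
def attach : Bool → Equiv.Perm (Fin 4)
  | true => Equiv.swap 2 3
  | false => Equiv.swap 1 3

/-- The triangulation `N` arises from two copies of `M` and a new tetrahedron, to which the face
opposite vertex `3` of the tetrahedron `r` of each copy is attached. -/
structure IsStdDoubling (M : Triangulation) (r : M.Tet) (N : Triangulation)
    (e : Option (Bool × M.Tet) ≃ N.Tet) : Prop where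
  boundary : M.glue r 3 = none
  copy : ∀ b i f, (i, f) ≠ (r, 3) → N.glue (e (some (b, i))) f =
    (M.glue i f).map fun jq => (e (some (b, jq.1)), jq.2)
  root : ∀ b, N.glue (e (some (b, r))) 3 = some (e none, attach b)
  free : ∀ f, (∀ b, f ≠ attach b 3) → N.glue (e none) f = none

/-- The normal arcs in the face opposite vertex `3`. -/
def rootForm {ι : Type} [DecidableEq ι] (r : ι) (a : Fin 3) : ι × (Fin 4 ⊕ Fin 3) → ℤ :=
  arcForm r 3 a.castSucc

theorem rootForm_nonneg {ι : Type} [DecidableEq ι] (r : ι) (a : Fin 3)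
    (c : ι × (Fin 4 ⊕ Fin 3)) : 0 ≤ rootForm r a c := by
  obtain ⟨i, b | q⟩ := c <;> simp only [rootForm, arcForm] <;> split_ifs <;> simp

namespace IsStdDoubling

open Triangulation

variable {M N : Triangulation} {r : M.Tet} {e : Option (Bool × M.Tet) ≃ N.Tet}

theorem isDoubling (h : IsStdDoubling M r N e) :
    IsDoubling ⟨M, (r, 3)⟩ ⟨N, (e none, 3)⟩ :=
  ⟨h.boundary, e, attach, by change attach true 3 ≠ attach false 3; decide, h.copy, h.root, h.free,
    rfl, by change ∀ b, (3 : Fin 4) ≠ attach b 3; decide⟩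

theorem root_symm (h : IsStdDoubling M r N e) (b : Bool) :
    N.glue (e none) (attach b 3) = some (e (some (b, r)), (attach b)⁻¹) :=
  N.glue_symm _ _ _ _ (h.root b)

/-- The part of a vector that belongs to one of the copies. -/
def restrict {R : Type} (e : Option (Bool × M.Tet) ≃ N.Tet) (X : N.Piece → R) (b : Bool) :
    M.Piece → R := fun c => X (e (some (b, c.1)), c.2)

theorem arcs_restrict {R : Type} [AddCommMonoid R] (X : N.Piece → R) (b : Bool) (i : M.Tet)
    (f a : Fin 4) : arcs (restrict e X b) i f a = arcs X (e (some (b, i))) f a := rfl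

theorem matching_iff (h : IsStdDoubling M r N e) {R : Type} [AddCommMonoid R] {X : N.Piece → R} :
    Matching X ↔ (∀ b, Matching (restrict e X b)) ∧ ∀ b a, a ≠ 3 →
      arcs (restrict e X b) r 3 a = arcs X (e none) (attach b 3) (attach b a) := by
  constructor
  · refine fun hX => ⟨fun b i f j p hg a ha => ?_, fun b a ha => hX _ _ _ _ (h.root b) a ha⟩
    have hne : (i, f) ≠ (r, 3) := by
      rintro heq
      rw [Prod.mk.injEq] at heq
      rw [heq.1, heq.2, h.boundary] at hg
      cases hg
    exact hX _ _ _ _ (by rw [h.copy b i f hne, hg]; rfl) a ha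
  · rintro ⟨h1, h2⟩ i f j p hg a ha
    obtain ⟨_ | ⟨b, i⟩, rfl⟩ := e.surjective i
    · by_cases hf : ∀ b, f ≠ attach b 3
      · rw [h.free f hf] at hg; cases hg
      · push Not at hf
        obtain ⟨b, rfl⟩ := hf
        rw [h.root_symm b, Option.some.injEq, Prod.mk.injEq] at hg
        obtain ⟨rfl, rfl⟩ := hg
        have := h2 b ((attach b)⁻¹ a) (by
          rintro heq
          apply ha
          rw [← heq]; exact ((attach b).apply_symm_apply a).symm)
        rw [show attach b ((attach b)⁻¹ a) = a from (attach b).apply_symm_apply a] at this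
        rw [← this, arcs_restrict,
          show (attach b)⁻¹ (attach b 3) = 3 from (attach b).symm_apply_apply 3]
    · by_cases hne : (i, f) = (r, 3)
      · rw [Prod.mk.injEq] at hne
        obtain ⟨rfl, rfl⟩ := hne
        rw [h.root b, Option.some.injEq, Prod.mk.injEq] at hg
        obtain ⟨rfl, rfl⟩ := hg
        exact h2 b a ha
      · rw [h.copy b i f hne, Option.map_eq_some_iff] at hg
        obtain ⟨⟨j', p'⟩, hg, heq⟩ := hg
        rw [Prod.mk.injEq] at heq
        obtain ⟨rfl, rfl⟩ := heq
        exact h1 b i f j' p' hg a ha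

theorem arcs_eq {X : N.Piece → ℝ} {i : N.Tet} :
    arcs X i 3 0 = X (i, Sum.inl 0) + X (i, Sum.inr 2) ∧
    arcs X i 3 1 = X (i, Sum.inl 1) + X (i, Sum.inr 1) ∧
    arcs X i 3 2 = X (i, Sum.inl 2) + X (i, Sum.inr 0) ∧
    arcs X i 2 0 = X (i, Sum.inl 0) + X (i, Sum.inr 1) ∧
    arcs X i 2 1 = X (i, Sum.inl 1) + X (i, Sum.inr 2) ∧
    arcs X i 2 3 = X (i, Sum.inl 3) + X (i, Sum.inr 0) ∧
    arcs X i 1 0 = X (i, Sum.inl 0) + X (i, Sum.inr 0) ∧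
    arcs X i 1 3 = X (i, Sum.inl 3) + X (i, Sum.inr 1) ∧
    arcs X i 1 2 = X (i, Sum.inl 2) + X (i, Sum.inr 2) := by
  refine ⟨?_, ?_, ?_, ?_, ?_, ?_, ?_, ?_, ?_⟩ <;>
  · simp only [arcs, Fin.sum_univ_three]
    simp [SameSide, Fin.ext_iff]

variable [Fintype M.Tet] [DecidableEq M.Tet]

/-- The vector of a surface in the double, from its restrictions to the copies. -/
noncomputable def extend (r : M.Tet) (e : Option (Bool × M.Tet) ≃ N.Tet) (x y : M.Piece → ℝ) :
    N.Piece → ℝ := fun c =>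
  match e.symm c.1, c.2 with
  | some (true, i), d => x (i, d)
  | some (false, i), d => y (i, d)
  -- Without arcs around vertices 1 and 2 in the marked face, the new tetrahedron contains only
  -- triangles around 0 and 3 and quadrilaterals of type 2; on the face glued to the first copy
  -- these give the arcs around 0, 2 and 1 of that copy.
  | none, Sum.inl a => ![form (rootForm r 0) x, 0, 0, form (rootForm r 2) x] a
  | none, Sum.inr q => ![0, 0, form (rootForm r 1) x] q

theorem extend_true (x y : M.Piece → ℝ) (i : M.Tet) (d) :
    extend r e x y (e (some (true, i)), d) = x (i, d) := by
  simp only [extend, Equiv.symm_apply_apply]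

theorem extend_false (x y : M.Piece → ℝ) (i : M.Tet) (d) :
    extend r e x y (e (some (false, i)), d) = y (i, d) := by
  simp only [extend, Equiv.symm_apply_apply]

theorem extend_inl (x y : M.Piece → ℝ) (a : Fin 4) : extend r e x y (e none, Sum.inl a) =
    ![form (rootForm r 0) x, 0, 0, form (rootForm r 2) x] a := by
  simp only [extend, Equiv.symm_apply_apply]

theorem extend_inr (x y : M.Piece → ℝ) (q : Fin 3) : extend r e x y (e none, Sum.inr q) =
    ![0, 0, form (rootForm r 1) x] q := by
  simp only [extend, Equiv.symm_apply_apply]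

theorem restrict_extend_true (x y : M.Piece → ℝ) : restrict e (extend r e x y) true = x :=
  funext fun _ => extend_true x y _ _

theorem restrict_extend_false (x y : M.Piece → ℝ) : restrict e (extend r e x y) false = y :=
  funext fun _ => extend_false x y _ _

theorem extend_smul (t : ℝ) (x y : M.Piece → ℝ) :
    extend r e (t • x) (t • y) = t • extend r e x y := by
  funext ⟨i, d⟩
  obtain ⟨_ | ⟨_ | _, i⟩, rfl⟩ := e.surjective i
  · obtain a | q := d
    · rw [Pi.smul_apply, extend_inl, extend_inl]
      fin_cases a <;> simp [form_smul]
    · rw [Pi.smul_apply, extend_inr, extend_inr]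
      fin_cases q <;> simp [form_smul]
  · rw [Pi.smul_apply, extend_false, extend_false]; rfl
  · rw [Pi.smul_apply, extend_true, extend_true]; rfl

theorem form_rootForm (x : M.Piece → ℝ) (a : Fin 3) :
    form (rootForm r a) x = arcs x r 3 a.castSucc := form_arcForm x r 3 a.castSucc

/-- The coefficients of the form are non-negative, so its vanishing at a non-negative vector is a
condition on the support. -/
theorem form_rootForm_eq_zero {x x' : M.Piece → ℝ} (hx : ∀ c, 0 ≤ x c)
    (hs : Function.support x' ⊆ Function.support x) {a : Fin 3} (h : form (rootForm r a) x = 0) :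
    form (rootForm r a) x' = 0 := by
  have h0 := (Finset.sum_eq_zero_iff_of_nonneg fun c _ => mul_nonneg
    (show (0 : ℝ) ≤ rootForm r a c by exact_mod_cast rootForm_nonneg r a c) (hx c)).1 h
  refine Finset.sum_eq_zero fun c hc => ?_
  rcases mul_eq_zero.1 (h0 c hc) with h1 | h1
  · rw [h1, zero_mul]
  · by_cases h2 : x' c = 0
    · rw [h2, mul_zero]
    · exact absurd h1 (hs h2)

/-- The coordinates in the new tetrahedron are boundary values of the first component, whose
vanishing is inherited by smaller supports. In particular the support of the extension is determined
by the two supports. -/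
theorem support_extend_subset {x y x' y' : M.Piece → ℝ} (hx : ∀ c, 0 ≤ x c)
    (hs : Function.support x' ⊆ Function.support x)
    (hs' : Function.support y' ⊆ Function.support y) :
    Function.support (extend r e x' y') ⊆ Function.support (extend r e x y) := by
  have h0 := fun a => form_rootForm_eq_zero (r := r) hx hs (a := a)
  rintro ⟨i, d⟩
  obtain ⟨_ | ⟨_ | _, i⟩, rfl⟩ := e.surjective i
  · obtain a | q := d
    · rw [Function.mem_support, Function.mem_support, extend_inl, extend_inl]
      match a with
      | 0 => exact mt (h0 0)
      | 1 => exact id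
      | 2 => exact id
      | 3 => exact mt (h0 2)
    · rw [Function.mem_support, Function.mem_support, extend_inr, extend_inr]
      match q with
      | 0 => exact id
      | 1 => exact id
      | 2 => exact mt (h0 1)
  · rw [Function.mem_support, Function.mem_support, extend_false, extend_false]
    exact fun h => hs' h
  · rw [Function.mem_support, Function.mem_support, extend_true, extend_true]
    exact fun h => hs h

theorem extend_eq_zero {x y : M.Piece → ℝ} : extend r e x y = 0 ↔ x = 0 ∧ y = 0 := by
  constructor
  · intro h0
    have h1 := congrArg (fun X => restrict e X true) h0
    have h2 := congrArg (fun X => restrict e X false) h0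
    simp only [restrict_extend_true, restrict_extend_false] at h1 h2
    exact ⟨h1, h2⟩
  · rintro ⟨rfl, rfl⟩
    have := extend_smul (r := r) (e := e) (0 : ℝ) 0 0
    rwa [zero_smul, zero_smul] at this

theorem arcs_extend (x y : M.Piece → ℝ) : arcs (extend r e x y) (e none) 3 0 =
    form (rootForm r 0) x + form (rootForm r 1) x := by
  rw [arcs_eq.1, extend_inl, extend_inr]
  rfl

variable [Fintype N.Tet] [DecidableEq N.Tet]

/-- A vector of the cone of the double that has only arcs around vertex `0` in the marked face is
determined by its restrictions. -/
theorem mem_cone_iff (h : IsStdDoubling M r N e) {X : N.Piece → ℝ} :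
    (X ∈ cone N.equations ∧ arcs X (e none) 3 1 = 0 ∧ arcs X (e none) 3 2 = 0) ↔
      restrict e X true ∈ cone M.equations ∧ restrict e X false ∈ cone M.equations ∧
        Fits (rootForm r) (restrict e X true) (restrict e X false) ∧
        X = extend r e (restrict e X true) (restrict e X false) := by
  obtain ⟨-, a31, a32, a20, a21, a23, a10, a13, a12⟩ := arcs_eq (X := X) (i := e none)
  rw [mem_cone_equations, mem_cone_equations, mem_cone_equations]
  have hFits : ∀ x y : M.Piece → ℝ, Fits (rootForm r) x y ↔ arcs x r 3 0 = arcs y r 3 0 ∧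
      arcs x r 3 1 = arcs y r 3 2 ∧ arcs x r 3 2 = arcs y r 3 1 := fun x y => by
    simp only [Fits, form_rootForm, Fin.forall_fin_succ]
    have : Equiv.swap (1 : Fin 3) 2 0 = 0 := by decide
    simp [this]
  have hall : ∀ P : Fin 4 → Prop, (∀ a, a ≠ 3 → P a) ↔ P 0 ∧ P 1 ∧ P 2 := fun P => by
    simp [Fin.forall_fin_succ]
  have hroot : (∀ b a, a ≠ 3 → arcs (restrict e X b) r 3 a =
      arcs X (e none) (attach b 3) (attach b a)) ↔
      (arcs (restrict e X false) r 3 0 = arcs X (e none) 1 0 ∧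
      arcs (restrict e X false) r 3 1 = arcs X (e none) 1 3 ∧
      arcs (restrict e X false) r 3 2 = arcs X (e none) 1 2) ∧
      (arcs (restrict e X true) r 3 0 = arcs X (e none) 2 0 ∧
      arcs (restrict e X true) r 3 1 = arcs X (e none) 2 1 ∧
      arcs (restrict e X true) r 3 2 = arcs X (e none) 2 3) := by
    simp only [hall, Bool.forall_bool]
    rfl
  rw [hFits]
  unfold InCone
  rw [h.matching_iff, hroot, a31, a32, a20, a21, a23, a10, a13, a12, Bool.forall_bool]
  constructor
  · rintro ⟨⟨hnn, ⟨hA, hB⟩, ⟨f0, f1, f2⟩, t0, t1, t2⟩, z1, z2⟩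
    have n := fun d => hnn (e none, d)
    have z := (add_eq_zero_iff_of_nonneg (n _) (n _)).1 z1
    have z' := (add_eq_zero_iff_of_nonneg (n _) (n _)).1 z2
    rw [z.1, zero_add] at t1
    rw [z.2, add_zero] at t0 f1
    rw [z'.1, zero_add] at f2
    rw [z'.2, add_zero] at t2 f0
    refine ⟨⟨fun c => hnn _, hB⟩, ⟨fun c => hnn _, hA⟩, ⟨t0.trans f0.symm, t1.trans f2.symm,
      t2.trans f1.symm⟩, funext ?_⟩
    rintro ⟨i, d⟩
    obtain ⟨_ | ⟨_ | _, i⟩, rfl⟩ := e.surjective i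
    · obtain a | q := d
      · rw [extend_inl, form_rootForm, form_rootForm]
        match a with
        | 0 => exact t0.symm
        | 1 => exact z.1
        | 2 => exact z'.1
        | 3 => exact t2.symm
      · rw [extend_inr, form_rootForm]
        match q with
        | 0 => exact z'.2
        | 1 => exact z.2
        | 2 => exact t1.symm
    · rw [extend_false]; rfl
    · rw [extend_true]; rfl
  · rintro ⟨⟨hnA, hA⟩, ⟨hnB, hB⟩, ⟨f0, f1, f2⟩, hX⟩
    have vl : ∀ a, X (e none, Sum.inl a) = ![arcs (restrict e X true) r 3 0, 0, 0,
        arcs (restrict e X true) r 3 2] a := fun a => by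
      rw [congrFun hX, extend_inl, form_rootForm, form_rootForm]; rfl
    have vr : ∀ q, X (e none, Sum.inr q) = ![0, 0, arcs (restrict e X true) r 3 1] q := fun q => by
      rw [congrFun hX, extend_inr, form_rootForm]; rfl
    have l0 := vl 0
    have l1 := vl 1
    have l2 := vl 2
    have l3 := vl 3
    have r0 := vr 0
    have r1 := vr 1
    have r2 := vr 2
    simp only [Matrix.cons_val] at l0 l1 l2 l3 r0 r1 r2
    rw [l0, l1, l2, l3, r0, r1, r2]
    simp only [add_zero, zero_add, and_true]
    refine ⟨?_, ⟨hB, hA⟩, f0.symm, f2.symm, f1.symm⟩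
    have hpos : ∀ a : Fin 3, 0 ≤ arcs (restrict e X true) r 3 a.castSucc := fun a => by
      rw [← form_rootForm]
      exact Finset.sum_nonneg fun c _ => mul_nonneg (by exact_mod_cast rootForm_nonneg r a c)
        (hnA c)
    rintro ⟨i, d⟩
    obtain ⟨_ | ⟨_ | _, i⟩, rfl⟩ := e.surjective i
    · obtain a | q := d
      · match a with
        | 0 => rw [l0]; exact hpos 0
        | 1 => rw [l1]
        | 2 => rw [l2]
        | 3 => rw [l3]; exact hpos 2
      · match q with
        | 0 => rw [r0]
        | 1 => rw [r1]
        | 2 => rw [r2]; exact hpos 1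
    · exact hnB (i, d)
    · exact hnA (i, d)

theorem extend_mem_cone (h : IsStdDoubling M r N e) {x y : M.Piece → ℝ}
    (hx : x ∈ cone M.equations) (hy : y ∈ cone M.equations) (hf : Fits (rootForm r) x y) :
    extend r e x y ∈ cone N.equations ∧ arcs (extend r e x y) (e none) 3 1 = 0 ∧
      arcs (extend r e x y) (e none) 3 2 = 0 := by
  refine h.mem_cone_iff.2 ?_
  rw [restrict_extend_true, restrict_extend_false]
  exact ⟨hx, hy, hf, rfl⟩

/-- A vector below the extension vanishes on the same pieces of the new tetrahedron, so it has no
arcs around 1 and 2 in the marked face either and is again an extension. -/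
theorem isRay_extend_iff (h : IsStdDoubling M r N e) {x y : M.Piece → ℝ}
    (hx : x ∈ cone M.equations) (hy : y ∈ cone M.equations) (hf : Fits (rootForm r) x y) :
    IsRay (cone N.equations) (extend r e x y) ↔ IsPairRay M.equations (rootForm r) x y := by
  have hX := h.extend_mem_cone hx hy hf
  constructor
  · intro hr
    refine ⟨hx, hy, hf, ?_, ?_⟩
    · rw [← not_and_or, ← extend_eq_zero (r := r) (e := e)]
      exact hr.2.1
    · intro x' hx' y' hy' hf' hs hs'
      obtain ⟨t, ht⟩ := hr.2.2 _ (h.extend_mem_cone hx' hy' hf').1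
        (support_extend_subset hx.1 hs hs')
      rw [← extend_smul] at ht
      refine ⟨t, ?_, ?_⟩
      · simpa only [restrict_extend_true] using congrArg (fun X => restrict e X true) ht
      · simpa only [restrict_extend_false] using congrArg (fun X => restrict e X false) ht
  · intro hr
    refine ⟨hX.1, ?_, fun X' hX' hs => ?_⟩
    · rw [Ne, extend_eq_zero, not_and_or]
      exact hr.2.2.2.1
    · have hz : ∀ d, extend r e x y (e none, d) = 0 → X' (e none, d) = 0 := fun d h0 => by
        by_contra h1
        exact hs h1 h0
      have hz1 : X' (e none, Sum.inl 1) = 0 := hz _ (extend_inl x y 1)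
      have hz2 : X' (e none, Sum.inl 2) = 0 := hz _ (extend_inl x y 2)
      have hz3 : X' (e none, Sum.inr 0) = 0 := hz _ (extend_inr x y 0)
      have hz4 : X' (e none, Sum.inr 1) = 0 := hz _ (extend_inr x y 1)
      obtain ⟨-, a31, a32, -⟩ := arcs_eq (X := X') (i := e none)
      obtain ⟨h1, h2, h3, h4⟩ := h.mem_cone_iff.1 ⟨hX', by rw [a31, hz1, hz4, add_zero],
        by rw [a32, hz2, hz3, add_zero]⟩
      obtain ⟨t, ht, ht'⟩ := hr.2.2.2.2 _ h1 _ h2 h3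
        (fun c hc => by
          have := hs (show (e (some (true, c.1)), c.2) ∈ Function.support X' from hc)
          rwa [Function.mem_support, extend_true] at this)
        (fun c hc => by
          have := hs (show (e (some (false, c.1)), c.2) ∈ Function.support X' from hc)
          rwa [Function.mem_support, extend_false] at this)
      refine ⟨t, ?_⟩
      rw [h4, ht, ht', extend_smul]

/-- The supports of the extremal pairs that are admissible and meet the marked face of the double
only in arcs around vertex `0`. -/
def pairSupports (M : Triangulation) [Fintype M.Tet] [DecidableEq M.Tet] (r : M.Tet) :
    Set (Set M.Piece × Set M.Piece) :=
  {q | M.QuadSet q.1 ∧ M.QuadSet q.2 ∧ ∃ x y, IsPairRay M.equations (rootForm r) x y ∧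
    Function.support x = q.1 ∧ Function.support y = q.2 ∧
    0 < form (rootForm r 0) x + form (rootForm r 1) x}

/-- Rays are counted by supports, and the support of a surface in the double is recovered from those
of its two restrictions. -/
theorem alpha_eq (h : IsStdDoubling M r N e) :
    N.alpha (e none, 3) 0 = (pairSupports M r).ncard := by
  rw [alpha_eq_ncard_alphaSupports]
  have hker : ∀ X : N.Piece → ℝ, (∀ b, b ≠ (3 : Fin 4) → b ≠ 0 → arcs X (e none) 3 b = 0) ↔
      arcs X (e none) 3 1 = 0 ∧ arcs X (e none) 3 2 = 0 := fun X => by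
    simp [Fin.forall_fin_succ]
  have hmem : ∀ S, S ∈ alphaSupports (T := N) (e none, 3) 0 ↔ N.QuadSet S ∧
      ∃ x y, IsPairRay M.equations (rootForm r) x y ∧ Function.support (extend r e x y) = S ∧
        0 < form (rootForm r 0) x + form (rootForm r 1) x := by
    refine fun S => and_congr_right fun _ => ⟨?_, ?_⟩
    · rintro ⟨X, hX, rfl, hpos, h0⟩
      obtain ⟨h1, h2, h3, h4⟩ := h.mem_cone_iff.1 ⟨hX.1, (hker X).1 h0⟩
      rw [h4] at hX hpos
      refine ⟨_, _, (h.isRay_extend_iff h1 h2 h3).1 hX, congrArg Function.support h4.symm, ?_⟩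
      rwa [arcs_extend] at hpos
    · rintro ⟨x, y, hxy, rfl, hpos⟩
      refine ⟨_, (h.isRay_extend_iff hxy.1 hxy.2.1 hxy.2.2.1).2 hxy, rfl, ?_,
        (hker _).2 (h.extend_mem_cone hxy.1 hxy.2.1 hxy.2.2.1).2⟩
      rwa [arcs_extend]
  let g : Set N.Piece → Set M.Piece × Set M.Piece := fun S =>
    ({c | (e (some (true, c.1)), c.2) ∈ S}, {c | (e (some (false, c.1)), c.2) ∈ S})
  have hg : ∀ x y, g (Function.support (extend r e x y)) =
      (Function.support x, Function.support y) := fun x y => by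
    refine Prod.ext (Set.ext fun c => ?_) (Set.ext fun c => ?_)
    · exact not_congr (Eq.congr_left (extend_true x y _ _))
    · exact not_congr (Eq.congr_left (extend_false x y _ _))
  have hinj : Set.InjOn g (alphaSupports (T := N) (e none, 3) 0) := by
    intro S hS S' hS' heq
    obtain ⟨-, x, y, hxy, rfl, -⟩ := (hmem S).1 hS
    obtain ⟨-, x', y', hxy', rfl, -⟩ := (hmem S').1 hS'
    rw [hg, hg, Prod.mk.injEq] at heq
    exact (support_extend_subset hxy'.1.1 heq.1.le heq.2.le).antisymm
      (support_extend_subset hxy.1.1 heq.1.ge heq.2.ge)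
  rw [← hinj.ncard_image]
  congr 1
  ext ⟨A, B⟩
  constructor
  · rintro ⟨S, hS, hSg⟩
    obtain ⟨hq, x, y, hxy, rfl, hpos⟩ := (hmem S).1 hS
    have h1 := congrArg Prod.fst hSg
    have h2 := congrArg Prod.snd hSg
    subst h1
    subst h2
    refine ⟨fun i q q' a b => hq _ q q' a b, fun i q q' a b => hq _ q q' a b, x, y, hxy, ?_, ?_,
      hpos⟩
    · exact congrArg Prod.fst (hg x y).symm
    · exact congrArg Prod.snd (hg x y).symm
  · rintro ⟨hA, hB, x, y, hxy, rfl, rfl, hpos⟩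
    refine ⟨Function.support (extend r e x y), (hmem _).2 ⟨?_, x, y, hxy, rfl, hpos⟩, hg x y⟩
    intro i q q' hq hq'
    rw [Function.mem_support] at hq hq'
    obtain ⟨_ | ⟨_ | _, i⟩, rfl⟩ := e.surjective i
    · rw [extend_inr] at hq hq'
      -- The new tetrahedron can contain quadrilaterals of type 2 only, so it adds no constraint.
      have : ∀ q : Fin 3, ![0, 0, form (rootForm r 1) x] q ≠ 0 → q = 2 := fun q => by
        match q with
        | 0 => exact fun h => absurd rfl h
        | 1 => exact fun h => absurd rfl h
        | 2 => exact fun _ => rfl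
      rw [this q hq, this q' hq']
    · rw [extend_false] at hq hq'
      exact hB i q q' hq hq'
    · rw [extend_true] at hq hq'
      exact hA i q q' hq hq'

/-- Boundary values (a,0,0) and (b,0,0) fit after multiplying each vector with the number of arcs of
the other, and the exchange of the last two values is harmless. A smaller fitting pair consists of
multiples of both rays, with factors linked by the first boundary value. -/
theorem sq_alpha_le (h : IsStdDoubling M r N e) :
    M.alpha (r, 3) 0 ^ 2 ≤ N.alpha (e none, 3) 0 := by
  rw [h.alpha_eq, alpha_eq_ncard_alphaSupports, sq, ← Set.ncard_prod]
  refine Set.ncard_le_ncard ?_ (Set.toFinite _)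
  rintro ⟨S, S'⟩ ⟨⟨hS, x, hx, hxS, hxpos, hx0⟩, hS', y, hy, hyS, hypos, hy0⟩
  simp only at hxS hyS hxpos hypos
  have f0 : ∀ z : M.Piece → ℝ, form (rootForm r 0) z = arcs z r 3 0 := fun z => form_rootForm z 0
  have f1 : ∀ z : M.Piece → ℝ, (∀ b, b ≠ (3 : Fin 4) → b ≠ 0 → arcs z r 3 b = 0) →
      form (rootForm r 1) z = 0 ∧ form (rootForm r 2) z = 0 := fun z hz => by
    rw [form_rootForm, form_rootForm]
    exact ⟨hz _ (by decide) (by decide), hz _ (by decide) (by decide)⟩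
  have hxs := support_smul hypos.ne' x
  have hys := support_smul hxpos.ne' y
  obtain ⟨x1, x2⟩ := f1 x hx0
  obtain ⟨y1, y2⟩ := f1 y hy0
  refine ⟨hS, hS', arcs y r 3 0 • x, arcs x r 3 0 • y, ⟨smul_mem_cone hypos.le hx.1,
    smul_mem_cone hxpos.le hy.1, ?_, Or.inl (smul_ne_zero hypos.ne' hx.2.1), ?_⟩,
    hxs.trans hxS, hys.trans hyS, ?_⟩
  · intro i
    rw [form_smul, form_smul]
    match i with
    | 0 => exact (congrArg _ (f0 x)).trans ((mul_comm _ _).trans (congrArg _ (f0 y)).symm)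
    | 1 =>
      change _ = _ * form (rootForm r 2) y
      rw [x1, y2, mul_zero, mul_zero]
    | 2 =>
      change _ = _ * form (rootForm r 1) y
      rw [x2, y1, mul_zero, mul_zero]
  · intro x' hx' y' hy' hf hs hs'
    rw [hxs] at hs
    rw [hys] at hs'
    obtain ⟨s, rfl⟩ := hx.2.2 x' hx' hs
    obtain ⟨t, rfl⟩ := hy.2.2 y' hy' hs'
    have := hf 0
    change form (rootForm r 0) _ = form (rootForm r 0) _ at this
    rw [form_smul, form_smul, f0, f0] at this
    refine ⟨s / arcs y r 3 0, ?_, ?_⟩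
    · rw [smul_smul, div_mul_cancel₀ _ hypos.ne']
    · rw [smul_smul]
      congr 1
      field_simp
      linarith
  · rw [form_smul, form_smul, x1, mul_zero, add_zero, f0]
    exact mul_pos hypos hxpos

end IsStdDoubling

/-! ### The number of vertex normal surfaces of the explicit triangulation -/

open PolyCone RayEnum

/-- If all gluings respect linear orders on the vertices of the tetrahedra, then no edge is
identified with itself in reverse. -/
theorem not_eqvGen_reverse_of_rank {ι : Type} {g : Gluing ι} {rank : ι → Fin 4 → ℕ}
    (hinj : ∀ i, Function.Injective (rank i))
    (hstep : ∀ i f j p, g i f = some (j, p) → ∀ a b, a ≠ f → b ≠ f → rank i a < rank i b →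
      rank j (p a) < rank j (p b)) (i : ι) (a b : Fin 4) (hab : a ≠ b) :
    ¬ Relation.EqvGen (EdgeStep g) (i, a, b) (i, b, a) := by
  have key : ∀ {s t}, Relation.EqvGen (EdgeStep g) s t →
      (rank s.1 s.2.1 < rank s.1 s.2.2 ↔ rank t.1 t.2.1 < rank t.1 t.2.2) := by
    intro s t h
    induction h with
    | rel _ _ h =>
      obtain ⟨i, j, f, a, b, p, hg, ha, hb⟩ := h
      refine ⟨hstep i f j p hg a b ha hb, fun h => ?_⟩
      rcases lt_trichotomy (rank i a) (rank i b) with h1 | h1 | h1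
      · exact h1
      · rw [hinj i h1] at h
        exact absurd h (lt_irrefl _)
      · exact absurd h (hstep i f j p hg b a hb ha h1).not_gt
    | refl => rfl
    | symm _ _ _ ih => exact ih.symm
    | trans _ _ _ _ _ ih₁ ih₂ => exact ih₁.trans ih₂
  intro h
  have := key h
  simp only at this
  rcases lt_trichotomy (rank i a) (rank i b) with h1 | h1 | h1
  · exact absurd h1 (this.1 h1).not_gt
  · exact hab (hinj i h1)
  · exact absurd h1 (this.2 h1).not_gt

namespace TriH

def rank : Fin 5 → Fin 4 → ℕ :=
  ![![0, 3, 1, 2], ![0, 3, 1, 2], ![0, 2, 1, 3], ![0, 3, 1, 2], ![0, 2, 1, 3]]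

theorem rank_injective : ∀ i, Function.Injective (rank i) := by decide +kernel

theorem rank_step : ∀ (i : Fin 5) (f : Fin 4), ∀ jp ∈ glue i f, ∀ a b, a ≠ f → b ≠ f →
    rank i a < rank i b → rank jp.1 (jp.2 a) < rank jp.1 (jp.2 b) := by
  decide +kernel

theorem glue_symm : ∀ (i : Fin 5) (f : Fin 4), ∀ jp ∈ glue i f,
    glue jp.1 (jp.2 f) = some (i, jp.2⁻¹) := by
  decide +kernel

theorem glue_ne_self : ∀ (i : Fin 5) (f : Fin 4), ∀ jp ∈ glue i f, (jp.1, jp.2 f) ≠ (i, f) := by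
  decide +kernel

end TriH

/-- The explicit triangulation with 5 tetrahedra whose double is `triG`. -/
def triH : Triangulation where
  Tet := Fin 5
  finite := inferInstance
  glue := TriH.glue
  glue_symm i f j p h := TriH.glue_symm i f (j, p) h
  glue_ne_self i f j p h := TriH.glue_ne_self i f (j, p) h
  edge_not_reversed := not_eqvGen_reverse_of_rank TriH.rank_injective
    fun i f j p h => TriH.rank_step i f (j, p) h

/-! ### The explicit triangulation with 11 tetrahedra as a double -/

namespace TriH

instance : Fintype triH.Tet := inferInstanceAs (Fintype (Fin 5))

instance : DecidableEq triH.Tet := inferInstanceAs (DecidableEq (Fin 5))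

instance : Fintype triG.Tet := inferInstanceAs (Fintype (Fin 11))

instance : DecidableEq triG.Tet := inferInstanceAs (DecidableEq (Fin 11))

/-- The tetrahedra of `triG` as those of the double of `triH`. -/
def tetMap : Option (Bool × Fin 5) → Fin 11
  | none => 0
  | some (true, i) => ![1, 3, 7, 4, 8] i
  | some (false, i) => ![2, 5, 9, 6, 10] i

theorem tetMap_bijective : Function.Bijective tetMap := by decide +kernel

noncomputable def tetEquiv : Option (Bool × triH.Tet) ≃ triG.Tet :=
  Equiv.ofBijective tetMap tetMap_bijective

theorem glue_copy : ∀ (b : Bool) (i : Fin 5) (f : Fin 4), (i, f) ≠ (0, 3) →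
    TriG.glue (tetMap (some (b, i))) f =
      (glue i f).map fun jq => (tetMap (some (b, jq.1)), jq.2) := by
  decide +kernel

theorem glue_root : ∀ b : Bool, TriG.glue (tetMap (some (b, 0))) 3 =
    some (tetMap none, attach b) := by
  decide +kernel

theorem glue_free : ∀ f : Fin 4, (∀ b, f ≠ attach b 3) → TriG.glue (tetMap none) f = none := by
  decide +kernel

theorem isStdDoubling : IsStdDoubling triH (0 : Fin 5) triG tetEquiv where
  boundary := rfl
  copy := glue_copy
  root := glue_root
  free := glue_free

theorem exists_of_mem_matchingForms {ι : Type} [DecidableEq ι] {g : Gluing ι} {i : ι} {f : Fin 4}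
    {φ : ι × (Fin 4 ⊕ Fin 3) → ℤ} : φ ∈ matchingForms g i f ↔ ∃ j p a,
      g i f = some (j, p) ∧ a ≠ f ∧ φ = arcForm i f a - arcForm j (p f) (p a) := by
  rw [matchingForms]
  cases hg : g i f with
  | none => simp
  | some jp =>
    have hall : ∀ a : Fin 4, a ∈ [0, 1, 2, 3] := by decide
    simp only [List.mem_map, List.mem_filter, decide_eq_true_eq, Option.some.injEq]
    constructor
    · rintro ⟨a, ⟨-, ha⟩, rfl⟩
      exact ⟨jp.1, jp.2, a, rfl, ha, rfl⟩
    · rintro ⟨j, p, a, rfl, ha, rfl⟩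
      exact ⟨a, ⟨hall a, ha⟩, rfl⟩

/-- The computed equations list each of the six gluings from one side only; the other side gives the
same equations. -/
theorem glue_cases : ∀ (i : Fin 5) (f : Fin 4), ∀ jp ∈ glue i f,
    (i, f) ∈ [((0 : Fin 5), (2 : Fin 4)), (0, 1), (1, 2), (1, 1), (3, 2), (3, 1)] ∨
    (jp.1, jp.2 f) ∈ [((0 : Fin 5), (2 : Fin 4)), (0, 1), (1, 2), (1, 1), (3, 2), (3, 1)] := by
  decide +kernel

theorem mem_equations {φ : Piece → ℤ} : φ ∈ equations ↔
    ∃ c ∈ [((0 : Fin 5), (2 : Fin 4)), (0, 1), (1, 2), (1, 1), (3, 2), (3, 1)],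
      φ ∈ matchingForms glue c.1 c.2 := by
  simp only [equations, innerForms, outerForms, Set.mem_union, Set.mem_ofPred_eq, List.mem_append,
    List.mem_cons, List.not_mem_nil, or_false, exists_eq_or_imp, exists_eq_left, or_assoc]

theorem cone_equations : cone triH.equations = cone equations := by
  ext x
  constructor
  · refine fun hx => ⟨hx.1, fun φ hφ => ?_⟩
    obtain ⟨c, -, hc⟩ := mem_equations.1 hφ
    obtain ⟨j, p, a, h⟩ := exists_of_mem_matchingForms.1 hc
    exact hx.2 φ ⟨c.1, c.2, j, p, a, h⟩
  · rintro ⟨hnn, hx⟩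
    refine Triangulation.mem_cone_equations.2 ⟨hnn, ?_⟩
    have key : ∀ (i : Fin 5) (f : Fin 4) (j : Fin 5) (p : Equiv.Perm (Fin 4)),
        (i, f) ∈ [((0 : Fin 5), (2 : Fin 4)), (0, 1), (1, 2), (1, 1), (3, 2), (3, 1)] →
        glue i f = some (j, p) → ∀ a, a ≠ f → Triangulation.arcs (T := triH) x i f a =
          Triangulation.arcs (T := triH) x j (p f) (p a) := by
      intro i f j p hm hg a ha
      have := sub_eq_zero.1 ((Triangulation.form_sub_left (arcForm i f a)
        (arcForm j (p f) (p a)) x).symm.trans (hx _ (mem_equations.2 ⟨(i, f), hm,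
        exists_of_mem_matchingForms.2 ⟨j, p, a, hg, ha, rfl⟩⟩)))
      exact (Triangulation.form_arcForm (T := triH) x i f a).symm.trans
        (this.trans (Triangulation.form_arcForm (T := triH) x j (p f) (p a)))
    intro i f j p hg a ha
    rcases glue_cases i f (j, p) hg with h | h
    · exact key i f j p h hg a ha
    · have := key j (p f) i p⁻¹ h (glue_symm i f (j, p) hg) (p a) (p.injective.ne ha)
      rw [show p⁻¹ (p f) = f from p.symm_apply_apply f,
        show p⁻¹ (p a) = a from p.symm_apply_apply a] at this
      exact this.symm

theorem isPairRay_iff {x y : Piece → ℝ} :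
    IsPairRay triH.equations (rootForm (0 : Fin 5)) x y ↔
      IsPairRay equations boundaryForm x y := by
  unfold IsPairRay
  rw [cone_equations]
  rfl

/-- Transfers the count of masks to supports; masks determine supports because positions of pieces
are distinct. -/
theorem ncard_pairSupports : (IsStdDoubling.pairSupports triH (0 : Fin 5)).ncard = 31643 := by
  rw [← ncard_pairMasks_equations]
  choose mask hmask using fun S : Set Piece => exists_isMask bit S
  have hinj : Function.Injective mask := fun S S' h =>
    (hmask S).set_unique bit_injective (h ▸ hmask S')
  have hadm : ∀ S, adm (mask S) = true ↔ triH.QuadSet S := fun S => by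
    rw [adm_iff]
    simp only [(hmask S).mem bit_injective]
    rfl
  refine (Set.ncard_image_of_injective _ (hinj.prodMap hinj)).symm.trans (congrArg Set.ncard ?_)
  ext ⟨m, m'⟩
  constructor
  · rintro ⟨⟨S, S'⟩, ⟨hS, hS', x, y, hxy, rfl, rfl, hpos⟩, heq⟩
    obtain ⟨rfl, rfl⟩ := Prod.mk.inj heq
    exact ⟨(hadm _).2 hS, (hadm _).2 hS', x, y, isPairRay_iff.1 hxy, hmask _, hmask _, hpos⟩
  · rintro ⟨ha, ha', x, y, hxy, hm, hm', hpos⟩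
    have h1 := (hmask (Function.support x)).unique hm
    have h2 := (hmask (Function.support y)).unique hm'
    simp only at h1 h2 ha ha'
    rw [← h1, hadm] at ha
    rw [← h2, hadm] at ha'
    exact ⟨(Function.support x, Function.support y), ⟨ha, ha', x, y, isPairRay_iff.2 hxy, rfl, rfl,
      hpos⟩, Prod.ext h1 h2⟩

theorem alpha_triG : triG.alpha triGFace 0 = 31643 :=
  isStdDoubling.alpha_eq.trans ncard_pairSupports

end TriH

/-! ### Vertex links from representatives of the identified corners, edges and arcs -/

open Relation

/-- Representatives of the vertices, and of the oriented edges and normal arcs with two different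
indices. -/
structure LinkReps {ι : Type} (g : Gluing ι) where
  vertex : ι × Fin 4 → ι × Fin 4
  edge : ι × Fin 4 × Fin 4 → ι × Fin 4 × Fin 4
  arc : ι × Fin 4 × Fin 4 → ι × Fin 4 × Fin 4
  vertex_step : ∀ {s t}, VertexStep g s t → vertex s = vertex t
  vertex_eqv : ∀ s, EqvGen (VertexStep g) s (vertex s)
  edge_step : ∀ {s t}, EdgeStep g s t → s.2.2 ≠ s.2.1 → edge s = edge t
  edge_eqv : ∀ s, s.2.2 ≠ s.2.1 → EqvGen (EdgeStep g) s (edge s)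
  arc_step : ∀ {s t}, ArcStep g s t → s.2.2 ≠ s.2.1 → arc s = arc t
  arc_eqv : ∀ s, s.2.2 ≠ s.2.1 → EqvGen (ArcStep g) s (arc s)

/-- A map that is constant along steps between members of `D` is constant on classes. -/
theorem rep_eq_of_eqvGen {α : Type} {step : α → α → Prop} {D : α → Prop} {rep : α → α}
    (hD : ∀ s t, step s t → (D s ↔ D t)) (hrep : ∀ s t, step s t → D s → rep s = rep t)
    {s t : α} (h : EqvGen step s t) : (D s ↔ D t) ∧ (D s → rep s = rep t) := by
  induction h with
  | rel s t h => exact ⟨hD s t h, hrep s t h⟩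
  | refl s => exact ⟨Iff.rfl, fun _ => rfl⟩
  | symm s t _ ih => exact ⟨ih.1.symm, fun h => (ih.2 (ih.1.2 h)).symm⟩
  | trans s t u _ _ ih₁ ih₂ =>
    exact ⟨ih₁.1.trans ih₂.1, fun h => (ih₁.2 h).trans (ih₂.2 (ih₁.1.1 h))⟩

/-- Classes correspond to fixed points of the choice of representatives. -/
theorem ncard_image_mk_eq {α : Type} {step : α → α → Prop} {D : α → Prop} {rep : α → α}
    (hD : ∀ s t, step s t → (D s ↔ D t)) (hrep : ∀ s t, step s t → D s → rep s = rep t)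
    (heqv : ∀ s, D s → EqvGen step s (rep s)) :
    (Quotient.mk (EqvGen.setoid step) '' {s | D s}).ncard = {s | D s ∧ rep s = s}.ncard := by
  have hinj : Set.InjOn (Quotient.mk (EqvGen.setoid step)) {s | D s ∧ rep s = s} := by
    intro s hs t ht h
    have := (rep_eq_of_eqvGen hD hrep (Quotient.exact h)).2 hs.1
    rwa [hs.2, ht.2] at this
  rw [← hinj.ncard_image]
  congr 1
  ext q
  constructor
  · rintro ⟨s, hs, rfl⟩
    have := rep_eq_of_eqvGen hD hrep (heqv s hs)
    exact ⟨rep s, ⟨this.1.1 hs, (this.2 hs).symm⟩, (Quotient.sound (heqv s hs)).symm⟩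
  · rintro ⟨s, hs, rfl⟩
    exact ⟨s, hs.1, rfl⟩

namespace LinkReps

section

variable {ι : Type} {g : Gluing ι} [DecidableEq ι] (R : LinkReps g)

/-- The contribution of a corner to the Euler characteristic of the link that contains it. -/
def weight (c : ι × Fin 4) : ℤ := 1 + ∑ b, if b ≠ c.2 then
  (if R.edge (c.1, c.2, b) = (c.1, c.2, b) then 1 else 0) -
    (if R.arc (c.1, c.2, b) = (c.1, c.2, b) then 1 else 0) else 0

def euler [Fintype ι] (v : ι × Fin 4) : ℤ := ∑ c, if R.vertex c = v then R.weight c else 0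

end

variable {T : Triangulation} (R : LinkReps T.glue)

theorem sameVertex_iff {v c : T.Tet × Fin 4} : T.SameVertex v c ↔ R.vertex v = R.vertex c := by
  constructor
  · intro h
    exact (rep_eq_of_eqvGen (D := fun _ => True) (fun _ _ _ => Iff.rfl)
      (fun _ _ h _ => R.vertex_step h)
      h).2 trivial
  · intro h
    have h1 := R.vertex_eqv v
    rw [h] at h1
    exact h1.trans _ _ _ ((R.vertex_eqv c).symm _ _)

theorem mem_linkFlags {v : T.Tet × Fin 4} {s : T.Tet × Fin 4 × Fin 4} : s ∈ T.linkFlags v ↔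
    R.vertex (s.1, s.2.1) = R.vertex v ∧ s.2.2 ≠ s.2.1 :=
  and_congr_left fun _ => R.sameVertex_iff.trans eq_comm

theorem vertexStep_linkTriangles {v s t : T.Tet × Fin 4} (h : VertexStep T.glue s t) :
    s ∈ T.linkTriangles v ↔ t ∈ T.linkTriangles v :=
  ⟨fun hs => hs.trans _ _ _ (.rel _ _ h), fun ht => ht.trans _ _ _ (.symm _ _ (.rel _ _ h))⟩

theorem edgeStep_linkFlags {v : T.Tet × Fin 4} {s t : T.Tet × Fin 4 × Fin 4}
    (h : EdgeStep T.glue s t) : s ∈ T.linkFlags v ↔ t ∈ T.linkFlags v := by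
  obtain ⟨i, j, f, a, b, p, hg, ha, hb⟩ := h
  exact and_congr (vertexStep_linkTriangles (.mk i j f a p hg ha)) p.injective.ne_iff.symm

theorem arcStep_linkFlags {v : T.Tet × Fin 4} {s t : T.Tet × Fin 4 × Fin 4}
    (h : ArcStep T.glue s t) : s ∈ T.linkFlags v ↔ t ∈ T.linkFlags v := by
  obtain ⟨i, j, f, a, p, hg, ha⟩ := h
  exact and_congr (vertexStep_linkTriangles (.mk i j f a p hg ha)) p.injective.ne_iff.symm

theorem ncard_setOf {α : Type} [Fintype α] (P : α → Prop) [DecidablePred P] :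
    ({s | P s}.ncard : ℤ) = ∑ s, if P s then 1 else 0 := by
  rw [Set.ncard_eq_toFinset_card', Set.toFinset_ofPred, Finset.card_filter]
  push_cast
  rfl

/-- Every class of edge ends or of arcs in the link has exactly one fixed representative, so
vertices, sides and triangles can be counted corner by corner. -/
theorem linkEulerChar_eq [Fintype T.Tet] [DecidableEq T.Tet] (v : T.Tet × Fin 4) :
    T.linkEulerChar v = R.euler (R.vertex v) := by
  have hV : (T.linkVertices v).ncard = {s | s ∈ T.linkFlags v ∧ R.edge s = s}.ncard :=
    ncard_image_mk_eq (D := fun s => s ∈ T.linkFlags v) (fun _ _ => edgeStep_linkFlags)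
      (fun _ _ h hs => R.edge_step h hs.2) fun s hs => R.edge_eqv s hs.2
  have hE : (T.linkEdges v).ncard = {s | s ∈ T.linkFlags v ∧ R.arc s = s}.ncard :=
    ncard_image_mk_eq (D := fun s => s ∈ T.linkFlags v) (fun _ _ => arcStep_linkFlags)
      (fun _ _ h hs => R.arc_step h hs.2) fun s hs => R.arc_eqv s hs.2
  have hT : T.linkTriangles v = {c | R.vertex c = R.vertex v} := by
    ext c
    exact R.sameVertex_iff.trans eq_comm
  rw [Triangulation.linkEulerChar, hV, hE, hT]
  simp only [R.mem_linkFlags]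
  rw [ncard_setOf, ncard_setOf, ncard_setOf, euler]
  simp only [Fintype.sum_prod_type]
  rw [← Finset.sum_sub_distrib, ← Finset.sum_add_distrib]
  refine Finset.sum_congr rfl fun i _ => ?_
  rw [← Finset.sum_sub_distrib, ← Finset.sum_add_distrib]
  refine Finset.sum_congr rfl fun a _ => ?_
  rw [← Finset.sum_sub_distrib]
  by_cases h : R.vertex (i, a) = R.vertex v
  · simp only [h, true_and, if_true, weight]
    rw [add_comm]
    congr 1
    refine Finset.sum_congr rfl fun b _ => ?_
    by_cases hb : b = a <;> simp [hb]
  · simp [h]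

end LinkReps

/-! ### Doubling a triangulation -/

open Relation

section

variable {ι : Type} [DecidableEq ι] (g : Gluing ι) (r : ι)

/-- The gluings of two copies of `g` and a new tetrahedron. -/
def doubleGlue : Gluing (Option (Bool × ι))
  | none, f => if f = 2 then some (some (true, r), (attach true)⁻¹) else
      if f = 1 then some (some (false, r), (attach false)⁻¹) else none
  | some (b, i), f => if i = r ∧ f = 3 then some (none, attach b) else
      (g i f).map fun jq => (some (b, jq.1), jq.2)

variable {g r}

theorem doubleGlue_none (b : Bool) :
    doubleGlue g r none (attach b 3) = some (some (b, r), (attach b)⁻¹) := by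
  cases b <;> rfl

theorem doubleGlue_root (b : Bool) : doubleGlue g r (some (b, r)) 3 = some (none, attach b) := by
  simp [doubleGlue]

theorem doubleGlue_copy (h3 : g r 3 = none) (b : Bool) {i j : ι} {f : Fin 4}
    {p : Equiv.Perm (Fin 4)} (h : g i f = some (j, p)) :
    doubleGlue g r (some (b, i)) f = some (some (b, j), p) := by
  have : ¬ (i = r ∧ f = 3) := by
    rintro ⟨rfl, rfl⟩
    rw [h3] at h
    cases h
  simp [doubleGlue, this, h]

theorem doubleGlue_cases {i j : Option (Bool × ι)} {f : Fin 4} {p : Equiv.Perm (Fin 4)}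
    (h : doubleGlue g r i f = some (j, p)) :
    (∃ b i' j', i = some (b, i') ∧ j = some (b, j') ∧ g i' f = some (j', p)) ∨
    (∃ b, i = some (b, r) ∧ f = 3 ∧ j = none ∧ p = attach b) ∨
    ∃ b, i = none ∧ f = attach b 3 ∧ j = some (b, r) ∧ p = (attach b)⁻¹ := by
  obtain _ | ⟨b, i⟩ := i
  · right; right
    by_cases h2 : f = 2
    · subst h2
      rw [show (2 : Fin 4) = attach true 3 from rfl, doubleGlue_none, Option.some.injEq,
        Prod.mk.injEq] at h
      exact ⟨true, rfl, rfl, h.1.symm, h.2.symm⟩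
    · by_cases h1 : f = 1
      · subst h1
        rw [show (1 : Fin 4) = attach false 3 from rfl, doubleGlue_none, Option.some.injEq,
          Prod.mk.injEq] at h
        exact ⟨false, rfl, rfl, h.1.symm, h.2.symm⟩
      · simp [doubleGlue, h1, h2] at h
  · by_cases hr : i = r ∧ f = 3
    · obtain ⟨rfl, rfl⟩ := hr
      rw [doubleGlue_root, Option.some.injEq, Prod.mk.injEq] at h
      exact Or.inr (Or.inl ⟨b, rfl, rfl, h.1.symm, h.2.symm⟩)
    · simp only [doubleGlue, hr, if_false, Option.map_eq_some_iff] at h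
      obtain ⟨⟨j', p'⟩, hg, heq⟩ := h
      rw [Prod.mk.injEq] at heq
      obtain ⟨rfl, rfl⟩ := heq
      exact Or.inl ⟨b, i, j', rfl, rfl, hg⟩

theorem doubleGlue_symm (h3 : g r 3 = none)
    (hs : ∀ i f j p, g i f = some (j, p) → g j (p f) = some (i, p⁻¹))
    (i f j p) (h : doubleGlue g r i f = some (j, p)) :
    doubleGlue g r j (p f) = some (i, p⁻¹) := by
  rcases doubleGlue_cases h with ⟨b, i, j, rfl, rfl, hg⟩ | ⟨b, rfl, rfl, rfl, rfl⟩ |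
    ⟨b, rfl, rfl, rfl, rfl⟩
  · exact doubleGlue_copy h3 b (hs i f j p hg)
  · exact doubleGlue_none b
  · rw [show (attach b)⁻¹ (attach b 3) = 3 from (attach b).symm_apply_apply 3, inv_inv]
    exact doubleGlue_root b

theorem doubleGlue_ne_self (hs : ∀ i f j p, g i f = some (j, p) → (j, p f) ≠ (i, f))
    (i f j p) (h : doubleGlue g r i f = some (j, p)) : (j, p f) ≠ (i, f) := by
  rcases doubleGlue_cases h with ⟨b, i, j, rfl, rfl, hg⟩ | ⟨b, rfl, rfl, rfl, rfl⟩ |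
    ⟨b, rfl, rfl, rfl, rfl⟩
  · have := hs i f j p hg
    intro heq
    apply this
    simp only [Prod.mk.injEq, Option.some.injEq, true_and] at heq
    rw [heq.1, heq.2]
  · simp
  · simp

/-- Orders on the vertices of the tetrahedra which the gluings respect. -/
structure IsRank (g : Gluing ι) (rank : ι → Fin 4 → ℕ) : Prop where
  injective : ∀ i, Function.Injective (rank i)
  step : ∀ i f j p, g i f = some (j, p) → ∀ a b, a ≠ f → b ≠ f → rank i a < rank i b →
    rank j (p a) < rank j (p b)

/-- The order 0 < 2 < 3 < 1. Both maps `attach b` preserve it on the vertices 0, 1, 2, so the new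
tetrahedron of a double can carry the same order as the old root. -/
def rootRank : Fin 4 → ℕ := ![0, 3, 1, 2]

def doubleRank (rank : ι → Fin 4 → ℕ) : Option (Bool × ι) → Fin 4 → ℕ
  | none => rootRank
  | some (_, i) => rank i

theorem rootRank_attach : ∀ (b : Bool) (a a' : Fin 4), a ≠ 3 → a' ≠ 3 →
    (rootRank a < rootRank a' ↔ rootRank (attach b a) < rootRank (attach b a')) := by
  decide

theorem IsRank.double {rank : ι → Fin 4 → ℕ} (h : IsRank g rank) (hr : rank r = rootRank) :
    IsRank (doubleGlue g r) (doubleRank rank) where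
  injective i := by
    obtain _ | ⟨b, i⟩ := i
    · change Function.Injective rootRank
      decide
    · exact h.injective i
  step i f j p hg := by
    rcases doubleGlue_cases hg with ⟨b, i, j, rfl, rfl, hg'⟩ | ⟨b, rfl, rfl, rfl, rfl⟩ |
      ⟨b, rfl, rfl, rfl, rfl⟩
    · exact h.step i f j p hg'
    · intro a a' ha ha'
      change rank r a < rank r a' → rootRank _ < rootRank _
      rw [hr]
      exact (rootRank_attach b a a' ha ha').1
    · intro a a' ha ha'
      have key : ∀ a, a ≠ attach b 3 → ∃ c, c ≠ 3 ∧ a = attach b c := fun a ha =>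
        ⟨(attach b).symm a, fun h => ha (by rw [← h, Equiv.apply_symm_apply]),
          (Equiv.apply_symm_apply _ _).symm⟩
      obtain ⟨c, hc, rfl⟩ := key a ha
      obtain ⟨c', hc', rfl⟩ := key a' ha'
      rw [show (attach b)⁻¹ (attach b c) = c from (attach b).symm_apply_apply c,
        show (attach b)⁻¹ (attach b c') = c' from (attach b).symm_apply_apply c']
      change rootRank _ < rootRank _ → rank r c < rank r c'
      rw [hr]
      exact (rootRank_attach b c c' hc hc').2

end

theorem EqvGen.map' {α β : Type} {R : α → α → Prop} {S : β → β → Prop} (f : α → β)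
    (hf : ∀ a b, R a b → S (f a) (f b)) {a b : α} (h : EqvGen R a b) : EqvGen S (f a) (f b) := by
  induction h with
  | rel a b h => exact .rel _ _ (hf a b h)
  | refl a => exact .refl _
  | symm a b _ ih => exact .symm _ _ ih
  | trans a b c _ _ ih₁ ih₂ => exact .trans _ _ _ ih₁ ih₂

section

variable {ι : Type} [DecidableEq ι] {g : Gluing ι} {r : ι}

/-- Representatives that are compatible with doubling at the face opposite vertex `3` of `r`. -/
structure LinkReps.IsRooted (R : LinkReps g) (r : ι) : Prop where
  vertex_zero : R.vertex (r, 0) = (r, 0)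
  vertex_one : R.vertex (r, 1) = (r, 1)
  vertex_two : R.vertex (r, 2) = (r, 0)
  edge : ∀ a b, a ≠ 3 → b ≠ 3 → b ≠ a → R.edge (r, a, b) = (r, a, b)
  arc : ∀ a, a ≠ 3 → R.arc (r, a, 3) = (r, a, 3)

namespace LinkReps

/-- The vertex of the double that contains a representative of a vertex of one of the copies. -/
def copyVertex (r : ι) (b : Bool) (c : ι × Fin 4) : Option (Bool × ι) × Fin 4 :=
  -- Vertex 1 of the root in the second copy is attached to vertex 3 of the new tetrahedron, which
  -- the first copy identifies with vertex 0.
  if c = (r, 0) then (none, 0) else if c = (r, 1) then (if b then (none, 1) else (none, 0)) else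
    (some (b, c.1), c.2)

def copyEdge (r : ι) (b : Bool) (s : ι × Fin 4 × Fin 4) : Option (Bool × ι) × Fin 4 × Fin 4 :=
  if s.1 = r ∧ s.2.1 ≠ 3 ∧ s.2.2 ≠ 3 then (none, attach b s.2.1, attach b s.2.2) else
    (some (b, s.1), s.2)

def copyArc (r : ι) (b : Bool) (s : ι × Fin 4 × Fin 4) : Option (Bool × ι) × Fin 4 × Fin 4 :=
  if s.1 = r ∧ s.2.1 ≠ 3 ∧ s.2.2 = 3 then (none, attach b s.2.1, attach b 3) else
    (some (b, s.1), s.2)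

variable (R : LinkReps g)

def doubleVertex (r : ι) : Option (Bool × ι) × Fin 4 → Option (Bool × ι) × Fin 4
  | (none, a) => if a = 1 then (none, 1) else (none, 0)
  | (some (b, i), a) => copyVertex r b (R.vertex (i, a))

def doubleEdge (r : ι) : Option (Bool × ι) × Fin 4 × Fin 4 → Option (Bool × ι) × Fin 4 × Fin 4
  | (none, s) => (none, s)
  | (some (b, i), s) => copyEdge r b (R.edge (i, s))

def doubleArc (r : ι) : Option (Bool × ι) × Fin 4 × Fin 4 → Option (Bool × ι) × Fin 4 × Fin 4
  | (none, s) => (none, s)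
  | (some (b, i), s) => copyArc r b (R.arc (i, s))

variable {R}

theorem IsRooted.doubleVertex_root (hR : R.IsRooted r) (b : Bool) (a : Fin 4) (ha : a ≠ 3) :
    R.doubleVertex r (some (b, r), a) = R.doubleVertex r (none, attach b a) := by
  have h1 : ∀ b, R.doubleVertex r (some (b, r), 0) = (none, 0) := fun b => by
    simp [doubleVertex, hR.vertex_zero, copyVertex]
  have h2 : ∀ b, R.doubleVertex r (some (b, r), 2) = (none, 0) := fun b => by
    simp [doubleVertex, hR.vertex_two, copyVertex]
  have h3 : ∀ b, R.doubleVertex r (some (b, r), 1) = if b then (none, 1) else (none, 0) :=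
    fun b => by simp [doubleVertex, hR.vertex_one, copyVertex]
  match b, a with
  | true, 0 => exact h1 _
  | false, 0 => exact h1 _
  | true, 1 => exact h3 _
  | false, 1 => exact h3 _
  | true, 2 => exact h2 _
  | false, 2 => exact h2 _
  | _, 3 => exact absurd rfl ha

theorem IsRooted.doubleEdge_root (hR : R.IsRooted r) (b : Bool) (a a' : Fin 4) (ha : a ≠ 3)
    (ha' : a' ≠ 3) (h : a' ≠ a) :
    R.doubleEdge r (some (b, r), a, a') = (none, attach b a, attach b a') := by
  simp [doubleEdge, hR.edge a a' ha ha' h, copyEdge, ha, ha']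

theorem IsRooted.doubleArc_root (hR : R.IsRooted r) (b : Bool) (a : Fin 4) (ha : a ≠ 3) :
    R.doubleArc r (some (b, r), a, 3) = (none, attach b a, attach b 3) := by
  simp [doubleArc, hR.arc a ha, copyArc, ha]

theorem eqvGen_copy_vertex (h3 : g r 3 = none) (b : Bool) {s t : ι × Fin 4}
    (h : EqvGen (VertexStep g) s t) :
    EqvGen (VertexStep (doubleGlue g r)) (some (b, s.1), s.2) (some (b, t.1), t.2) := by
  refine EqvGen.map' (fun s : ι × Fin 4 => ((some (b, s.1) : Option (Bool × ι)), s.2)) ?_ h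
  rintro _ _ ⟨i, j, f, a, p, hg, ha⟩
  exact .mk _ _ f a p (doubleGlue_copy h3 b hg) ha

theorem eqvGen_copy_edge (h3 : g r 3 = none) (b : Bool) {s t : ι × Fin 4 × Fin 4}
    (h : EqvGen (EdgeStep g) s t) :
    EqvGen (EdgeStep (doubleGlue g r)) (some (b, s.1), s.2) (some (b, t.1), t.2) := by
  refine EqvGen.map' (fun s : ι × Fin 4 × Fin 4 => ((some (b, s.1) : Option (Bool × ι)), s.2)) ?_ h
  rintro _ _ ⟨i, j, f, a, a', p, hg, ha, ha'⟩
  exact .mk _ _ f a a' p (doubleGlue_copy h3 b hg) ha ha'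

theorem eqvGen_copy_arc (h3 : g r 3 = none) (b : Bool) {s t : ι × Fin 4 × Fin 4}
    (h : EqvGen (ArcStep g) s t) :
    EqvGen (ArcStep (doubleGlue g r)) (some (b, s.1), s.2) (some (b, t.1), t.2) := by
  refine EqvGen.map' (fun s : ι × Fin 4 × Fin 4 => ((some (b, s.1) : Option (Bool × ι)), s.2)) ?_ h
  rintro _ _ ⟨i, j, f, a, p, hg, ha⟩
  exact .mk _ _ f a p (doubleGlue_copy h3 b hg) ha

theorem eqvGen_root_vertex (b : Bool) {a : Fin 4} (ha : a ≠ 3) :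
    EqvGen (VertexStep (doubleGlue g r)) (some (b, r), a) (none, attach b a) :=
  .rel _ _ (.mk _ _ 3 a _ (doubleGlue_root b) ha)

/-- Vertices 0 and 2 of the root are identified within each copy, so vertices 3 and 2 of the new
tetrahedron are both identified with its vertex 0. -/
theorem IsRooted.eqvGen_none (hR : R.IsRooted r) (h3 : g r 3 = none) (b : Bool) :
    EqvGen (VertexStep (doubleGlue g r)) (none, attach b 2) (none, 0) := by
  have h := R.vertex_eqv (r, 2)
  rw [hR.vertex_two] at h
  have h0 := eqvGen_root_vertex (g := g) (r := r) b (a := 0) (by decide)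
  rw [show attach b 0 = 0 by cases b <;> rfl] at h0
  exact ((eqvGen_root_vertex b (by decide)).symm _ _).trans _ _ _
    ((eqvGen_copy_vertex h3 b h).trans _ _ _ h0)

theorem inv_attach {b : Bool} {a : Fin 4} (ha : a ≠ attach b 3) :
    (attach b)⁻¹ a ≠ 3 ∧ attach b ((attach b)⁻¹ a) = a :=
  ⟨fun h => ha (by rw [← h]; exact ((attach b).apply_symm_apply a).symm),
    (attach b).apply_symm_apply a⟩

/-- The representatives for the double. -/
def double (hR : R.IsRooted r) (h3 : g r 3 = none) : LinkReps (doubleGlue g r) where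
  vertex := R.doubleVertex r
  edge := R.doubleEdge r
  arc := R.doubleArc r
  vertex_step := by
    rintro _ _ ⟨i, j, f, a, p, hg, ha⟩
    rcases doubleGlue_cases hg with ⟨b, i, j, rfl, rfl, hg'⟩ | ⟨b, rfl, rfl, rfl, rfl⟩ |
      ⟨b, rfl, rfl, rfl, rfl⟩
    · exact congrArg (copyVertex r b) (R.vertex_step (.mk i j f a p hg' ha))
    · exact hR.doubleVertex_root b a ha
    · rw [hR.doubleVertex_root b _ (inv_attach ha).1, (inv_attach ha).2]
  vertex_eqv := by
    rintro ⟨_ | ⟨b, i⟩, a⟩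
    · match a with
      | 0 => exact .refl _
      | 1 => exact .refl _
      | 2 => exact hR.eqvGen_none h3 false
      | 3 => exact hR.eqvGen_none h3 true
    · have h := eqvGen_copy_vertex h3 b (R.vertex_eqv (i, a))
      refine h.trans _ _ _ ?_
      change EqvGen _ _ (copyVertex r b (R.vertex (i, a)))
      rw [copyVertex]
      split_ifs with h0 h1 hb
      · rw [h0]
        have := eqvGen_root_vertex (g := g) (r := r) b (a := 0) (by decide)
        rwa [show attach b 0 = 0 by cases b <;> rfl] at this
      · rw [h1, hb]
        exact eqvGen_root_vertex (g := g) (r := r) true (a := 1) (by decide)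
      · rw [h1, Bool.eq_false_iff.2 hb]
        exact (eqvGen_root_vertex (g := g) (r := r) false (a := 1) (by decide)).trans _ _ _
          (hR.eqvGen_none h3 true)
      · exact .refl _
  edge_step := by
    rintro _ _ ⟨i, j, f, a, a', p, hg, ha, ha'⟩ hne
    rcases doubleGlue_cases hg with ⟨b, i, j, rfl, rfl, hg'⟩ | ⟨b, rfl, rfl, rfl, rfl⟩ |
      ⟨b, rfl, rfl, rfl, rfl⟩
    · exact congrArg (copyEdge r b) (R.edge_step (.mk i j f a a' p hg' ha ha') hne)
    · exact hR.doubleEdge_root b a a' ha ha' hne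
    · rw [hR.doubleEdge_root b _ _ (inv_attach ha).1 (inv_attach ha').1
        ((Equiv.injective _).ne hne), (inv_attach ha).2, (inv_attach ha').2]
      rfl
  edge_eqv := by
    rintro ⟨_ | ⟨b, i⟩, s⟩ hne
    · exact .refl _
    · refine (eqvGen_copy_edge h3 b (R.edge_eqv (i, s) hne)).trans _ _ _ ?_
      change EqvGen _ _ (copyEdge r b (R.edge (i, s)))
      rw [copyEdge]
      split_ifs with h
      · rw [h.1]
        exact .rel _ _ (.mk _ _ 3 _ _ _ (doubleGlue_root b) h.2.1 h.2.2)
      · exact .refl _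
  arc_step := by
    rintro _ _ ⟨i, j, f, a, p, hg, ha⟩ hne
    rcases doubleGlue_cases hg with ⟨b, i, j, rfl, rfl, hg'⟩ | ⟨b, rfl, rfl, rfl, rfl⟩ |
      ⟨b, rfl, rfl, rfl, rfl⟩
    · exact congrArg (copyArc r b) (R.arc_step (.mk i j f a p hg' ha) hne)
    · exact hR.doubleArc_root b a ha
    · rw [show (attach b)⁻¹ (attach b 3) = 3 from (attach b).symm_apply_apply 3,
        hR.doubleArc_root b _ (inv_attach ha).1, (inv_attach ha).2]
      rfl
  arc_eqv := by
    rintro ⟨_ | ⟨b, i⟩, s⟩ hne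
    · exact .refl _
    · refine (eqvGen_copy_arc h3 b (R.arc_eqv (i, s) hne)).trans _ _ _ ?_
      change EqvGen _ _ (copyArc r b (R.arc (i, s)))
      generalize R.arc (i, s) = t
      obtain ⟨i, a, f⟩ := t
      rw [copyArc]
      split_ifs with h
      · obtain ⟨h1, ha, hf⟩ := h
        simp only at h1 ha hf
        rw [h1, hf]
        exact .rel _ _ (.mk _ _ 3 a _ (doubleGlue_root b) ha)
      · exact .refl _

theorem isRooted_double (hR : R.IsRooted r) (h3 : g r 3 = none) :
    (double hR h3).IsRooted none where
  vertex_zero := rfl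
  vertex_one := rfl
  vertex_two := rfl
  edge _ _ _ _ _ := rfl
  arc _ _ := rfl

end LinkReps

end

open Relation

/-! ### Euler characteristics of the links in a double -/

namespace LinkReps

variable {ι : Type} [DecidableEq ι] {g : Gluing ι} {r : ι} {R : LinkReps g}

theorem copyEdge_eq_iff {b : Bool} {i : ι} {a a' : Fin 4} {t : ι × Fin 4 × Fin 4} :
    copyEdge r b t = (some (b, i), a, a') ↔ t = (i, a, a') ∧ ¬ (i = r ∧ a ≠ 3 ∧ a' ≠ 3) := by
  obtain ⟨j, c, c'⟩ := t
  rw [copyEdge]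
  split_ifs with h
  · simp only [Prod.mk.injEq, reduceCtorEq, false_and, false_iff]
    rintro ⟨⟨rfl, rfl, rfl⟩, h'⟩
    exact h' h
  · simp only [Prod.mk.injEq, Option.some.injEq, true_and]
    refine ⟨?_, fun h => h.1⟩
    rintro ⟨rfl, rfl, rfl⟩
    exact ⟨⟨rfl, rfl, rfl⟩, h⟩

theorem copyArc_eq_iff {b : Bool} {i : ι} {a a' : Fin 4} {t : ι × Fin 4 × Fin 4} :
    copyArc r b t = (some (b, i), a, a') ↔ t = (i, a, a') ∧ ¬ (i = r ∧ a ≠ 3 ∧ a' = 3) := by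
  obtain ⟨j, c, c'⟩ := t
  rw [copyArc]
  split_ifs with h
  · simp only [Prod.mk.injEq, reduceCtorEq, false_and, false_iff]
    rintro ⟨⟨rfl, rfl, rfl⟩, h'⟩
    exact h' h
  · simp only [Prod.mk.injEq, Option.some.injEq, true_and]
    refine ⟨?_, fun h => h.1⟩
    rintro ⟨rfl, rfl, rfl⟩
    exact ⟨⟨rfl, rfl, rfl⟩, h⟩

/-- All edges and arcs of the new tetrahedron represent themselves: 1 + 3 − 3. -/
theorem weight_double_none (hR : R.IsRooted r) (h3 : g r 3 = none) (a : Fin 4) :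
    (double hR h3).weight (none, a) = 1 := by
  simp [weight, double, doubleEdge, doubleArc]

/-- Whether the corner belongs to the face at which the triangulation is doubled. -/
def rootCorner (r : ι) (c : ι × Fin 4) : ℤ := if c.1 = r ∧ c.2 ≠ 3 then 1 else 0

/-- A corner on the glued face gives up two edge ends and one arc to the new tetrahedron, so its
weight drops by 1. -/
theorem weight_double_some (hR : R.IsRooted r) (h3 : g r 3 = none) (b : Bool) (i : ι) (a : Fin 4) :
    (double hR h3).weight (some (b, i), a) = R.weight (i, a) - rootCorner r (i, a) := by
  simp only [weight, double, doubleEdge, doubleArc, copyEdge_eq_iff, copyArc_eq_iff, rootCorner]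
  by_cases hi : i = r
  · subst hi
    match a with
    | 0 => simp [Fin.sum_univ_four, hR.edge, hR.arc]; ring
    | 1 => simp [Fin.sum_univ_four, hR.edge, hR.arc]; ring
    | 2 => simp [Fin.sum_univ_four, hR.edge, hR.arc]; ring
    | 3 => simp [Fin.sum_univ_four]
  · simp [hi]

theorem copyVertex_eq_none_one {b : Bool} {c : ι × Fin 4} :
    copyVertex r b c = (none, 1) ↔ b = true ∧ c = (r, 1) := by
  rw [copyVertex]
  split_ifs with h0 h1 hb
  · simp [h0]
  · simp [h1, hb]
  · simp [hb]
  · simp [h1]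

theorem copyVertex_eq_none_zero {b : Bool} {c : ι × Fin 4} :
    copyVertex r b c = (none, 0) ↔ c = (r, 0) ∨ (b = false ∧ c = (r, 1)) := by
  rw [copyVertex]
  split_ifs with h0 h1 hb
  · simp [h0]
  · simp [h1, hb]
  · simp [h1, hb]
  · simp [h0, h1]

theorem copyVertex_eq_some {b b' : Bool} {c u : ι × Fin 4} (h0 : u ≠ (r, 0)) (h1 : u ≠ (r, 1)) :
    copyVertex r b c = (some (b', u.1), u.2) ↔ b = b' ∧ c = u := by
  rw [copyVertex]
  split_ifs with h h' hb
  · simp [h, h0.symm]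
  · simp [h', h1.symm]
  · simp [h', h1.symm]
  · simp [Prod.ext_iff, and_assoc]

variable [Fintype ι]

theorem sum_rootCorner (hR : R.IsRooted r) (u : ι × Fin 4) :
    (∑ c, if R.vertex c = u then rootCorner r c else 0) =
      2 * (if u = (r, 0) then 1 else 0) + if u = (r, 1) then 1 else 0 := by
  rw [Fintype.sum_prod_type, Finset.sum_eq_single r]
  · rw [Fin.sum_univ_four, hR.vertex_zero, hR.vertex_one, hR.vertex_two]
    simp only [rootCorner, eq_comm (a := u)]
    split_ifs <;> simp_all
  · intro i _ hi
    simp [rootCorner, hi]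
  · simp

theorem sum_copy (hR : R.IsRooted r) (u : ι × Fin 4) :
    (∑ c, if R.vertex c = u then R.weight c - rootCorner r c else 0) =
      R.euler u - (2 * (if u = (r, 0) then 1 else 0) + if u = (r, 1) then 1 else 0) := by
  rw [← sum_rootCorner hR, euler, ← Finset.sum_sub_distrib]
  refine Finset.sum_congr rfl fun c _ => ?_
  split_ifs <;> simp

theorem euler_double (hR : R.IsRooted r) (h3 : g r 3 = none) (v : Option (Bool × ι) × Fin 4) :
    (double hR h3).euler v = (∑ a, if R.doubleVertex r (none, a) = v then 1 else 0) +
      ∑ b, ∑ c, if copyVertex r b (R.vertex c) = v then R.weight c - rootCorner r c else 0 := by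
  rw [euler, Fintype.sum_prod_type, Fintype.sum_option, Fintype.sum_prod_type]
  simp only [weight_double_none, weight_double_some, Fintype.sum_prod_type]
  rfl

/-- Vertex 1 of the new tetrahedron only meets the first copy: one new triangle, one corner of the
glued face. -/
theorem euler_double_one (hR : R.IsRooted r) (h3 : g r 3 = none) :
    (double hR h3).euler (none, 1) = R.euler (r, 1) := by
  rw [euler_double]
  simp only [copyVertex_eq_none_one, Fintype.sum_bool, true_and, Bool.false_eq_true, false_and,
    if_false, Finset.sum_const_zero, sum_copy hR]
  simp [doubleVertex]

/-- Three new triangles (at 0, 2, 3) are added. Each copy contributes its link at 0, with two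
corners on the glued face, and the second copy also its link at 1, with one such corner: 3 + 2(e₀ −
2) + (e₁ − 1). -/
theorem euler_double_zero (hR : R.IsRooted r) (h3 : g r 3 = none) :
    (double hR h3).euler (none, 0) = 2 * R.euler (r, 0) + R.euler (r, 1) - 2 := by
  have hsplit : ∀ c, (if R.vertex c = (r, 0) ∨ R.vertex c = (r, 1) then
      R.weight c - rootCorner r c else 0) =
      (if R.vertex c = (r, 0) then R.weight c - rootCorner r c else 0) +
      if R.vertex c = (r, 1) then R.weight c - rootCorner r c else 0 := fun c => by
    by_cases h : R.vertex c = (r, 0)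
    · simp [h]
    · simp [h]
  rw [euler_double]
  simp only [copyVertex_eq_none_zero, Fintype.sum_bool, true_and, Bool.true_eq_false, false_and,
    or_false, hsplit, Finset.sum_add_distrib, sum_copy hR]
  simp [Fin.sum_univ_four, doubleVertex]
  ring

theorem euler_double_some (hR : R.IsRooted r) (h3 : g r 3 = none) (b : Bool) {u : ι × Fin 4}
    (h0 : u ≠ (r, 0)) (h1 : u ≠ (r, 1)) :
    (double hR h3).euler (some (b, u.1), u.2) = R.euler u := by
  have hn : ∀ a, R.doubleVertex r (none, a) ≠ (some (b, u.1), u.2) := fun a => by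
    rw [doubleVertex]
    split_ifs <;> simp
  rw [euler_double]
  simp only [copyVertex_eq_some h0 h1, hn, if_false, Finset.sum_const_zero, zero_add]
  cases b <;> simp [sum_copy hR, h0, h1]

end LinkReps

/-! ### The inductive construction -/

/-- The properties of a triangulation that are inherited by its double. -/
structure IsGood (T : Triangulation) (r : T.Tet) : Prop where
  boundary : T.glue r 3 = none
  manifold : T.IsManifold
  rank : ∃ rank : T.Tet → Fin 4 → ℕ, IsRank T.glue rank ∧ rank r = rootRank
  reps : ∃ R : LinkReps T.glue, R.IsRooted r

namespace IsGood

open LinkReps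

variable {T : Triangulation} {r : T.Tet}

open Classical in
/-- The double of a triangulation. -/
noncomputable def double (h : IsGood T r) : Triangulation where
  Tet := Option (Bool × T.Tet)
  finite := by have := T.finite; infer_instance
  glue := doubleGlue T.glue r
  glue_symm := doubleGlue_symm h.boundary T.glue_symm
  glue_ne_self := doubleGlue_ne_self T.glue_ne_self
  edge_not_reversed := by
    obtain ⟨rank, hrank, hr⟩ := h.rank
    exact not_eqvGen_reverse_of_rank (hrank.double hr).injective (hrank.double hr).step

theorem isStdDoubling (h : IsGood T r) : IsStdDoubling T r h.double (Equiv.refl _) where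
  boundary := h.boundary
  copy b i f hne := by
    classical
    have : ¬ (i = r ∧ f = 3) := fun h => hne (Prod.ext h.1 h.2)
    change doubleGlue T.glue r (some (b, i)) f = _
    simp only [doubleGlue, this, if_false]
    rfl
  root b := by classical exact doubleGlue_root (g := T.glue) b
  free f hf := by
    classical
    change doubleGlue T.glue r none f = none
    have h2 : f ≠ 2 := hf true
    have h1 : f ≠ 1 := hf false
    simp [doubleGlue, h1, h2]

theorem linkHasBoundary (h : IsGood T r) {R : LinkReps T.glue} {v : T.Tet × Fin 4} {a : Fin 4}
    (ha : a ≠ 3) (hv : R.vertex v = R.vertex (r, a)) : T.LinkHasBoundary v :=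
  ⟨(r, a, 3), R.mem_linkFlags.2 ⟨hv.symm, ha.symm⟩, h.boundary⟩

theorem euler_eq_one [Fintype T.Tet] [DecidableEq T.Tet] (h : IsGood T r) {R : LinkReps T.glue}
    {a : Fin 4} (ha : a ≠ 3) : R.euler (R.vertex (r, a)) = 1 := by
  rw [← R.linkEulerChar_eq]
  rcases h.manifold (r, a) with hs | hd
  · exact absurd (h.linkHasBoundary ha (R := R) rfl) hs.1
  · exact hd.2

/-- The links at the marked face of `T` have boundary, hence are discs with e₀ = e₁ = 1, and the
formulas give 1 again; the free face keeps their boundary non-empty. The remaining links and their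
boundaries are copied unchanged. -/
theorem isManifold_double (h : IsGood T r) : h.double.IsManifold := by
  classical
  have := T.finite
  have : Fintype T.Tet := Fintype.ofFinite _
  let : Fintype h.double.Tet := (inferInstance : Fintype (Option (Bool × T.Tet)))
  let : DecidableEq h.double.Tet := (inferInstance : DecidableEq (Option (Bool × T.Tet)))
  obtain ⟨R, hR⟩ := h.reps
  have e0 : R.euler (r, 0) = 1 := by
    have := h.euler_eq_one (R := R) (a := 0) (by decide)
    rwa [hR.vertex_zero] at this
  have e1 : R.euler (r, 1) = 1 := by
    have := h.euler_eq_one (R := R) (a := 1) (by decide)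
    rwa [hR.vertex_one] at this
  let D : LinkReps h.double.glue := LinkReps.double hR h.boundary
  have hbd : ∀ {v : h.double.Tet × Fin 4} {a : Fin 4}, a ≠ 3 → D.vertex v = D.vertex (none, a) →
      h.double.LinkHasBoundary v := fun {v a} ha hv =>
    ⟨((none : Option (Bool × T.Tet)), a, 3), D.mem_linkFlags.2 ⟨hv.symm, ha.symm⟩, rfl⟩
  have hroot : ∀ v, (D.vertex v = (none, 0) ∨ D.vertex v = (none, 1)) → h.double.LinkIsDisc v := by
    rintro v (hv | hv)
    · refine ⟨hbd (a := 0) (by decide) hv, ?_⟩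
      rw [D.linkEulerChar_eq, hv]
      exact (euler_double_zero hR h.boundary).trans (by rw [e0, e1]; rfl)
    · refine ⟨hbd (a := 1) (by decide) hv, ?_⟩
      rw [D.linkEulerChar_eq, hv]
      exact (euler_double_one hR h.boundary).trans e1
  rintro ⟨_ | ⟨b, i⟩, a⟩
  · refine Or.inr (hroot _ ?_)
    change (if a = 1 then (none, 1) else (none, 0)) = _ ∨ (if a = 1 then (none, 1) else (none, 0)) = _
    by_cases ha : a = 1
    · exact Or.inr (if_pos ha)
    · exact Or.inl (if_neg ha)
  · have hD : ∀ i a, D.vertex (some (b, i), a) = copyVertex r b (R.vertex (i, a)) := fun _ _ => rfl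
    by_cases h0 : R.vertex (i, a) = (r, 0)
    · refine Or.inr (hroot _ (Or.inl ?_))
      rw [hD, copyVertex, if_pos h0]
    by_cases h1 : R.vertex (i, a) = (r, 1)
    · refine Or.inr (hroot _ ?_)
      rw [hD, copyVertex, if_neg h0, if_pos h1]
      cases b
      · exact Or.inl rfl
      · exact Or.inr rfl
    have hv : D.vertex (some (b, i), a) = (some (b, (R.vertex (i, a)).1), (R.vertex (i, a)).2) := by
      rw [hD, copyVertex, if_neg h0, if_neg h1]
    have he : h.double.linkEulerChar (some (b, i), a) = T.linkEulerChar (i, a) := by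
      rw [D.linkEulerChar_eq, R.linkEulerChar_eq, hv]
      exact euler_double_some hR h.boundary b h0 h1
    have hb : h.double.LinkHasBoundary (some (b, i), a) ↔ T.LinkHasBoundary (i, a) := by
      constructor
      · rintro ⟨⟨_ | ⟨b', i'⟩, a', f⟩, hs, hbd⟩
        · have := (D.mem_linkFlags.1 hs).1
          rw [hv] at this
          change (if a' = 1 then (none, 1) else (none, 0)) = _ at this
          split_ifs at this <;>
          · exact absurd (congrArg Prod.fst this) (Option.some_ne_none _).symm
        · have hs' := D.mem_linkFlags.1 hs
          rw [hv] at hs'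
          have hu := ((copyVertex_eq_some h0 h1).1 hs'.1).2
          refine ⟨(i', a', f), R.mem_linkFlags.2 ⟨hu, hs'.2⟩, ?_⟩
          change doubleGlue T.glue r (some (b', i')) f = none at hbd
          rw [doubleGlue] at hbd
          split_ifs at hbd
          exact Option.map_eq_none_iff.1 hbd
      · rintro ⟨⟨i', a', f⟩, hs, hbd⟩
        have hs' := R.mem_linkFlags.1 hs
        refine ⟨((some (b, i') : Option (Bool × T.Tet)), a', f), D.mem_linkFlags.2
          ⟨congrArg (copyVertex r b) hs'.1, hs'.2⟩, ?_⟩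
        change doubleGlue T.glue r (some (b, i')) f = none
        -- A boundary side in the glued face would belong to the link of one of the excluded
        -- vertices.
        have hne : ¬ (i' = r ∧ f = 3) := by
          rintro ⟨rfl, rfl⟩
          obtain ⟨hu, ha'⟩ := hs'
          simp only at hu ha'
          rw [← hu] at h0 h1
          match a' with
          | 0 => exact h0 hR.vertex_zero
          | 1 => exact h1 hR.vertex_one
          | 2 => exact h0 hR.vertex_two
          | 3 => exact ha' rfl
        rw [doubleGlue, if_neg hne]
        exact Option.map_eq_none_iff.2 hbd
    unfold Triangulation.LinkIsSphere Triangulation.LinkIsDisc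
    rw [hb, he]
    exact h.manifold (i, a)

theorem isGood_double (h : IsGood T r) : IsGood h.double (none : Option (Bool × T.Tet)) where
  boundary := rfl
  manifold := h.isManifold_double
  rank := by
    classical
    obtain ⟨rank, hrank, hr⟩ := h.rank
    exact ⟨doubleRank rank, hrank.double hr, rfl⟩
  reps := by
    classical
    obtain ⟨R, hR⟩ := h.reps
    exact ⟨LinkReps.double hR h.boundary, isRooted_double hR h.boundary⟩

theorem numTet_double (h : IsGood T r) : h.double.numTet = 2 * T.numTet + 1 := by
  have := T.finite
  change Nat.card (Option (Bool × T.Tet)) = 2 * Nat.card T.Tet + 1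
  rw [Finite.card_option, Nat.card_prod, Nat.card_eq_fintype_card, Fintype.card_bool]

theorem sq_alpha_le_double (h : IsGood T r) : T.alpha (r, 3) 0 ^ 2 ≤
    h.double.alpha ((none : Option (Bool × T.Tet)), 3) 0 := by
  classical
  have := T.finite
  have := h.double.finite
  have : Fintype T.Tet := Fintype.ofFinite _
  have : Fintype h.double.Tet := Fintype.ofFinite _
  exact h.isStdDoubling.sq_alpha_le

end IsGood

open Relation

/-! ### Vertex links of the explicit triangulation -/

namespace TriG

/-- The corner across face `f`, if there is one. -/
def crossVertex (c : Fin 11 × Fin 4) (f : Fin 4) : Fin 11 × Fin 4 :=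
  match glue c.1 f with
  | none => c
  | some (j, p) => if c.2 ≠ f then (j, p c.2) else c

def crossEdge (s : Fin 11 × Fin 4 × Fin 4) (f : Fin 4) : Fin 11 × Fin 4 × Fin 4 :=
  match glue s.1 f with
  | none => s
  | some (j, p) => if s.2.1 ≠ f ∧ s.2.2 ≠ f then (j, p s.2.1, p s.2.2) else s

theorem eqvGen_crossVertex (c : Fin 11 × Fin 4) (f : Fin 4) :
    EqvGen (VertexStep glue) c (crossVertex c f) := by
  rw [crossVertex]
  cases h : glue c.1 f with
  | none => exact .refl _
  | some jp =>
    by_cases hc : c.2 ≠ f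
    · simp only [hc, ne_eq, not_false_eq_true, if_true]
      exact .rel _ _ (.mk _ _ f _ _ h hc)
    · simp only [hc, if_false]
      exact .refl _

theorem eqvGen_crossEdge (s : Fin 11 × Fin 4 × Fin 4) (f : Fin 4) :
    EqvGen (EdgeStep glue) s (crossEdge s f) := by
  rw [crossEdge]
  cases h : glue s.1 f with
  | none => exact .refl _
  | some jp =>
    by_cases hc : s.2.1 ≠ f ∧ s.2.2 ≠ f
    · simp only [if_pos hc]
      exact .rel _ _ (.mk _ _ f _ _ _ h hc.1 hc.2)
    · simp only [if_neg hc]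
      exact .refl _

/-- The face through which a corner is moved towards its representative. -/
def vertexFace (i : Fin 11) : Fin 4 → Option (Fin 4) :=
  if i = 0 then ![none, none, some 1, some 2] else
  if i < 3 then ![some 3, some 3, some 1, some 2] else
  if i < 7 then ![some 3, some 3, some 1, some 1] else ![some 1, some 0, some 0, some 0]

/-- The face through which an edge is moved towards its representative. -/
def edgeFace (i : Fin 11) (a b : Fin 4) : Option (Fin 4) :=
  if i = 0 then none else
  if i < 7 then if a ≠ 3 ∧ b ≠ 3 then some 3 else
    if 3 ≤ i ∧ a ≠ 0 ∧ a ≠ 1 ∧ b ≠ 0 ∧ b ≠ 1 then some 1 else none else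
  if a ≠ 0 ∧ b ≠ 0 then some 0 else if a ≠ 1 ∧ b ≠ 1 then some 1 else none

def vertexParent (c : Fin 11 × Fin 4) : Fin 11 × Fin 4 :=
  (vertexFace c.1 c.2).elim c (crossVertex c)

def edgeParent (s : Fin 11 × Fin 4 × Fin 4) : Fin 11 × Fin 4 × Fin 4 :=
  (edgeFace s.1 s.2.1 s.2.2).elim s (crossEdge s)

theorem eqvGen_iterate {α : Type} {step : α → α → Prop} {parent : α → α}
    (h : ∀ s, EqvGen step s (parent s)) (n : ℕ) (s : α) : EqvGen step s (parent^[n] s) := by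
  induction n generalizing s with
  | zero => exact .refl _
  | succ n ih => exact (h s).trans _ _ _ (ih (parent s))

/-- Corners are moved towards tetrahedron 0; that eleven moves (four for edges) reach a common
representative is confirmed by `vertexRep_step` and `edgeRep_step`. -/
def vertexRep : Fin 11 × Fin 4 → Fin 11 × Fin 4 := vertexParent^[11]

def edgeRep : Fin 11 × Fin 4 × Fin 4 → Fin 11 × Fin 4 × Fin 4 := edgeParent^[4]

/-- An arc type lies in at most two tetrahedra, which are different here; the one with the smaller
number represents it. -/
def arcRep (s : Fin 11 × Fin 4 × Fin 4) : Fin 11 × Fin 4 × Fin 4 :=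
  match glue s.1 s.2.2 with
  | none => s
  | some (j, p) => if j < s.1 then (j, p s.2.1, p s.2.2) else s

theorem vertexRep_step : ∀ (i : Fin 11) (f : Fin 4), ∀ jp ∈ glue i f, ∀ a, a ≠ f →
    vertexRep (i, a) = vertexRep (jp.1, jp.2 a) := by
  decide +kernel

theorem edgeRep_step : ∀ (i : Fin 11) (f : Fin 4), ∀ jp ∈ glue i f, ∀ a b, a ≠ f → b ≠ f → b ≠ a →
    edgeRep (i, a, b) = edgeRep (jp.1, jp.2 a, jp.2 b) := by
  decide +kernel

theorem arcRep_step : ∀ (i : Fin 11) (f : Fin 4), ∀ jp ∈ glue i f, ∀ a, a ≠ f →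
    arcRep (i, a, f) = arcRep (jp.1, jp.2 a, jp.2 f) := by
  decide +kernel

def linkReps : LinkReps glue where
  vertex := vertexRep
  edge := edgeRep
  arc := arcRep
  vertex_step := by
    rintro _ _ ⟨i, j, f, a, p, hg, ha⟩
    exact vertexRep_step i f (j, p) hg a ha
  vertex_eqv := eqvGen_iterate (fun c => by
    rw [vertexParent]
    cases vertexFace c.1 c.2 with
    | none => exact .refl _
    | some f => exact eqvGen_crossVertex c f) 11
  edge_step := by
    rintro _ _ ⟨i, j, f, a, b, p, hg, ha, hb⟩ hne
    exact edgeRep_step i f (j, p) hg a b ha hb hne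
  edge_eqv s _ := eqvGen_iterate (fun s => by
    rw [edgeParent]
    cases edgeFace s.1 s.2.1 s.2.2 with
    | none => exact .refl _
    | some f => exact eqvGen_crossEdge s f) 4 s
  arc_step := by
    rintro _ _ ⟨i, j, f, a, p, hg, ha⟩ _
    exact arcRep_step i f (j, p) hg a ha
  arc_eqv s hs := by
    rw [arcRep]
    cases h : glue s.1 s.2.2 with
    | none => exact .refl _
    | some jp =>
      by_cases hj : jp.1 < s.1
      · simp only [hj, if_true]
        exact .rel _ _ (.mk _ _ _ _ _ h hs.symm)
      · simp only [hj, if_false]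
        exact .refl _

theorem isRooted_linkReps : linkReps.IsRooted 0 where
  vertex_zero := by decide +kernel
  vertex_one := by decide +kernel
  vertex_two := by decide +kernel
  edge := by
    change ∀ a b : Fin 4, a ≠ 3 → b ≠ 3 → b ≠ a → edgeRep (0, a, b) = (0, a, b)
    decide +kernel
  arc := by
    change ∀ a : Fin 4, a ≠ 3 → arcRep (0, a, 3) = (0, a, 3)
    decide +kernel

/-- The triangulation has just two vertices, so two Euler characteristics have to be computed. -/
theorem vertexRep_cases : ∀ c : Fin 11 × Fin 4,
    linkReps.vertex c = (0, 0) ∨ linkReps.vertex c = (0, 1) := by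
  decide +kernel

theorem euler_zero : linkReps.euler (0, 0) = 1 := by decide +kernel

theorem euler_one : linkReps.euler (0, 1) = 1 := by decide +kernel

end TriG

theorem isManifold_triG : triG.IsManifold := by
  let R : LinkReps triG.glue := TriG.linkReps
  have h0 : R.vertex ((0 : Fin 11), 0) = ((0 : Fin 11), 0) := TriG.isRooted_linkReps.vertex_zero
  have h1 : R.vertex ((0 : Fin 11), 1) = ((0 : Fin 11), 1) := TriG.isRooted_linkReps.vertex_one
  have e0 : R.euler ((0 : Fin 11), 0) = 1 := TriG.euler_zero
  have e1 : R.euler ((0 : Fin 11), 1) = 1 := TriG.euler_one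
  have key : ∀ v, R.vertex v = ((0 : Fin 11), 0) ∨ R.vertex v = ((0 : Fin 11), 1) :=
    TriG.vertexRep_cases
  clear_value R
  intro v
  refine Or.inr ?_
  rcases key v with h | h
  · refine ⟨⟨((0 : Fin 11), 0, 3), R.mem_linkFlags.2 ⟨h0.trans h.symm, by decide⟩, rfl⟩, ?_⟩
    rw [R.linkEulerChar_eq, h]
    exact e0
  · refine ⟨⟨((0 : Fin 11), 1, 3), R.mem_linkFlags.2 ⟨h1.trans h.symm, by decide⟩, rfl⟩, ?_⟩
    rw [R.linkEulerChar_eq, h]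
    exact e1

theorem isGood_triG : IsGood triG (0 : Fin 11) where
  boundary := rfl
  manifold := isManifold_triG
  rank := ⟨fun i a => (TriG.rank i a : ℕ), ⟨by
    change ∀ i : Fin 11, Function.Injective fun a => (TriG.rank i a : ℕ)
    decide +kernel, fun i f j p hg a b ha hb h =>
      (TriG.rank_step i f (j, p) hg a b ha hb).1 h⟩, by
    change (fun a => (TriG.rank 0 a : ℕ)) = rootRank
    decide +kernel⟩
  reps := ⟨TriG.linkReps, TriG.isRooted_linkReps⟩

/-- A triangulation to which the doubling construction can be applied. -/
structure GoodTriangulation where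
  tri : Triangulation
  root : tri.Tet
  good : IsGood tri root

/-! ### The sequence of iterated doubles and its growth -/

namespace GoodTriangulation

def marked (S : GoodTriangulation) : MarkedTriangulation := ⟨S.tri, (S.root, 3)⟩

noncomputable def next (S : GoodTriangulation) : GoodTriangulation :=
  ⟨S.good.double, (none : Option (Bool × S.tri.Tet)), S.good.isGood_double⟩

theorem isDoubling_next (S : GoodTriangulation) : IsDoubling S.marked S.next.marked :=
  S.good.isStdDoubling.isDoubling

/-- The iterated doubles of `triG`. -/
noncomputable def iterate : ℕ → GoodTriangulation
  | 0 => ⟨triG, (0 : Fin 11), isGood_triG⟩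
  | k + 1 => (iterate k).next

/-- A double has 2n + 1 tetrahedra, so n + 1 doubles in each step. -/
theorem numTet_iterate (k : ℕ) : (iterate k).tri.numTet + 1 = 12 * 2 ^ k := by
  induction k with
  | zero =>
    change Nat.card (Fin 11) + 1 = _
    rw [Nat.card_fin]; rfl
  | succ k ih =>
    have := (iterate k).good.numTet_double
    change (iterate k).good.double.numTet + 1 = _
    rw [this, pow_succ]
    omega

theorem pow_le_alpha_iterate (k : ℕ) :
    31643 ^ 2 ^ k ≤ (iterate k).tri.alpha ((iterate k).root, 3) 0 := by
  induction k with
  | zero => exact TriH.alpha_triG.ge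
  | succ k ih =>
    refine le_trans ?_ (iterate k).good.sq_alpha_le_double
    rw [pow_succ 2 k, pow_mul]
    exact Nat.pow_le_pow_left ih 2

theorem alpha_le_sigma (S : GoodTriangulation) :
    S.tri.alpha (S.root, 3) 0 ≤ S.tri.sigma := by
  classical
  have := S.tri.finite
  have : Fintype S.tri.Tet := Fintype.ofFinite _
  exact Triangulation.alpha_le_sigma _ _

theorem pow_le_sigma_iterate (k : ℕ) :
    (2.3715 : ℝ) ^ (iterate k).tri.numTet ≤ ((iterate k).tri.sigma : ℝ) := by
  have h : (31643 : ℝ) ^ 2 ^ k ≤ (iterate k).tri.sigma := by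
    exact_mod_cast (pow_le_alpha_iterate k).trans (iterate k).alpha_le_sigma
  refine le_trans ?_ h
  -- Raising the exponent from n to n + 1 makes it exactly 12·2^k.
  calc (2.3715 : ℝ) ^ (iterate k).tri.numTet ≤ 2.3715 ^ ((iterate k).tri.numTet + 1) :=
        pow_le_pow_right₀ (by norm_num) (Nat.le_succ _)
    _ = (2.3715 ^ 12) ^ 2 ^ k := by rw [numTet_iterate, pow_mul]
    -- The twelfth root of 31643 is just above 2.3715.
    _ ≤ 31643 ^ 2 ^ k := pow_le_pow_left₀ (by norm_num) (by norm_num) _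

end GoodTriangulation

theorem corollary3 :
    -- the starting triangulation, its face `0(012)` and the arc type around vertex `0`
    triG.numTet = 11 ∧ triG.IsBounded ∧ triG.IsManifold ∧
    triG.IsBoundaryFace triGFace ∧
    (∃ a b : Fin 4, a ≠ triGFace.2 ∧ b ≠ triGFace.2 ∧
      ¬ triG.SameVertex (triGFace.1, a) (triGFace.1, b)) ∧
    triG.alpha triGFace 0 = 31643 ∧
    -- the family that starts from it by repeated doubling
    ∃ G : ℕ → MarkedTriangulation,
      G 0 = ⟨triG, triGFace⟩ ∧
      (∀ k, IsDoubling (G k) (G (k + 1))) ∧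
      ∀ k, (G k).1.IsBounded ∧ (G k).1.IsManifold ∧
        ((G k).1.numTet : ℤ) = 12 * 2 ^ k - 1 ∧
        (2.3715 : ℝ) ^ (G k).1.numTet ≤ ((G k).1.sigma : ℝ) := by
  refine ⟨Nat.card_fin 11, ⟨triGFace, rfl⟩, isManifold_triG, rfl,
    ⟨0, 1, by decide, by decide, fun h => ?_⟩, TriH.alpha_triG,
    fun k => (GoodTriangulation.iterate k).marked, rfl,
    fun k => (GoodTriangulation.iterate k).isDoubling_next, fun k => ⟨⟨((GoodTriangulation.iterate k).root, 3),
      (GoodTriangulation.iterate k).good.boundary⟩, (GoodTriangulation.iterate k).good.manifold, ?_,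
      GoodTriangulation.pow_le_sigma_iterate k⟩⟩
  -- The two corners have different representatives.
  · have h' := (LinkReps.sameVertex_iff (T := triG) TriG.linkReps).1 h
    exact absurd (TriG.isRooted_linkReps.vertex_zero.symm.trans
      (h'.trans TriG.isRooted_linkReps.vertex_one)) (by decide)
  · have := GoodTriangulation.numTet_iterate k
    change ((GoodTriangulation.iterate k).tri.numTet : ℤ) = _
    rw [eq_sub_iff_add_eq]
    exact_mod_cast this
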